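/- **Setting.** Let $0<q<1$, let $a,b,c,d\in\mathbb{C}\setminus\{0\}$, and write $(x;q)_n=\prod_{l=0}^{n-1}(1-xq^l)$, $(x;q)_\infty=\prod_{l\ge 0}(1-xq^l)$, $(x_1,\dots,x_r;q)_n=\prod_i (x_i;q)_n$. The Askey–Wilson polynomials are $$p_n(x)=\frac{(ab,ac,ad;q)_n}{a^n}\sum_{l=0}^{n}\frac{(q^{-n},abcdq^{n-1},az,a/z;q)_l}{(ab,ac,ad,q;q)_l}\,q^l,\qquad x=\tfrac12\left(z+\tfrac1z\right),$$ for $n\ge 0$ (where $(ab;q)_n/(ab;q)_l$ is read as $(abq^l;q)_{n-l}$, and similarly for $ac,ad$), and $p_n=0$ for $n<0$. For $\gamma\in\mathbb{C}$ put $\lambda_\gamma=(q^{-\gamma}-1)(1-abcdq^{\gamma-1})$ and $$\xi^a_\gamma=\frac{q^\gamma(abcd/q,bcq^\gamma,bdq^\gamma,cdq^\gamma,q^{\gamma+1};q)_\infty}{a^\gamma(abcdq^{\gamma-1},bc,bd,cd,q;q)_\infty},$$ and let $\xi^b,\xi^c,\xi^d$ be obtained by replacing $(a,b,c,d)$ with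 $(b,c,d,a)$, $(c,d,a,b)$, $(d,a,b,c)$. Let $\mathrm{Wr}_\gamma(h^{(1)},\dots,h^{(m)})=\det\big(h^{(i)}_{\gamma-j+1}\big)_{1\le i,j\le m}$. Let $\phi^{(1)},\dots,\phi^{(k)}$ be polynomials with complex coefficients, let $\delta_1,\dots,\delta_k\in\{a,b,c,d\}$, $\delta_{k+1}=a$, and set $\psi^{(j)}_\gamma=\phi^{(j)}(\lambda_\gamma)/\xi^{\delta_j}_\gamma$. Let $$\eta^{b,j}_\gamma=q^{-\gamma(k-1)}(bcq^{\gamma-j+1},bdq^{\gamma-j+1};q)_{j-1}(acq^{\gamma-k+1},adq^{\gamma-k+1};q)_{k-j},$$ let $\eta^{c,j},\eta^{d,j}$ be obtained by replacing $(a,b,c,d)$ with $(a,c,b,d)$ and $(a,d,c,b)$, and put $$\chi_\gamma=\prod_{j=1}^{k+1}\xi^{\delta_j}_{\gamma-j+1}\prod_{1\le j\le k,\ \delta_j\ne a}\eta^{\delta_j,j}_\gamma,\qquad \tau_\gamma=\chi_\gamma\prod_{j=1}^{k+1}\frac1{\xi^a_{\gamma-j+1}}\,\mathrm{Wr}_\gamma(\xi^a\psi^{(1)},\dots,\xi^a\psi^{(k)}).$$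 All these are meromorphic in $\gamma$ (when the constants $(bc,bd,cd;q)_\infty$, etc., in the denominators are nonzero, which is part of the assumptions below), $\tau_\gamma$ is a Laurent polynomial in $q^\gamma$, and values at integers are values of the meromorphic functions. Define $$\hat p_n(x)=\chi_n\,\mathrm{Wr}_n(\psi^{(1)}_n,\dots,\psi^{(k)}_n,p_n(x))=\sum_{l=0}^{k}Q^{(-l)}_n\,p_{n-l}(x),\qquad n=0,1,2,\dots,$$ where $Q^{(-l)}_\gamma$ is the coefficient of $f_{\gamma-l}$ in $\chi_\gamma\mathrm{Wr}_\gamma(\psi^{(1)},\dots,\psi^{(k)},f)$. **Assumptions.** $\tau_n\neq 0$ for $n=-1,0,1,\dots$, and $\chi_n\xi^a_{n-k-1}/\chi_{n-1}$ is well defined (finite) and nonzero for $n=0,1,2,\dots$. **The two algebras.** Let $$A_\gamma=\frac{1-abcdq^{\gamma-1}}{(1-abcdq^{2\gamma-1})(1-abcdq^{2\gamma})},$$ $$B_\gamma=\frac{q^{\gamma-1}\left[(1+abcdq^{2\gamma-1})(sq+s'abcd)-q^{\gamma-1}(1+q)abcd(s+s'q)\right]}{(1-abcdq^{2\gamma-2})(1-abcdq^{2\gamma})},$$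 $$C_\gamma=\frac{(1-q^\gamma)\prod_{uv}(1-uvq^{\gamma-1})}{(1-abcdq^{2\gamma-2})(1-abcdq^{2\gamma-1})},$$ where $s=a+b+c+d$, $s'=a^{-1}+b^{-1}+c^{-1}+d^{-1}$, and $uv$ runs over $ab,ac,ad,bc,bd,cd$. Fix any $\varepsilon\in\mathbb{C}$ such that for $\gamma=n+\varepsilon$ and all $n\in\mathbb{Z}$ the denominators above do not vanish and $A_\gamma\ne0$, $C_\gamma\neq 0$. Let $\mathcal{L}_\gamma$ act on functions of $n\in\mathbb{Z}$ by $(\mathcal{L}_\gamma u)_n=A_{n+\varepsilon}u_{n+1}+B_{n+\varepsilon}u_n+C_{n+\varepsilon}u_{n-1}$, let $W$ be the span of the functions $n\mapsto\psi^{(j)}_{n+\varepsilon}$, $j=1,\dots,k$, and put $$\mathfrak{A}_z=\{f(z+1/z)\in\mathbb{C}[z+1/z]: f(\mathcal{L}_\gamma)W\subset W\},$$ $$\mathfrak{A}_n=\Big\{h(\lambda_{n-k/2})\in\mathbb{C}[\lambda_{n-k/2}]:\ \frac{h(\lambda_{n-k/2})-h(\lambda_{n-k/2-1})}{\tau_{n-1}}\in\mathbb{C}[q^n,q^{-n}]\Big\}.$$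 **Theorem 3.1.** For every $f(z+1/z)\in\mathfrak{A}_z$ there is a difference operator $\hat{\mathcal L}^f_n=\sum_{|j|\le N}M^{(j)}_nE_n^j$ acting on functions of $n\in\mathbb{N}_0$ (with $E_n^ju_n=u_{n+j}$, terms with $n+j<0$ being absent), whose coefficients are independent of $z$, and for every $h(\lambda_{n-k/2})\in\mathfrak{A}_n$ there is a $q$-difference operator $\hat{\mathcal B}^h_z=\sum_{|j|\le N}\beta_j(z)D_z^j$ with coefficients $\beta_j\in\mathbb{C}(z)$ independent of $n$ (with $D_z^jr(z)=r(q^jz)$), such that for all $n\in\mathbb{N}_0$, with $x=\frac12(z+\frac1z)$, $$\hat{\mathcal L}^f_n\,\hat p_n(x)=f(z+1/z)\,\hat p_n(x),\qquad \hat{\mathcal B}^h_z\,\hat p_n(x)=h(\lambda_{n-k/2})\,\hat p_n(x).$$ These operators can be chosen so that $\mathfrak{D}_n=\{\hat{\mathcal L}^f_n: f\in\mathfrak{A}_z\}$ is a commutative algebra of difference operators in $n$, isomorphic to $\mathfrak{A}_z$ via $f\mapsto\hat{\mathcal L}^f_n$, and $\mathfrak{D}_z=\{\hat{\mathcal B}^h_z: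 h\in\mathfrak{A}_n\}$ is a commutative algebra of $q$-difference operators in $z$, isomorphic to $\mathfrak{A}_n$ via $h\mapsto\hat{\mathcal B}^h_z$. Thus both algebras are diagonalized by the polynomials $\hat p_n(x)$. -/

import Mathlib

open Filter Topology Polynomial

noncomputable section

namespace AWExt

/-- The finite `q`-shifted factorial `(x;q)_n`. -/
def qPoch (q x : ℂ) (n : ℕ) : ℂ := ∏ l ∈ Finset.range n, (1 - x * q ^ l)

/-- The infinite `q`-shifted factorial `(x;q)_∞`. -/
def qPochInf (q x : ℂ) : ℂ := ∏' l : ℕ, (1 - x * q ^ l)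

/-- The data of the construction: the base `q ∈ (0,1)`, the nonzero Askey-Wilson parameters
`a, b, c, d`, the polynomials `φ^(1), …, φ^(k)` and the choices `δ_1, …, δ_k ∈ {a, b, c, d}`
(encoded as `0, 1, 2, 3`). The index `j : Fin k` stands for `j + 1`. -/
structure Data (k : ℕ) where
  q : ℝ
  q_pos : 0 < q
  q_lt_one : q < 1
  a : ℂ
  b : ℂ
  c : ℂ
  d : ℂ
  a_ne_zero : a ≠ 0
  b_ne_zero : b ≠ 0
  c_ne_zero : c ≠ 0
  d_ne_zero : d ≠ 0
  φ : Fin k → ℂ[X]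
  δ : Fin k → Fin 4

namespace Data

variable {k : ℕ} (D : Data k)

/-- The product `abcd`. -/
def abcd : ℂ := D.a * D.b * D.c * D.d

/-- The power `q^γ` for complex `γ`. -/
def qpow (γ : ℂ) : ℂ := (D.q : ℂ) ^ γ

/-- The parameters as a family: `0, 1, 2, 3 ↦ a, b, c, d`. -/
def par : Fin 4 → ℂ := ![D.a, D.b, D.c, D.d]

/-- The Askey-Wilson polynomial
`p_n(x) = (ab,ac,ad;q)_n a^{-n} ₄φ₃(q^{-n}, abcd q^{n-1}, az, a/z; ab, ac, ad; q, q)`,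
`x = (z + 1/z)/2`, as a polynomial in `x`. The denominators of the terminating series are
cancelled against the prefactor through `(ab;q)_n / (ab;q)_l = (ab q^l;q)_{n-l}`, and
`(az;q)_l (a/z;q)_l = ∏_{i<l} (1 - 2 a q^i x + a^2 q^{2i})`. -/
def awPoly (n : ℕ) : ℂ[X] :=
  ∑ l ∈ Finset.range (n + 1),
    C ((D.a ^ n)⁻¹ *
        (qPoch D.q (D.a * D.b * D.q ^ l) (n - l) * qPoch D.q (D.a * D.c * D.q ^ l) (n - l) *
          qPoch D.q (D.a * D.d * D.q ^ l) (n - l)) *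
        (qPoch D.q ((D.q : ℂ) ^ (-(n : ℤ))) l *
          qPoch D.q (D.abcd * (D.q : ℂ) ^ ((n : ℤ) - 1)) l / qPoch D.q D.q l) *
        (D.q : ℂ) ^ l) *
      ∏ i ∈ Finset.range l,
        (1 - C (2 * D.a * (D.q : ℂ) ^ i) * X + C (D.a ^ 2 * (D.q : ℂ) ^ (2 * i)))

/-- The eigenvalue `λ_γ = (q^{-γ} - 1)(1 - abcd q^{γ-1})`. -/
def lam (γ : ℂ) : ℂ := (D.qpow (-γ) - 1) * (1 - D.abcd * D.qpow (γ - 1))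

/-- `q^γ (ABCE/q, BC q^γ, BE q^γ, CE q^γ, q^{γ+1};q)_∞ /
(A^γ (ABCE q^{γ-1}, BC, BE, CE, q;q)_∞)`, the meromorphic extension in `γ` of
`q^n (ABCE/q;q)_n / (A^n (BC, BE, CE, q;q)_n)`. -/
def xiOf (A B C E γ : ℂ) : ℂ :=
  D.qpow γ *
    (qPochInf D.q (A * B * C * E / D.q) * qPochInf D.q (B * C * D.qpow γ) *
      qPochInf D.q (B * E * D.qpow γ) * qPochInf D.q (C * E * D.qpow γ) *
      qPochInf D.q (D.qpow (γ + 1))) /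
  (A ^ γ *
    (qPochInf D.q (A * B * C * E * D.qpow (γ - 1)) * qPochInf D.q (B * C) *
      qPochInf D.q (B * E) * qPochInf D.q (C * E) * qPochInf D.q D.q))

/-- The functions `ξ^a_γ, ξ^b_γ, ξ^c_γ, ξ^d_γ`, for `i = 0, 1, 2, 3`: the parameters
`(a, b, c, d)` are rotated cyclically. -/
def xi (i : Fin 4) (γ : ℂ) : ℂ :=
  D.xiOf (D.par i) (D.par (i + 1)) (D.par (i + 2)) (D.par (i + 3)) γ

/-- `ψ^(j)_γ = φ^(j)(λ_γ) / ξ^{δ_j}_γ`. -/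
def psi (j : Fin k) (γ : ℂ) : ℂ := (D.φ j).eval (D.lam γ) / D.xi (D.δ j) γ

/-- `q^{-γ(k-1)} (BC q^{γ-j+1}, BE q^{γ-j+1};q)_{j-1} (AC q^{γ-k+1}, AE q^{γ-k+1};q)_{k-j}`
(with `j + 1` in place of `j`, as the index starts at `0`). -/
def etaOf (A B C E : ℂ) (j : Fin k) (γ : ℂ) : ℂ :=
  (D.qpow γ ^ (k - 1))⁻¹ *
    (qPoch D.q (B * C * D.qpow (γ - (j : ℕ))) j * qPoch D.q (B * E * D.qpow (γ - (j : ℕ))) j) *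
    (qPoch D.q (A * C * D.qpow (γ - k + 1)) (k - 1 - j) *
      qPoch D.q (A * E * D.qpow (γ - k + 1)) (k - 1 - j))

/-- `η^{b,j}_γ, η^{c,j}_γ, η^{d,j}_γ` for `i = 1, 2, 3`, and the empty factor `1` for `i = 0`. -/
def eta (i : Fin 4) (j : Fin k) (γ : ℂ) : ℂ :=
  ![1, D.etaOf D.a D.b D.c D.d j γ, D.etaOf D.a D.c D.b D.d j γ,
    D.etaOf D.a D.d D.c D.b j γ] i

/-- The normalizing factor
`χ_γ = ∏_{j=1}^{k+1} ξ^{δ_j}_{γ-j+1} ∏_{j ≤ k, δ_j ≠ a} η^{δ_j,j}_γ`, with `δ_{k+1} = a`. -/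
def chi (γ : ℂ) : ℂ :=
  (∏ j : Fin k, D.xi (D.δ j) (γ - (j : ℕ))) * D.xi 0 (γ - k) *
    ∏ j : Fin k, D.eta (D.δ j) j γ

/-- The Casorati determinant `Wr_γ(h^(1), …, h^(m)) = det (h^(i)_{γ-j+1})`. -/
def _root_.AWExt.casorati {m : ℕ} (h : Fin m → ℂ → ℂ) (γ : ℂ) : ℂ :=
  Matrix.det (Matrix.of fun i j : Fin m => h i (γ - (j : ℕ)))

/-- `τ_γ = χ_γ ∏_{j=1}^{k+1} (ξ^a_{γ-j+1})⁻¹ Wr_γ(ξ^a ψ^(1), …, ξ^a ψ^(k))`. -/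
def tau (γ : ℂ) : ℂ :=
  D.chi γ * (∏ j : Fin (k + 1), (D.xi 0 (γ - (j : ℕ)))⁻¹) *
    casorati (fun j γ' => D.xi 0 γ' * D.psi j γ') γ

/-- The coefficient `Q^{(-l)}_γ` of the shift `f_γ ↦ f_{γ-l}` in the difference operator
`f ↦ χ_γ Wr_γ(ψ^(1), …, ψ^(k), f)`, read off on the indicator function of `γ - l`. -/
def coeffQ (l : ℕ) (γ : ℂ) : ℂ :=
  D.chi γ * casorati (Fin.snoc (α := fun _ => ℂ → ℂ) D.psi
    (fun γ' => if γ' = γ - l then 1 else 0)) γ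

/-- The value at `n` of a meromorphic function given by a formula near `n`. -/
def _root_.AWExt.valueAt (g : ℂ → ℂ) (n : ℂ) : ℂ := limUnder (𝓝[≠] n) g

/-- The meromorphic function given near `n` by the formula `g` has a finite nonzero value
at `n`. -/
def _root_.AWExt.NonzeroAt (g : ℂ → ℂ) (n : ℂ) : Prop :=
  ∃ v : ℂ, v ≠ 0 ∧ Tendsto g (𝓝[≠] n) (𝓝 v)

/-- The extension `p̂_n(x) = χ_n Wr_n(ψ^(1)_n, …, ψ^(k)_n, p_n(x))
= ∑_l Q^{(-l)}_n p_{n-l}(x)` of the Askey-Wilson polynomials, where `p_m = 0` for `m < 0` and the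
coefficients are the values at `n` of the meromorphic functions `Q^{(-l)}_γ`. -/
def pHat (n : ℕ) : ℂ[X] :=
  ∑ l ∈ Finset.range (k + 1),
    if l ≤ n then C (valueAt (D.coeffQ l) n) * D.awPoly (n - l) else 0

/-- `p̂_n(x)` as a function of `z`, where `x = (z + 1/z)/2`. -/
def pHatZ (n : ℕ) : RatFunc ℂ :=
  aeval ((RatFunc.X + RatFunc.X⁻¹) / 2 : RatFunc ℂ) (D.pHat n)

/-! ### The algebra attached to the variable `z` -/

/-- The coefficient `A_γ` of the recurrence operator. -/
def recA (γ : ℂ) : ℂ :=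
  (1 - D.abcd * D.qpow (γ - 1)) /
    ((1 - D.abcd * D.qpow (2 * γ - 1)) * (1 - D.abcd * D.qpow (2 * γ)))

/-- The coefficient `B_γ` of the recurrence operator. -/
def recB (γ : ℂ) : ℂ :=
  D.qpow (γ - 1) *
    ((1 + D.abcd * D.qpow (2 * γ - 1)) *
        ((D.a + D.b + D.c + D.d) * D.q + (D.a⁻¹ + D.b⁻¹ + D.c⁻¹ + D.d⁻¹) * D.abcd) -
      D.qpow (γ - 1) * (1 + D.q) * D.abcd *
        ((D.a + D.b + D.c + D.d) + (D.a⁻¹ + D.b⁻¹ + D.c⁻¹ + D.d⁻¹) * D.q)) /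
    ((1 - D.abcd * D.qpow (2 * γ - 2)) * (1 - D.abcd * D.qpow (2 * γ)))

/-- The coefficient `C_γ` of the recurrence operator. -/
def recC (γ : ℂ) : ℂ :=
  (1 - D.a * D.b * D.qpow (γ - 1)) * (1 - D.a * D.c * D.qpow (γ - 1)) *
    (1 - D.a * D.d * D.qpow (γ - 1)) * (1 - D.b * D.c * D.qpow (γ - 1)) *
    (1 - D.b * D.d * D.qpow (γ - 1)) * (1 - D.c * D.d * D.qpow (γ - 1)) *
    (1 - D.qpow γ) /
    ((1 - D.abcd * D.qpow (2 * γ - 2)) * (1 - D.abcd * D.qpow (2 * γ - 1)))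

/-- The shifts `ε` for which, with `γ = n + ε`, the coefficients `A_γ, B_γ, C_γ` are well defined
and `A_γ ≠ 0`, `C_γ ≠ 0` for all `n ∈ ℤ`. -/
def Admissible (ε : ℂ) : Prop :=
  ∀ n : ℤ,
    1 - D.abcd * D.qpow (2 * (n + ε) - 2) ≠ 0 ∧
    1 - D.abcd * D.qpow (2 * (n + ε) - 1) ≠ 0 ∧
    1 - D.abcd * D.qpow (2 * (n + ε)) ≠ 0 ∧
    D.recA (n + ε) ≠ 0 ∧ D.recC (n + ε) ≠ 0

/-- The bi-infinite recurrence operator `𝓛_γ = A_γ E + B_γ Id + C_γ E⁻¹`, `γ = n + ε`, acting on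
functions of `n ∈ ℤ`. -/
def recOp (ε : ℂ) : Module.End ℂ (ℤ → ℂ) where
  toFun u := fun n =>
    D.recA (n + ε) * u (n + 1) + D.recB (n + ε) * u n + D.recC (n + ε) * u (n - 1)
  map_add' u v := by
    funext n
    simp only [Pi.add_apply]
    ring
  map_smul' s u := by
    funext n
    simp only [Pi.smul_apply, smul_eq_mul, RingHom.id_apply]
    ring

/-- `W = span {ψ^(1)_γ, …, ψ^(k)_γ}`, `γ = n + ε`, as functions of `n ∈ ℤ`. -/
def W (ε : ℂ) : Submodule ℂ (ℤ → ℂ) :=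
  Submodule.span ℂ (Set.range fun (j : Fin k) (n : ℤ) => D.psi j (n + ε))

/-- The algebra `𝔄_z` of the polynomials `f(z + 1/z)` with `f(𝓛_γ) W ⊂ W`. The polynomial
`f` in the variable `t = z + 1/z` represents `f(z + 1/z)`. -/
def algZ (ε : ℂ) : Subalgebra ℂ ℂ[X] where
  carrier := {f | ∀ w ∈ D.W ε, aeval (D.recOp ε) f w ∈ D.W ε}
  mul_mem' {f g} hf hg w hw := by
    rw [map_mul]
    exact hf _ (hg w hw)
  add_mem' {f g} hf hg w hw := by
    rw [map_add]
    exact (D.W ε).add_mem (hf w hw) (hg w hw)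
  algebraMap_mem' s w hw := by
    rw [AlgHom.commutes, Module.algebraMap_end_apply]
    exact (D.W ε).smul_mem s hw

/-! ### The algebra attached to the variable `n` -/

/-- The unit `q^n` of `ℂ`. -/
def qUnit (n : ℕ) : ℂˣ :=
  Units.mk0 ((D.q : ℂ) ^ n) (pow_ne_zero n (Complex.ofReal_ne_zero.mpr D.q_pos.ne'))

/-- The value at `q^n` of a Laurent polynomial. -/
def laurentAt (n : ℕ) : LaurentPolynomial ℂ →+* ℂ :=
  LaurentPolynomial.eval₂ (RingHom.id ℂ) (D.qUnit n)

theorem exists_laurent_lam (s : ℂ) :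
    ∃ r : LaurentPolynomial ℂ, ∀ n : ℕ, D.laurentAt n r = D.lam (n + s) := by
  have hq : (D.q : ℂ) ≠ 0 := Complex.ofReal_ne_zero.mpr D.q_pos.ne'
  refine ⟨(LaurentPolynomial.C (D.qpow (-s)) * LaurentPolynomial.T (-1) - 1) *
    (1 - LaurentPolynomial.C (D.abcd * D.qpow (s - 1)) * LaurentPolynomial.T 1), fun n => ?_⟩
  have h1 : D.qpow (-(n + s)) = D.qpow (-s) * ((D.q : ℂ) ^ n)⁻¹ := by
    rw [qpow, qpow, neg_add, add_comm, Complex.cpow_add _ _ hq, Complex.cpow_neg _ (n : ℂ),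
      Complex.cpow_natCast]
  have h2 : D.qpow (n + s - 1) = D.qpow (s - 1) * (D.q : ℂ) ^ n := by
    rw [qpow, qpow, add_sub_assoc, add_comm, Complex.cpow_add _ _ hq, Complex.cpow_natCast]
  rw [lam, h1, h2]
  simp [laurentAt, LaurentPolynomial.eval₂_C_mul_T, qUnit, mul_assoc]

theorem exists_laurent_eval_lam (h : ℂ[X]) (s : ℂ) :
    ∃ r : LaurentPolynomial ℂ, ∀ n : ℕ, D.laurentAt n r = h.eval (D.lam (n + s)) := by
  obtain ⟨r, hr⟩ := D.exists_laurent_lam s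
  refine ⟨h.eval₂ LaurentPolynomial.C r, fun n => ?_⟩
  rw [Polynomial.hom_eval₂, hr]
  have : (D.laurentAt n).comp LaurentPolynomial.C = RingHom.id ℂ := by
    ext
    simp [laurentAt]
  rw [this, Polynomial.eval₂_id]

/-- The algebra `𝔄_n` of the polynomials `h(λ_{n-k/2})` for which
`h(λ_{n-k/2}) - h(λ_{n-k/2-1})` is divisible by `τ_{n-1}` in `ℂ[q^n, q^{-n}]`. The polynomial `h`
represents `h(λ_{n-k/2})`; an identity of Laurent polynomials in `q^n` is expressed by its
validity for all large `n`, where the formula for `τ_{n-1}` can be evaluated directly. -/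
def algN : Subalgebra ℂ ℂ[X] where
  carrier := {h | ∃ r : LaurentPolynomial ℂ, ∀ᶠ n : ℕ in atTop,
    h.eval (D.lam (n - k / 2)) - h.eval (D.lam (n - k / 2 - 1)) =
      D.laurentAt n r * D.tau (n - 1)}
  mul_mem' {f g} := by
    rintro ⟨r, hr⟩ ⟨s, hs⟩
    obtain ⟨u, hu⟩ := D.exists_laurent_eval_lam f (-(k / 2))
    obtain ⟨v, hv⟩ := D.exists_laurent_eval_lam g (-(k / 2) - 1)
    refine ⟨u * s + r * v, ?_⟩
    filter_upwards [hr, hs] with n h1 h2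
    have e1 : (n : ℂ) + -(k / 2) = n - k / 2 := by ring
    have e2 : (n : ℂ) + (-(k / 2) - 1) = n - k / 2 - 1 := by ring
    rw [map_add, map_mul, map_mul, hu, hv, e1, e2, eval_mul, eval_mul]
    linear_combination (f.eval (D.lam (n - k / 2))) * h2 + (g.eval (D.lam (n - k / 2 - 1))) * h1
  add_mem' {f g} := by
    rintro ⟨r, hr⟩ ⟨s, hs⟩
    refine ⟨r + s, ?_⟩
    filter_upwards [hr, hs] with n h1 h2
    rw [map_add, eval_add, eval_add]
    linear_combination h1 + h2
  algebraMap_mem' s := ⟨0, by simp⟩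

end Data

/-! ### Operators -/

/-- Difference operators `∑_{|j| ≤ N} M^{(j)}_n E_n^j` acting on functions of `n ∈ ℕ`; the terms
with `n + j < 0` are absent. -/
def IsDifferenceOperator (T : Module.End ℂ (ℕ → ℂ)) : Prop :=
  ∃ (N : ℕ) (M : ℤ → ℕ → ℂ), ∀ (u : ℕ → ℂ) (n : ℕ),
    T u n = ∑ j ∈ Finset.Icc (-(N : ℤ)) N,
      M j n * (if 0 ≤ (n : ℤ) + j then u ((n : ℤ) + j).toNat else 0)

/-- The substitution `r(z) ↦ r(s z)` on rational functions (used for `s ≠ 0`). -/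
def scale (s : ℂ) (r : RatFunc ℂ) : RatFunc ℂ :=
  RatFunc.eval (RatFunc.C : ℂ →+* RatFunc ℂ) (RatFunc.C s * RatFunc.X) r

/-- `q`-difference operators `∑_j β_j(z) D_z^j` (finitely many `j ∈ ℤ`) with rational
coefficients, where `D_z r(z) = r(q z)`. -/
def IsQDifferenceOperator (q : ℝ) (T : Module.End ℂ (RatFunc ℂ)) : Prop :=
  ∃ β : ℤ →₀ RatFunc ℂ, ∀ r : RatFunc ℂ,
    T r = β.sum fun j βj => βj * scale ((q : ℂ) ^ j) r

end AWExt

end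

/-!
Both algebras come from the operator `χ Wr(ψ^(1), …, ψ^(k), ·) = ∑_l Q^{(-l)} E^{-l}`, which
annihilates the functions `ψ^(j)` and sends the Askey-Wilson polynomials `p_n` to `p̂_n`. The
assumptions on `τ` and `χ` make `Q^{(0)}_n` nonzero for `n ≥ 0` (`coeffQ_zero_eq`), so `p̂_n` has
degree `n` and the `p̂_n` form a basis of `ℂ[x]`.

*The variable `n`.* In the basis `p̂_n`, multiplication by `f(2x)` has a matrix, and this matrix
is the only candidate for the operator attached to `f`; it depends multiplicatively on `f` and has
the required eigenfunctions. What has to be proved is that for `f ∈ 𝔄_z` the matrix is banded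
(`Regular.exists_band`). Let `Φ_j` be the linear functional with `Φ_j(p_n) = ψ^(j)_n`. It
annihilates `p̂_n` for `n ≥ k`, and up to low degrees `f(2x)` acts on such functionals through
`f(𝓛)`, by the three-term recurrence `aw_recurrence`. As `f(𝓛)` preserves the span of the `ψ^(j)`,
also `f(2x) p̂_n` is annihilated by all `Φ_j`. It involves only `p_m` with `m ≥ n - k - deg f`.
Subtracting multiples of `p̂_m` with `m ≥ n - deg f` leaves a combination of `k` consecutive
`p_m`, which vanishes because the Casorati determinant of the `ψ^(j)`, a factor of `τ`, is nonzero
(`repr_eq_zero_of_functional`). The relation `f(𝓛) W ⊂ W` is given on the lattice `ε + ℤ`, but is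
needed at the integers; it can be moved there, since `ψ^(j)_γ` is `δ_j^γ` times a meromorphic
function of `q^γ` near `q^γ = 0`, and exponentials whose bases do not differ by powers of `q` are
independent over such functions (`transfer`).

*The variable `z`.* Besides the Askey-Wilson operator, which acts on `p_n` by `λ_n`, each
parameter `δ` gives a first order analogue; the connection formula between the parameters `b` and
`bq` shows that, after the addition of a multiple of the Askey-Wilson operator, it acts by the
trapezoidal sum `p_n ↦ (ξ_n)⁻¹ (∑_{m<n} c_m ξ_m p_m + c_n ξ_n p_n / 2)`, with `ξ = ξ^δ` and `c_m =
q^{-m} - abcd q^{m-1}` (`exists_trapezoid`). On the other hand, if `h(λ_{γ+1-k/2}) - h(λ_{γ-k/2})`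
is a multiple of `τ_γ`, then inverting the Casorati matrices of the `ψ^(j)` provides weights for
which a sum operator on the `p_n` is intertwined by `χ Wr(ψ, ·)` with multiplication by
`h(λ_{n-k/2})` (`sum_mul_trapezoid_eq_zero`). The reflection `q^γ ↦ q^{1-γ}/(abcd)`, under which
`λ_γ` is invariant, runs through lattices in the opposite direction and so reverses the columns of
the matrix whose determinant is `τ`; it follows that the weights are `c_m ξ_m` times polynomials
in `λ_m` (`Regular.exists_symmetric`), so that the sum operator is a polynomial expression in the
operators above. A `q`-difference operator is determined by its action on the `p̂_n`
(`Regular.qDiff_ext`); therefore the correspondence `h ↦ 𝓑^h` is a homomorphism.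

In both variables, commutativity is inherited from the commutative algebras `𝔄_z` and `𝔄_n`.
-/

open Filter Topology Polynomial

noncomputable section

namespace AWExt

/-! ### The q-shifted factorials and the coefficients of the Askey-Wilson polynomials -/

theorem qPoch_zero (q x : ℂ) : qPoch q x 0 = 1 := by simp [qPoch]

theorem qPoch_succ (q x : ℂ) (n : ℕ) : qPoch q x (n + 1) = qPoch q x n * (1 - x * q ^ n) := by
  simp [qPoch, Finset.prod_range_succ]

theorem qPoch_succ' (q x : ℂ) (n : ℕ) : qPoch q x (n + 1) = (1 - x) * qPoch q (x * q) n := by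
  rw [qPoch, Finset.prod_range_succ', mul_comm]
  simp only [pow_zero, mul_one, qPoch]
  congr 1
  exact Finset.prod_congr rfl fun i _ => by ring

theorem qPoch_ne_zero {q x : ℂ} {n : ℕ} (h : ∀ l < n, x * q ^ l ≠ 1) : qPoch q x n ≠ 0 := by
  rw [qPoch, Finset.prod_ne_zero_iff]
  intro l hl
  exact sub_ne_zero.mpr (h l (Finset.mem_range.mp hl)).symm

/-- Moving the base point of a shifted factorial by one step. -/
theorem qPoch_shift (q x : ℂ) (n : ℕ) :
    qPoch q (x * q) n * (1 - x) = qPoch q x n * (1 - x * q ^ n) := by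
  rw [mul_comm, ← qPoch_succ', qPoch_succ]

/-- The coefficient of `(az, a/z; q)_l` in the Askey-Wilson polynomial `p_n`. -/
def awCoeff (q a b c d : ℂ) (n l : ℕ) : ℂ :=
  (a ^ n)⁻¹ *
    (qPoch q (a * b * q ^ l) (n - l) * qPoch q (a * c * q ^ l) (n - l) *
      qPoch q (a * d * q ^ l) (n - l)) *
    (qPoch q (q ^ (-(n : ℤ))) l * qPoch q (a * b * c * d * q ^ ((n : ℤ) - 1)) l / qPoch q q l) *
    q ^ l

/-- The product `(az, a/z; q)_l` as a polynomial in `x = (z + 1/z)/2`. -/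
def awBasis (q a : ℂ) (l : ℕ) : ℂ[X] :=
  ∏ i ∈ Finset.range l, (1 - C (2 * a * q ^ i) * X + C (a ^ 2 * q ^ (2 * i)))

/-- The Askey-Wilson polynomial with explicit parameters. -/
def aw (q a b c d : ℂ) (n : ℕ) : ℂ[X] :=
  ∑ l ∈ Finset.range (n + 1), C (awCoeff q a b c d n l) * awBasis q a l

theorem Data.awPoly_eq {k : ℕ} (D : Data k) (n : ℕ) :
    D.awPoly n = aw D.q D.a D.b D.c D.d n := rfl

theorem aw_perm_bcd (q a b c d : ℂ) (n : ℕ) :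
    aw q a c b d n = aw q a b c d n ∧ aw q a d c b n = aw q a b c d n := by
  constructor <;>
  · refine Finset.sum_congr rfl fun l _ => ?_
    congr 2
    unfold awCoeff
    first
    | rw [show a * c * b * d = a * b * c * d by ring]
    | rw [show a * d * c * b = a * b * c * d by ring]
    ring

/-- The standing nondegeneracy assumptions on the base `q` and the product `t = abcd`:
`q` is nonzero and no root of unity, and `t q^m ≠ 1` for `m ≥ -1`. -/
structure Generic (q t : ℂ) : Prop where
  q_ne : q ≠ 0
  pow_ne : ∀ n : ℕ, q ^ (n + 1) ≠ 1
  t_ne : ∀ n : ℕ, t * q ^ n ≠ q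

namespace Generic

variable {q t : ℂ} (G : Generic q t)
include G

theorem q_sub : 1 - q ≠ 0 := sub_ne_zero.mpr (by simpa using (G.pow_ne 0).symm)

theorem qPoch_q_ne (l : ℕ) : qPoch q q l ≠ 0 :=
  qPoch_ne_zero fun i _ => by rw [mul_comm, ← pow_succ]; exact G.pow_ne i

theorem pow_sub (n : ℕ) : 1 - q ^ (n + 1) ≠ 0 := sub_ne_zero.mpr (G.pow_ne n).symm

theorem t_sub (n : ℕ) : q - t * q ^ n ≠ 0 := sub_ne_zero.mpr (G.t_ne n).symm

theorem pow_inj {m n : ℕ} (h : q ^ m = q ^ n) : m = n := by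
  wlog hmn : m ≤ n generalizing m n
  · exact (this h.symm (by omega)).symm
  obtain ⟨j, rfl⟩ := Nat.exists_eq_add_of_le hmn
  rcases j with - | j
  · rfl
  · rw [pow_add] at h
    exact absurd (mul_left_cancel₀ (pow_ne_zero m G.q_ne) (by rw [← h, mul_one])) (G.pow_ne j)

theorem mul_q : Generic q (t * q) where
  q_ne := G.q_ne
  pow_ne := G.pow_ne
  t_ne n := by have := G.t_ne (n + 1); rwa [pow_succ', ← mul_assoc] at this

end Generic

section Coefficients

variable {q a b c d : ℂ}

theorem awCoeff_eq_zero (hq : q ≠ 0) {n l : ℕ} (h : n < l) : awCoeff q a b c d n l = 0 := by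
  have : qPoch q (q ^ (-(n : ℤ))) l = 0 := by
    rw [qPoch, Finset.prod_eq_zero (Finset.mem_range.mpr h)]
    rw [zpow_neg, zpow_natCast, inv_mul_cancel₀ (pow_ne_zero n hq), sub_self]
  rw [awCoeff, this]
  simp

/-- `p_n` as a sum over any sufficiently long range. -/
theorem aw_eq_sum (hq : q ≠ 0) {n N : ℕ} (h : n < N) :
    aw q a b c d n = ∑ l ∈ Finset.range N, C (awCoeff q a b c d n l) * awBasis q a l := by
  refine Finset.sum_subset (Finset.range_mono h) fun l _ hl => ?_
  rw [awCoeff_eq_zero hq (by simpa using hl), C_0, zero_mul]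

variable (G : Generic q (a * b * c * d))
include G

/-- The recursion of the coefficients in the summation index. -/
theorem awCoeff_succ_right (n l : ℕ) :
    awCoeff q a b c d n (l + 1) *
      ((1 - a * b * q ^ l) * (1 - a * c * q ^ l) * (1 - a * d * q ^ l) * (1 - q ^ (l + 1))) =
    awCoeff q a b c d n l * ((1 - q ^ l / q ^ n) * (q - a * b * c * d * q ^ n * q ^ l)) := by
  have hq := G.q_ne
  rcases lt_trichotomy n l with h | rfl | h
  · rw [awCoeff_eq_zero hq h, awCoeff_eq_zero hq (by omega)]; ring
  · rw [awCoeff_eq_zero hq (Nat.lt_succ_self _), div_self (pow_ne_zero _ hq)]; ring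
  obtain ⟨j, rfl⟩ := Nat.exists_eq_add_of_lt h
  have hqq := G.qPoch_q_ne l
  have h1 := G.pow_sub l
  have hp := pow_ne_zero (l + j + 1) hq
  unfold awCoeff
  rw [show l + j + 1 - (l + 1) = j by omega, show l + j + 1 - l = j + 1 by omega,
    qPoch_succ q q l, qPoch_succ q _ l, qPoch_succ q (a * b * c * d * _) l, qPoch_succ' q _ j,
    qPoch_succ' q _ j, qPoch_succ' q _ j, zpow_sub₀ hq, zpow_neg, zpow_natCast, zpow_one,
    pow_succ q l, ← mul_assoc (a * b), ← mul_assoc (a * c), ← mul_assoc (a * d)]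
  rw [pow_succ] at h1
  generalize qPoch q (a * b * q ^ l * q) j = u1
  generalize qPoch q (a * c * q ^ l * q) j = u2
  generalize qPoch q (a * d * q ^ l * q) j = u3
  generalize qPoch q (q ^ (l + j + 1))⁻¹ l = u4
  generalize qPoch q (a * b * c * d * (q ^ (l + j + 1) / q)) l = u5
  generalize qPoch q q l = u6 at *
  generalize q ^ (l + j + 1) = Q at *
  generalize q ^ l = y at *
  generalize (a ^ (l + j + 1))⁻¹ = u7
  have e1 : (u6 * (1 - q * y))⁻¹ * (1 - y * q) = u6⁻¹ := by
    rw [mul_inv, mul_comm q y, mul_assoc, inv_mul_cancel₀ h1, mul_one]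
  have e2 : q - a * b * c * d * Q * y = (1 - a * b * c * d * (Q / q) * y) * q := by field_simp
  rw [div_eq_mul_inv _ (u6 * (1 - q * y)), div_eq_mul_inv _ u6, e2, ← e1]
  ring

/-- The recursion of the coefficients in the degree. -/
theorem awCoeff_succ_left (ha : a ≠ 0) (n l : ℕ) :
    awCoeff q a b c d (n + 1) l *
      (a * (1 - q ^ l / q ^ (n + 1)) * (q - a * b * c * d * q ^ n)) =
    awCoeff q a b c d n l *
      ((1 - a * b * q ^ n) * (1 - a * c * q ^ n) * (1 - a * d * q ^ n) *
        (1 - 1 / q ^ (n + 1)) * (q - a * b * c * d * q ^ n * q ^ l)) := by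
  have hq := G.q_ne
  rcases lt_trichotomy l (n + 1) with h | rfl | h
  swap
  · rw [awCoeff_eq_zero hq (Nat.lt_succ_self _), div_self (pow_ne_zero _ hq)]; ring
  swap
  · rw [awCoeff_eq_zero hq h, awCoeff_eq_zero hq (by omega)]; ring
  obtain ⟨j, rfl⟩ := Nat.exists_eq_add_of_le (Nat.lt_succ_iff.mp h)
  have e1 := qPoch_shift q (q ^ (l + j + 1))⁻¹ l
  have e2 := qPoch_shift q (a * b * c * d * (q ^ (l + j) / q)) l
  have e3 : (q ^ (l + j + 1))⁻¹ * q = (q ^ (l + j))⁻¹ := by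
    rw [pow_succ]; field_simp
  have e4 : a * b * c * d * (q ^ (l + j) / q) * q = a * b * c * d * q ^ (l + j) := by field_simp
  rw [e3] at e1
  rw [e4] at e2
  have ht := G.t_sub (l + j)
  have hp := pow_ne_zero (l + j) hq
  have ha' := pow_ne_zero (l + j) ha
  unfold awCoeff
  rw [show l + j + 1 - l = j + 1 by omega, show l + j - l = j by omega,
    qPoch_succ q _ j, qPoch_succ q _ j, qPoch_succ q _ j, zpow_sub₀ hq, zpow_sub₀ hq, zpow_neg,
    zpow_neg, zpow_natCast, zpow_one, zpow_natCast, mul_assoc (a * b), mul_assoc (a * c),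
    mul_assoc (a * d), ← pow_add, pow_succ q (l + j), mul_div_cancel_right₀ _ hq,
    pow_succ a (l + j), mul_inv (a ^ (l + j))]
  rw [pow_succ q (l + j)] at e1
  generalize qPoch q (a * b * q ^ l) j = u1
  generalize qPoch q (a * c * q ^ l) j = u2
  generalize qPoch q (a * d * q ^ l) j = u3
  generalize qPoch q (q ^ (l + j) * q)⁻¹ l = u4 at *
  generalize qPoch q (q ^ (l + j))⁻¹ l = u5 at *
  generalize qPoch q (a * b * c * d * q ^ (l + j)) l = u6 at *
  generalize qPoch q (a * b * c * d * (q ^ (l + j) / q)) l = u7 at *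
  generalize qPoch q q l = u8 at *
  generalize q ^ (l + j) = Q at *
  generalize q ^ l = y at *
  generalize (a ^ (l + j))⁻¹ = u9
  have e5 : u6 * (q - a * b * c * d * Q) = u7 * (q - a * b * c * d * Q * y) := by
    have h1 : a * b * c * d * (Q / q) = a * b * c * d * Q / q := by ring
    rw [h1] at e2
    field_simp at e2
    linear_combination e2
  have e6 : u4 * (1 - y / (Q * q)) = u5 * (1 - 1 / (Q * q)) := by
    have h1 : (Q * q)⁻¹ = 1 / (Q * q) := by ring
    rw [h1] at e1
    linear_combination -e1
  have : u9 * a⁻¹ * (u1 * (1 - a * b * Q) * (u2 * (1 - a * c * Q)) * (u3 * (1 - a * d * Q))) *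
      (u4 * u6 / u8) * y * (a * (1 - y / (Q * q)) * (q - a * b * c * d * Q)) =
      u9 * (a⁻¹ * a) * (u1 * (1 - a * b * Q) * (u2 * (1 - a * c * Q)) * (u3 * (1 - a * d * Q))) *
      (u4 * (1 - y / (Q * q))) * (u6 * (q - a * b * c * d * Q)) / u8 * y := by ring
  rw [this, e5, e6, inv_mul_cancel₀ ha]
  ring

/-- The leading coefficients. -/
theorem awCoeff_self_succ (ha : a ≠ 0) (n : ℕ) :
    awCoeff q a b c d (n + 1) (n + 1) * (a * q ^ n * (q - a * b * c * d * q ^ n)) =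
    -awCoeff q a b c d n n *
      ((q - a * b * c * d * q ^ n * q ^ n) * (1 - a * b * c * d * q ^ n * q ^ n)) := by
  have hq := G.q_ne
  have e3 : (q ^ (n + 1))⁻¹ * q = (q ^ n)⁻¹ := by
    rw [pow_succ]; field_simp
  have e2 := qPoch_shift q (a * b * c * d * (q ^ n / q)) n
  have e4 : a * b * c * d * (q ^ n / q) * q = a * b * c * d * q ^ n := by field_simp
  rw [e4] at e2
  have ht := G.t_sub n
  have hp := pow_ne_zero n hq
  have h1 := G.pow_sub n
  have h2 := G.qPoch_q_ne n
  unfold awCoeff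
  simp only [Nat.sub_self, qPoch_zero]
  rw [qPoch_succ' q _ n, qPoch_succ q (a * b * c * d * _) n, qPoch_succ q q n, zpow_sub₀ hq,
    zpow_sub₀ hq, zpow_neg, zpow_neg, zpow_natCast, zpow_one, zpow_natCast, e3, pow_succ q n,
    mul_div_cancel_right₀ _ hq, pow_succ a n, mul_inv (a ^ n)]
  rw [pow_succ] at h1
  generalize qPoch q (q ^ n)⁻¹ n = u5 at *
  generalize qPoch q (a * b * c * d * q ^ n) n = u6 at *
  generalize qPoch q (a * b * c * d * (q ^ n / q)) n = u7 at *
  generalize qPoch q q n = u8 at *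
  generalize q ^ n = Q at *
  generalize (a ^ n)⁻¹ = u9
  have e5 : u6 * (q - a * b * c * d * Q) = u7 * (q - a * b * c * d * Q * Q) := by
    have h1 : a * b * c * d * (Q / q) = a * b * c * d * Q / q := by ring
    rw [h1] at e2
    field_simp at e2
    linear_combination e2
  have e6 : (1 - (Q * q)⁻¹) / (u8 * (1 - q * Q)) * (Q * q) = -u8⁻¹ := by
    rw [mul_comm q Q]
    field_simp
    ring
  have : u9 * a⁻¹ * (1 * 1 * 1) * ((1 - (Q * q)⁻¹) * u5 * (u6 * (1 - a * b * c * d * Q * Q)) /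
      (u8 * (1 - q * Q))) * (Q * q) * (a * Q * (q - a * b * c * d * Q)) =
      u9 * (a⁻¹ * a) * ((1 - (Q * q)⁻¹) / (u8 * (1 - q * Q)) * (Q * q)) * u5 *
      (u6 * (q - a * b * c * d * Q)) * Q * (1 - a * b * c * d * Q * Q) := by ring
  rw [this, e5, e6, inv_mul_cancel₀ ha]
  ring

theorem awCoeff_self_ne_zero (ha : a ≠ 0) (n : ℕ) : awCoeff q a b c d n n ≠ 0 := by
  have hq := G.q_ne
  unfold awCoeff
  rw [Nat.sub_self, qPoch_zero, qPoch_zero, qPoch_zero]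
  refine mul_ne_zero (mul_ne_zero (mul_ne_zero (inv_ne_zero (pow_ne_zero _ ha)) (by simp))
    (div_ne_zero (mul_ne_zero ?_ ?_) (G.qPoch_q_ne n))) (pow_ne_zero _ hq)
  · refine qPoch_ne_zero fun l hl h => ?_
    rw [zpow_neg, zpow_natCast, inv_mul_eq_one₀ (pow_ne_zero _ hq)] at h
    exact hl.ne (G.pow_inj h).symm
  · refine qPoch_ne_zero fun l hl h => G.t_ne (n + l) ?_
    rw [zpow_sub₀ hq, zpow_natCast, zpow_one] at h
    field_simp at h
    rw [pow_add, ← mul_assoc, h]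

end Coefficients

/-! ### The recurrence coefficients -/

/-- The coefficient `A_γ` of the recurrence as a function of `Q = q^γ`. -/
def awRecA (q a b c d Q : ℂ) : ℂ :=
  (1 - a * b * c * d * (Q / q)) /
    ((1 - a * b * c * d * (Q ^ 2 / q)) * (1 - a * b * c * d * Q ^ 2))

/-- The coefficient `B_γ` of the recurrence as a function of `Q = q^γ`. -/
def awRecB (q a b c d Q : ℂ) : ℂ :=
  Q / q * ((1 + a * b * c * d * (Q ^ 2 / q)) *
        ((a + b + c + d) * q + (a⁻¹ + b⁻¹ + c⁻¹ + d⁻¹) * (a * b * c * d)) -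
      Q / q * (1 + q) * (a * b * c * d) *
        ((a + b + c + d) + (a⁻¹ + b⁻¹ + c⁻¹ + d⁻¹) * q)) /
    ((1 - a * b * c * d * (Q ^ 2 / q ^ 2)) * (1 - a * b * c * d * Q ^ 2))

/-- The coefficient `C_γ` of the recurrence as a function of `Q = q^γ`. -/
def awRecC (q a b c d Q : ℂ) : ℂ :=
  (1 - a * b * (Q / q)) * (1 - a * c * (Q / q)) * (1 - a * d * (Q / q)) * (1 - b * c * (Q / q)) *
    (1 - b * d * (Q / q)) * (1 - c * d * (Q / q)) * (1 - Q) /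
    ((1 - a * b * c * d * (Q ^ 2 / q ^ 2)) * (1 - a * b * c * d * (Q ^ 2 / q)))

section
variable {q a b c d Q : ℂ}

theorem awRecB_eq (hq : q ≠ 0) (ha : a ≠ 0) (hb : b ≠ 0) (hc : c ≠ 0) (hd : d ≠ 0)
    (h0 : q ^ 2 - a * b * c * d * Q ^ 2 ≠ 0)
    (h1 : q - a * b * c * d * Q ^ 2 ≠ 0) (h2 : 1 - a * b * c * d * Q ^ 2 ≠ 0) :
    awRecB q a b c d Q = a + a⁻¹ -
      (q - a * b * c * d * Q) * (1 - a * b * Q) * (1 - a * c * Q) * (1 - a * d * Q) /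
        (a * (q - a * b * c * d * Q ^ 2) * (1 - a * b * c * d * Q ^ 2)) -
      a * (1 - Q) * (q - b * c * Q) * (q - b * d * Q) * (q - c * d * Q) /
        ((q ^ 2 - a * b * c * d * Q ^ 2) * (q - a * b * c * d * Q ^ 2)) := by
  have e : awRecB q a b c d Q = Q * ((q + a * b * c * d * Q ^ 2) *
      ((a + b + c + d) * q + (b * c * d + a * c * d + a * b * d + a * b * c)) -
      Q * (1 + q) * ((a + b + c + d) * (a * b * c * d) + (b * c * d + a * c * d + a * b * d + a * b * c) * q))
       / ((q ^ 2 - a * b * c * d * Q ^ 2) * (1 - a * b * c * d * Q ^ 2)) := by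
    unfold awRecB
    have h0' : 1 - a * b * c * d * (Q ^ 2 / q ^ 2) ≠ 0 := by
      intro h; apply h0; field_simp at h; linear_combination h
    rw [div_eq_div_iff (mul_ne_zero h0' h2) (mul_ne_zero h0 h2)]
    field_simp
  rw [e]
  generalize hD0 : q ^ 2 - a * b * c * d * Q ^ 2 = D0 at *
  generalize hD1 : q - a * b * c * d * Q ^ 2 = D1 at *
  generalize hD2 : 1 - a * b * c * d * Q ^ 2 = D2 at *
  field_simp
  subst hD0 hD1 hD2
  ring

/-- The rational identity behind the three-term recurrence, after the expansion in the basis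
`(az, a/z; q)_l`, `y = q^l`, and division by the coefficients of `p_n`. -/
theorem aw_recurrence_identity {y : ℂ} (ha : a ≠ 0) (hy : y ≠ 0)
    (h0 : q ^ 2 - a * b * c * d * Q ^ 2 ≠ 0)
    (h1 : q - a * b * c * d * Q ^ 2 ≠ 0) (h2 : 1 - a * b * c * d * Q ^ 2 ≠ 0)
    (hX : q * Q - y ≠ 0) (hZ : q ^ 2 - a * b * c * d * Q * y ≠ 0) :
    (1 - a * b * Q) * (1 - a * c * Q) * (1 - a * d * Q) * (q * Q - 1) *
        (q - a * b * c * d * Q * y) /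
        (a * (q * Q - y) * ((q - a * b * c * d * Q ^ 2) * (1 - a * b * c * d * Q ^ 2))) +
      (a + a⁻¹ -
        (q - a * b * c * d * Q) * (1 - a * b * Q) * (1 - a * c * Q) * (1 - a * d * Q) /
          (a * (q - a * b * c * d * Q ^ 2) * (1 - a * b * c * d * Q ^ 2)) -
        a * (1 - Q) * (q - b * c * Q) * (q - b * d * Q) * (q - c * d * Q) /
          ((q ^ 2 - a * b * c * d * Q ^ 2) * (q - a * b * c * d * Q ^ 2))) -
      a * ((q - b * c * Q) * (q - b * d * Q) * (q - c * d * Q)) * (Q - y) *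
        (q ^ 2 - a * b * c * d * Q) / ((q ^ 2 - a * b * c * d * Q ^ 2) *
          (q - a * b * c * d * Q ^ 2) * (q ^ 2 - a * b * c * d * Q * y)) =
    (a * y)⁻¹ + a * y - (q - a * b * y) * (q - a * c * y) * (q - a * d * y) * (1 - y) * Q /
      (a * y * (q * Q - y) * (q ^ 2 - a * b * c * d * Q * y)) := by
  -- The two differences of neighbouring terms are divisible by `1 - y`.
  have e1 : (1 - a * b * Q) * (1 - a * c * Q) * (1 - a * d * Q) * (q * Q - 1) *
        (q - a * b * c * d * Q * y) /
        (a * (q * Q - y) * ((q - a * b * c * d * Q ^ 2) * (1 - a * b * c * d * Q ^ 2))) -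
        (q - a * b * c * d * Q) * (1 - a * b * Q) * (1 - a * c * Q) * (1 - a * d * Q) /
          (a * (q - a * b * c * d * Q ^ 2) * (1 - a * b * c * d * Q ^ 2)) =
      -((1 - a * b * Q) * (1 - a * c * Q) * (1 - a * d * Q) * q * (1 - y)) /
        (a * (q - a * b * c * d * Q ^ 2) * (q * Q - y)) := by
    generalize hX' : q * Q - y = X at *
    generalize hD1 : q - a * b * c * d * Q ^ 2 = D1 at *
    generalize hD2 : 1 - a * b * c * d * Q ^ 2 = D2 at *
    field_simp
    subst hX' hD1 hD2
    ring
  have e2 : a * (1 - Q) * (q - b * c * Q) * (q - b * d * Q) * (q - c * d * Q) /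
          ((q ^ 2 - a * b * c * d * Q ^ 2) * (q - a * b * c * d * Q ^ 2)) +
      a * ((q - b * c * Q) * (q - b * d * Q) * (q - c * d * Q)) * (Q - y) *
        (q ^ 2 - a * b * c * d * Q) / ((q ^ 2 - a * b * c * d * Q ^ 2) *
          (q - a * b * c * d * Q ^ 2) * (q ^ 2 - a * b * c * d * Q * y)) =
      a * ((q - b * c * Q) * (q - b * d * Q) * (q - c * d * Q)) * (1 - y) /
        ((q - a * b * c * d * Q ^ 2) * (q ^ 2 - a * b * c * d * Q * y)) := by
    generalize hD0 : q ^ 2 - a * b * c * d * Q ^ 2 = D0 at *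
    generalize hD1 : q - a * b * c * d * Q ^ 2 = D1 at *
    generalize hZ' : q ^ 2 - a * b * c * d * Q * y = Z at *
    field_simp
    subst hD0 hD1 hZ'
    ring
  have e3 : -((1 - a * b * Q) * (1 - a * c * Q) * (1 - a * d * Q) * q * (1 - y)) /
        (a * (q - a * b * c * d * Q ^ 2) * (q * Q - y)) -
      a * ((q - b * c * Q) * (q - b * d * Q) * (q - c * d * Q)) * (1 - y) /
        ((q - a * b * c * d * Q ^ 2) * (q ^ 2 - a * b * c * d * Q * y)) + (a + a⁻¹) =
      (a * y)⁻¹ + a * y - (q - a * b * y) * (q - a * c * y) * (q - a * d * y) * (1 - y) * Q /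
      (a * y * (q * Q - y) * (q ^ 2 - a * b * c * d * Q * y)) := by
    generalize hX' : q * Q - y = X at *
    generalize hD1 : q - a * b * c * d * Q ^ 2 = D1 at *
    generalize hZ' : q ^ 2 - a * b * c * d * Q * y = Z at *
    field_simp
    subst hX' hD1 hZ'
    ring
  linear_combination e1 - e2 + e3

end

/-! ### The three-term recurrence relation and the degree -/

section
variable {q a b c d : ℂ}

/-- The three-term recurrence for the coefficients; `pc` stands for the coefficient that is moved
up by multiplication with `z + 1/z`. -/
theorem awCoeff_recurrence_aux {Q y c0 c1 c2 pc : ℂ} (hq : q ≠ 0)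
    (ha : a ≠ 0) (hb : b ≠ 0) (hc : c ≠ 0) (hd : d ≠ 0) (hy : y ≠ 0)
    (h0 : q ^ 2 - a * b * c * d * Q ^ 2 ≠ 0)
    (h1 : q - a * b * c * d * Q ^ 2 ≠ 0) (h2 : 1 - a * b * c * d * Q ^ 2 ≠ 0)
    (hX : q * Q - y ≠ 0) (hZ : q ^ 2 - a * b * c * d * Q * y ≠ 0)
    (hQ1 : Q - 1 ≠ 0) (hV : q - a * b * c * d * Q ≠ 0)
    (r1 : c1 * (a * (Q - y) * (q ^ 2 - a * b * c * d * Q) * q ^ 3) =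
      c0 * ((q - a * b * Q) * (q - a * c * Q) * (q - a * d * Q) * (Q - 1) *
        (q ^ 2 - a * b * c * d * Q * y)))
    (r2 : c2 * (a * (q * Q - y) * (q - a * b * c * d * Q)) =
      c1 * ((1 - a * b * Q) * (1 - a * c * Q) * (1 - a * d * Q) * (q * Q - 1) *
        (q - a * b * c * d * Q * y)))
    (r3 : c1 * ((q - a * b * y) * (q - a * c * y) * (q - a * d * y) * (1 - y) * Q) =
      pc * (a * y * (q * Q - y) * (q ^ 2 - a * b * c * d * Q * y))) :
    awRecA q a b c d Q * c2 + awRecB q a b c d Q * c1 + awRecC q a b c d Q * c0 =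
      c1 * ((a * y)⁻¹ + a * y) - pc := by
  have eA : awRecA q a b c d Q * c2 = c1 *
      ((1 - a * b * Q) * (1 - a * c * Q) * (1 - a * d * Q) * (q * Q - 1) *
        (q - a * b * c * d * Q * y) /
        (a * (q * Q - y) * ((q - a * b * c * d * Q ^ 2) * (1 - a * b * c * d * Q ^ 2)))) := by
    have : awRecA q a b c d Q = (q - a * b * c * d * Q) /
        ((q - a * b * c * d * Q ^ 2) * (1 - a * b * c * d * Q ^ 2)) := by
      unfold awRecA
      rw [show 1 - a * b * c * d * (Q / q) = (q - a * b * c * d * Q) / q by field_simp,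
        show 1 - a * b * c * d * (Q ^ 2 / q) = (q - a * b * c * d * Q ^ 2) / q by field_simp,
        div_mul_eq_mul_div, div_div_div_cancel_right₀ hq]
    rw [this, ← mul_div_assoc, ← r2]
    generalize q * Q - y = X at *
    generalize q - a * b * c * d * Q ^ 2 = D1 at *
    generalize 1 - a * b * c * d * Q ^ 2 = D2 at *
    field_simp
  have eC : awRecC q a b c d Q * c0 = -(c1 *
      (a * ((q - b * c * Q) * (q - b * d * Q) * (q - c * d * Q)) * (Q - y) *
        (q ^ 2 - a * b * c * d * Q) / ((q ^ 2 - a * b * c * d * Q ^ 2) *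
          (q - a * b * c * d * Q ^ 2) * (q ^ 2 - a * b * c * d * Q * y)))) := by
    have e0 : awRecC q a b c d Q = (q - a * b * Q) * (q - a * c * Q) * (q - a * d * Q) *
        ((q - b * c * Q) * (q - b * d * Q) * (q - c * d * Q)) * (1 - Q) /
        (q ^ 3 * ((q ^ 2 - a * b * c * d * Q ^ 2) * (q - a * b * c * d * Q ^ 2))) := by
      unfold awRecC
      rw [show 1 - a * b * c * d * (Q ^ 2 / q ^ 2) =
          (q ^ 2 - a * b * c * d * Q ^ 2) / q ^ 2 by field_simp,
        show 1 - a * b * c * d * (Q ^ 2 / q) = (q - a * b * c * d * Q ^ 2) / q by field_simp]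
      generalize q ^ 2 - a * b * c * d * Q ^ 2 = D0 at *
      generalize q - a * b * c * d * Q ^ 2 = D1 at *
      field_simp
    have e1 : c0 * ((q - a * b * Q) * (q - a * c * Q) * (q - a * d * Q)) =
        c1 * (a * (Q - y) * (q ^ 2 - a * b * c * d * Q) * q ^ 3) /
          ((Q - 1) * (q ^ 2 - a * b * c * d * Q * y)) := by
      rw [eq_div_iff (mul_ne_zero hQ1 hZ), r1]
      ring
    rw [e0, show ∀ u v w x : ℂ, u * v * w / x * c0 = c0 * u * v * w / x by intros; ring, e1]
    generalize q ^ 2 - a * b * c * d * Q ^ 2 = D0 at *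
    generalize q - a * b * c * d * Q ^ 2 = D1 at *
    generalize q ^ 2 - a * b * c * d * Q * y = Z at *
    field_simp
    ring
  have eP : pc = c1 * ((q - a * b * y) * (q - a * c * y) * (q - a * d * y) * (1 - y) * Q /
      (a * y * (q * Q - y) * (q ^ 2 - a * b * c * d * Q * y))) := by
    rw [← mul_div_assoc, r3, mul_div_cancel_right₀]
    exact mul_ne_zero (mul_ne_zero (mul_ne_zero ha hy) hX) hZ
  rw [eA, eC, eP, awRecB_eq hq ha hb hc hd h0 h1 h2]
  linear_combination c1 * aw_recurrence_identity ha hy h0 h1 h2 hX hZ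

theorem X_mul_awBasis (hq : q ≠ 0) (ha : a ≠ 0) (l : ℕ) :
    (2 * X : ℂ[X]) * awBasis q a l =
      C ((a * q ^ l)⁻¹ + a * q ^ l) * awBasis q a l - C ((a * q ^ l)⁻¹) * awBasis q a (l + 1) := by
  have h : a * q ^ l ≠ 0 := mul_ne_zero ha (pow_ne_zero l hq)
  have e : awBasis q a (l + 1) = awBasis q a l *
      (1 - C (2 * (a * q ^ l)) * X + C ((a * q ^ l) ^ 2)) := by
    rw [awBasis, Finset.prod_range_succ, mul_assoc 2 a, mul_comm 2 l, pow_mul, ← mul_pow]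
    rfl
  have h1 : (C ((a * q ^ l)⁻¹) * C (a * q ^ l) : ℂ[X]) = 1 := by
    rw [← C_mul, inv_mul_cancel₀ h, C_1]
  rw [e]
  generalize a * q ^ l = v at *
  simp only [C_add, C_mul, map_pow, show (C (2 : ℂ) : ℂ[X]) = 2 from rfl]
  linear_combination (-2 * X + C v) * awBasis q a l * h1

/-- The three-term recurrence of the Askey-Wilson polynomials, for `n = m + 1 ≥ 1`. -/
theorem aw_recurrence (G : Generic q (a * b * c * d)) (ha : a ≠ 0) (hb : b ≠ 0) (hc : c ≠ 0)
    (hd : d ≠ 0) (m : ℕ) :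
    C (awRecA q a b c d (q ^ (m + 1))) * aw q a b c d (m + 2) +
      C (awRecB q a b c d (q ^ (m + 1))) * aw q a b c d (m + 1) +
      C (awRecC q a b c d (q ^ (m + 1))) * aw q a b c d m = 2 * X * aw q a b c d (m + 1) := by
  have hq := G.q_ne
  set Q := q ^ (m + 1) with hQd
  have hQ : Q ≠ 0 := pow_ne_zero _ hq
  have h0 : q ^ 2 - a * b * c * d * Q ^ 2 ≠ 0 := by
    have := mul_ne_zero hq (G.t_sub (2 * m + 1))
    intro h
    apply this
    rw [← h, hQd]
    ring
  have h1 : q - a * b * c * d * Q ^ 2 ≠ 0 := by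
    rw [hQd, ← pow_mul]; exact G.t_sub _
  have h2 : 1 - a * b * c * d * Q ^ 2 ≠ 0 := by
    intro h
    apply G.t_sub (2 * m + 3)
    rw [show a * b * c * d * q ^ (2 * m + 3) = q * (a * b * c * d * Q ^ 2) by rw [hQd]; ring]
    linear_combination q * h
  have hQ1 : Q - 1 ≠ 0 := sub_ne_zero.mpr (G.pow_ne m)
  have hV : q - a * b * c * d * Q ≠ 0 := G.t_sub _
  -- The coefficient identity for `l ≤ m + 1`, with `pc` the shifted coefficient.
  have key : ∀ l ≤ m + 1, ∀ pc : ℂ,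
      awCoeff q a b c d (m + 1) l * ((q - a * b * q ^ l) * (q - a * c * q ^ l) *
        (q - a * d * q ^ l) * (1 - q ^ l) * Q) =
        pc * (a * q ^ l * (q * Q - q ^ l) * (q ^ 2 - a * b * c * d * Q * q ^ l)) →
      awRecA q a b c d Q * awCoeff q a b c d (m + 2) l +
        awRecB q a b c d Q * awCoeff q a b c d (m + 1) l +
        awRecC q a b c d Q * awCoeff q a b c d m l =
      awCoeff q a b c d (m + 1) l * ((a * q ^ l)⁻¹ + a * q ^ l) - pc := by
    intro l hl pc r3
    have hX : q * Q - q ^ l ≠ 0 := by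
      rw [hQd, ← pow_succ', sub_ne_zero]
      exact fun h => absurd (G.pow_inj h) (by omega)
    have hZ : q ^ 2 - a * b * c * d * Q * q ^ l ≠ 0 := by
      have := mul_ne_zero hq (G.t_sub (m + l))
      intro h
      apply this
      rw [← h, hQd]
      ring
    refine awCoeff_recurrence_aux hq ha hb hc hd (pow_ne_zero l hq) h0 h1 h2 hX hZ hQ1 hV ?_ ?_ r3
    · have := awCoeff_succ_left G ha m l
      rw [← hQd, show q ^ m = Q / q by rw [hQd, pow_succ, mul_div_cancel_right₀ _ hq]] at this
      field_simp at this
      linear_combination this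
    · have := awCoeff_succ_left G ha (m + 1) l
      rw [← hQd, show q ^ (m + 1 + 1) = q * Q by rw [hQd]; ring] at this
      field_simp at this
      linear_combination this
  have expand : 2 * X * aw q a b c d (m + 1) =
      ∑ l ∈ Finset.range (m + 2), (C (awCoeff q a b c d (m + 1) l * ((a * q ^ l)⁻¹ + a * q ^ l)) *
        awBasis q a l - C (awCoeff q a b c d (m + 1) l * (a * q ^ l)⁻¹) * awBasis q a (l + 1)) := by
    rw [aw, Finset.mul_sum]
    refine Finset.sum_congr rfl fun l _ => ?_
    rw [mul_left_comm, X_mul_awBasis hq ha, C_mul, C_mul]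
    ring
  rw [expand, aw_eq_sum hq (show m + 2 < m + 3 by omega), aw_eq_sum hq (show m + 1 < m + 3 by omega),
    aw_eq_sum hq (show m < m + 3 by omega), Finset.mul_sum, Finset.mul_sum, Finset.mul_sum,
    ← Finset.sum_add_distrib, ← Finset.sum_add_distrib, Finset.sum_sub_distrib,
    Finset.sum_range_succ' _ (m + 2)]
  rw [eq_sub_iff_add_eq, add_right_comm, ← Finset.sum_add_distrib, Finset.sum_range_succ _ (m + 1),
    Finset.sum_range_succ' _ (m + 1)]
  have eq0 := key 0 (by omega) 0 (by simp)
  have top : awRecA q a b c d Q * awCoeff q a b c d (m + 2) (m + 2) +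
      awCoeff q a b c d (m + 1) (m + 1) * (a * q ^ (m + 1))⁻¹ = 0 := by
    have := awCoeff_self_succ G ha (m + 1)
    rw [← hQd] at this ⊢
    have e : awCoeff q a b c d (m + 2) (m + 2) = -awCoeff q a b c d (m + 1) (m + 1) *
      ((q - a * b * c * d * Q * Q) * (1 - a * b * c * d * Q * Q)) /
        (a * Q * (q - a * b * c * d * Q)) := by
      rw [← this, mul_div_cancel_right₀ _ (mul_ne_zero (mul_ne_zero ha hQ) hV)]
    rw [e]
    unfold awRecA
    rw [show 1 - a * b * c * d * (Q / q) = (q - a * b * c * d * Q) / q by field_simp,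
      show 1 - a * b * c * d * (Q ^ 2 / q) = (q - a * b * c * d * Q ^ 2) / q by field_simp,
      show a * b * c * d * Q * Q = a * b * c * d * Q ^ 2 by ring]
    generalize q - a * b * c * d * Q ^ 2 = D1 at *
    generalize 1 - a * b * c * d * Q ^ 2 = D2 at *
    generalize q - a * b * c * d * Q = D3 at *
    field_simp
    ring
  have mid : ∀ l ∈ Finset.range (m + 1),
      C (awRecA q a b c d Q) * (C (awCoeff q a b c d (m + 2) (l + 1)) * awBasis q a (l + 1)) +
        C (awRecB q a b c d Q) * (C (awCoeff q a b c d (m + 1) (l + 1)) * awBasis q a (l + 1)) +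
        C (awRecC q a b c d Q) * (C (awCoeff q a b c d m (l + 1)) * awBasis q a (l + 1)) +
        C (awCoeff q a b c d (m + 1) l * (a * q ^ l)⁻¹) * awBasis q a (l + 1) =
      C (awCoeff q a b c d (m + 1) (l + 1) * ((a * q ^ (l + 1))⁻¹ + a * q ^ (l + 1))) *
        awBasis q a (l + 1) := by
    intro l hl
    have := key (l + 1) (by simpa using hl) (awCoeff q a b c d (m + 1) l * (a * q ^ l)⁻¹) ?_
    · simp only [← mul_assoc, ← C_mul, ← add_mul, ← C_add, this, sub_add_cancel]
    · have h := awCoeff_succ_right G (m + 1) l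
      rw [← hQd] at h
      have hp := pow_ne_zero l hq
      rw [pow_succ]
      rw [pow_succ] at h
      generalize q ^ l = y at *
      field_simp at h ⊢
      linear_combination h
  rw [Finset.sum_congr rfl mid]
  have e0 : C (awRecA q a b c d Q) * (C (awCoeff q a b c d (m + 2) 0) * awBasis q a 0) +
        C (awRecB q a b c d Q) * (C (awCoeff q a b c d (m + 1) 0) * awBasis q a 0) +
        C (awRecC q a b c d Q) * (C (awCoeff q a b c d m 0) * awBasis q a 0) =
      C (awCoeff q a b c d (m + 1) 0 * ((a * q ^ 0)⁻¹ + a * q ^ 0)) * awBasis q a 0 := by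
    rw [sub_zero] at eq0
    simp only [← mul_assoc, ← C_mul, ← add_mul, ← C_add, eq0]
  rw [e0]
  have etop : C (awRecA q a b c d Q) *
      (C (awCoeff q a b c d (m + 2) (m + 2)) * awBasis q a (m + 2)) +
        C (awRecB q a b c d Q) * (C (awCoeff q a b c d (m + 1) (m + 2)) * awBasis q a (m + 2)) +
        C (awRecC q a b c d Q) * (C (awCoeff q a b c d m (m + 2)) * awBasis q a (m + 2)) +
        C (awCoeff q a b c d (m + 1) (m + 1) * (a * q ^ (m + 1))⁻¹) * awBasis q a (m + 2) = 0 := by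
    rw [awCoeff_eq_zero hq (show m + 1 < m + 2 by omega), awCoeff_eq_zero hq (show m < m + 2 by omega),
      C_0, zero_mul, mul_zero, mul_zero, add_zero, add_zero, ← mul_assoc, ← C_mul, ← add_mul, ← C_add,
      top, C_0, zero_mul]
  linear_combination etop

theorem natDegree_awBasis_le (l : ℕ) : (awBasis q a l).natDegree ≤ l := by
  induction l with
  | zero => simp [awBasis]
  | succ l ih =>
    rw [awBasis, Finset.prod_range_succ]
    refine natDegree_mul_le.trans (add_le_add ih ?_)
    compute_degree

theorem coeff_awBasis_self (l : ℕ) :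
    (awBasis q a l).coeff l = ∏ i ∈ Finset.range l, -(2 * a * q ^ i) := by
  induction l with
  | zero => simp [awBasis]
  | succ l ih =>
    have h : (1 - C (2 * a * q ^ l) * X + C (a ^ 2 * q ^ (2 * l)) : ℂ[X]).natDegree ≤ 1 := by
      compute_degree
    have e : awBasis q a (l + 1) =
        awBasis q a l * (1 - C (2 * a * q ^ l) * X + C (a ^ 2 * q ^ (2 * l))) :=
      Finset.prod_range_succ _ _
    rw [Finset.prod_range_succ, ← ih, e]
    rw [coeff_mul_add_eq_of_natDegree_le (natDegree_awBasis_le l) h]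
    rw [coeff_add, coeff_sub, coeff_C_mul, coeff_X_one, coeff_one, coeff_C]
    simp

theorem degree_aw (G : Generic q (a * b * c * d)) (ha : a ≠ 0) (n : ℕ) :
    (aw q a b c d n).degree = n := by
  have hle : (aw q a b c d n).natDegree ≤ n := by
    refine natDegree_sum_le_of_forall_le _ _ fun l hl => ?_
    refine (natDegree_C_mul_le _ _).trans ((natDegree_awBasis_le l).trans ?_)
    exact Nat.lt_succ_iff.mp (Finset.mem_range.mp hl)
  have hc : (aw q a b c d n).coeff n ≠ 0 := by
    rw [aw, finsetSum_coeff, Finset.sum_range_succ, Finset.sum_eq_zero, zero_add, coeff_C_mul,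
      coeff_awBasis_self]
    · refine mul_ne_zero (awCoeff_self_ne_zero G ha n) (Finset.prod_ne_zero_iff.mpr fun i _ => ?_)
      exact neg_ne_zero.mpr (mul_ne_zero (mul_ne_zero two_ne_zero ha) (pow_ne_zero i G.q_ne))
    · intro l hl
      rw [coeff_C_mul, coeff_eq_zero_of_natDegree_lt, mul_zero]
      exact (natDegree_awBasis_le l).trans_lt (Finset.mem_range.mp hl)
  exact degree_eq_of_le_of_coeff_ne_zero (degree_le_of_natDegree_le hle) hc

/-- The Askey-Wilson polynomials do not change when `a` and `b` are interchanged: the recurrence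
and the first two polynomials are symmetric. -/
theorem aw_swap (G : Generic q (a * b * c * d)) (ha : a ≠ 0) (hb : b ≠ 0) (hc : c ≠ 0)
    (hd : d ≠ 0) (n : ℕ) : aw q b a c d n = aw q a b c d n := by
  have hab : b * a * c * d = a * b * c * d := by ring
  have G' : Generic q (b * a * c * d) := by rwa [hab]
  have hq := G.q_ne
  induction n using Nat.twoStepInduction with
  | zero => simp [aw, awCoeff, awBasis, qPoch]
  | one =>
    have h1 : (1 : ℂ) - q ≠ 0 := G.q_sub
    have e : ∀ a b : ℂ, a ≠ 0 → aw q a b c d 1 =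
        C (a⁻¹ * ((1 - a * b) * (1 - a * c) * (1 - a * d)) - (a⁻¹ + a) * (1 - a * b * c * d)) +
          C (2 * (1 - a * b * c * d)) * X := by
      intro a b ha
      have e1 : (1 - q⁻¹) * (1 - a * b * c * d) / (1 - q) * q = -(1 - a * b * c * d) := by
        field_simp
        ring
      have e2 : a⁻¹ * ((1 - q⁻¹) * (1 - a * b * c * d) / (1 - q)) * q =
          -(a⁻¹ * (1 - a * b * c * d)) := by rw [mul_assoc, e1]; ring
      have e3 : (C a⁻¹ * C a : ℂ[X]) = 1 := by rw [← C_mul, inv_mul_cancel₀ ha, C_1]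
      simp only [aw, awCoeff, awBasis, Finset.sum_range_succ, Finset.range_zero, Finset.sum_empty,
        qPoch_succ, qPoch_zero, Finset.prod_range_succ]
      simp only [Nat.sub_self, qPoch_zero, Nat.cast_one, sub_self, zpow_zero, pow_zero, mul_one,
        one_mul, zero_add, pow_one, div_one, mul_zero, zpow_neg, zpow_one]
      rw [e2]
      simp only [C_add, C_mul, map_pow, C_neg, C_sub, C_1]
      linear_combination (-(1 - C a * C b * C c * C d) * (C a - C 2 * X)) * e3
    rw [e a b ha, e b a hb, hab]
    congr 2
    field_simp
    ring
  | more m ih0 ih1 =>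
    have r := aw_recurrence G ha hb hc hd m
    have r' := aw_recurrence G' hb ha hc hd m
    have hA : awRecA q b a c d (q ^ (m + 1)) = awRecA q a b c d (q ^ (m + 1)) := by
      simp only [awRecA, hab]
    have hB : awRecB q b a c d (q ^ (m + 1)) = awRecB q a b c d (q ^ (m + 1)) := by
      simp only [awRecB, hab, add_comm b a, add_comm b⁻¹ a⁻¹]
    have hC : awRecC q b a c d (q ^ (m + 1)) = awRecC q a b c d (q ^ (m + 1)) := by
      simp only [awRecC, mul_comm b a]
      congr 1
      ring
    have hA0 : awRecA q a b c d (q ^ (m + 1)) ≠ 0 := by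
      have h1 := G.t_sub (m + 1)
      have h2 := G.t_sub (2 * m + 2)
      have h3 := G.t_sub (2 * m + 3)
      have hQ : (q ^ (m + 1)) ^ 2 = q ^ (2 * m + 2) := by ring
      unfold awRecA
      rw [hQ]
      refine div_ne_zero ?_ (mul_ne_zero ?_ ?_) <;> intro h
      · apply h1; field_simp at h; linear_combination h
      · apply h2; field_simp at h; linear_combination h
      · apply h3; rw [pow_succ]; linear_combination q * h
    rw [hA, hB, hC, ih0, ih1, ← r] at r'
    have := add_right_cancel (add_right_cancel r')
    exact mul_left_cancel₀ (C_ne_zero.mpr hA0) this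

end

/-! ### The ring of q-difference operators -/

theorem algHom_ratFunc_ext {f g : RatFunc ℂ →ₐ[ℂ] RatFunc ℂ} (h : f RatFunc.X = g RatFunc.X) :
    f = g := by
  have key : ∀ p : ℂ[X], f (algebraMap ℂ[X] (RatFunc ℂ) p) = g (algebraMap ℂ[X] (RatFunc ℂ) p) := by
    intro p
    rw [← RatFunc.aeval_X_left_eq_algebraMap, ← aeval_algHom_apply, ← aeval_algHom_apply, h]
  ext r
  rw [← RatFunc.num_div_denom r, map_div₀, map_div₀, key, key]

theorem transcendental_C_mul_X {s : ℂ} (hs : s ≠ 0) :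
    Function.Injective (aeval (RatFunc.C s * RatFunc.X : RatFunc ℂ) : ℂ[X] →ₐ[ℂ] RatFunc ℂ) := by
  rw [injective_iff_map_eq_zero]
  intro p hp
  have e : (aeval (RatFunc.C s * RatFunc.X : RatFunc ℂ)) p =
      algebraMap ℂ[X] (RatFunc ℂ) (p.comp (C s * X)) := by
    rw [← RatFunc.aeval_X_left_eq_algebraMap, aeval_comp]
    simp
  rw [e, map_eq_zero_iff _ (RatFunc.algebraMap_injective ℂ)] at hp
  have := congrArg (fun r => r.comp (C s⁻¹ * X)) hp
  simp only [comp_assoc, zero_comp] at this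
  simpa [← mul_assoc, ← C_mul, mul_inv_cancel₀ hs] using this

/-- The substitution `r(z) ↦ r(s z)` as an algebra homomorphism, for `s ≠ 0`. -/
def scaleHom (s : ℂˣ) : RatFunc ℂ →ₐ[ℂ] RatFunc ℂ :=
  RatFunc.liftAlgHom (aeval (RatFunc.C (s : ℂ) * RatFunc.X : RatFunc ℂ))
    (nonZeroDivisors_le_comap_nonZeroDivisors_of_injective _ (transcendental_C_mul_X s.ne_zero))

theorem scaleHom_X (s : ℂˣ) : scaleHom s RatFunc.X = RatFunc.C (s : ℂ) * RatFunc.X := by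
  have := RatFunc.liftAlgHom_apply_div (aeval (RatFunc.C (s : ℂ) * RatFunc.X : RatFunc ℂ))
    (nonZeroDivisors_le_comap_nonZeroDivisors_of_injective _ (transcendental_C_mul_X s.ne_zero))
    X 1
  simpa [scaleHom] using this

theorem scaleHom_C (s : ℂˣ) (x : ℂ) : scaleHom s (RatFunc.C x) = RatFunc.C x :=
  (scaleHom s).commutes x

theorem scale_eq (s : ℂˣ) (r : RatFunc ℂ) : scale s r = scaleHom s r := by
  rw [scale, RatFunc.eval, scaleHom, RatFunc.liftAlgHom_apply]
  rfl

theorem scaleHom_mul (s t : ℂˣ) (r : RatFunc ℂ) :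
    scaleHom (s * t) r = scaleHom s (scaleHom t r) := by
  have : scaleHom (s * t) = (scaleHom s).comp (scaleHom t) := algHom_ratFunc_ext (by
    rw [AlgHom.comp_apply, scaleHom_X, scaleHom_X, map_mul, scaleHom_X, scaleHom_C, Units.val_mul,
      map_mul]
    ring)
  rw [this, AlgHom.comp_apply]

theorem scaleHom_one (r : RatFunc ℂ) : scaleHom 1 r = r := by
  have : scaleHom 1 = AlgHom.id ℂ (RatFunc ℂ) := algHom_ratFunc_ext (by simp [scaleHom_X])
  rw [this, AlgHom.id_apply]

/-- The monomial `β(z) D_z^j`, where `D_z r(z) = r(q z)`. -/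
def qMonomial (q : ℂˣ) (β : RatFunc ℂ) (j : ℤ) : Module.End ℂ (RatFunc ℂ) :=
  LinearMap.mulLeft ℂ β ∘ₗ (scaleHom (q ^ j)).toLinearMap

theorem qMonomial_apply (q : ℂˣ) (β : RatFunc ℂ) (j : ℤ) (r : RatFunc ℂ) :
    qMonomial q β j r = β * scaleHom (q ^ j) r := rfl

theorem qMonomial_mul (q : ℂˣ) (β γ : RatFunc ℂ) (i j : ℤ) :
    qMonomial q β i * qMonomial q γ j = qMonomial q (β * scaleHom (q ^ i) γ) (i + j) := by
  ext r
  simp only [Module.End.mul_apply, qMonomial_apply, map_mul, zpow_add, scaleHom_mul, mul_assoc]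

theorem qMonomial_one (q : ℂˣ) : qMonomial q 1 0 = 1 := by
  ext r
  simp [qMonomial_apply, scaleHom_one]

/-- The algebra of `q`-difference operators with rational coefficients. -/
def qDiff (q : ℂˣ) : Subalgebra ℂ (Module.End ℂ (RatFunc ℂ)) :=
  (Submodule.span ℂ {T | ∃ β j, T = qMonomial q β j}).toSubalgebra
    (Submodule.subset_span ⟨1, 0, (qMonomial_one q).symm⟩) fun x y hx hy => by
      have := Submodule.mul_mem_mul hx hy
      rw [Submodule.span_mul_span] at this
      refine Submodule.span_mono ?_ this
      rintro _ ⟨_, ⟨β, i, rfl⟩, _, ⟨γ, j, rfl⟩, rfl⟩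
      exact ⟨_, _, qMonomial_mul q β γ i j⟩

theorem qMonomial_mem (q : ℂˣ) (β : RatFunc ℂ) (j : ℤ) : qMonomial q β j ∈ qDiff q :=
  Submodule.subset_span ⟨β, j, rfl⟩

theorem exists_finsupp_of_mem_qDiff {q : ℂˣ} {T : Module.End ℂ (RatFunc ℂ)} (hT : T ∈ qDiff q) :
    ∃ β : ℤ →₀ RatFunc ℂ, ∀ r, T r = β.sum fun j βj => βj * scaleHom (q ^ j) r := by
  refine Submodule.span_induction (p := fun T _ => ∃ β : ℤ →₀ RatFunc ℂ, ∀ r,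
    T r = β.sum fun j βj => βj * scaleHom (q ^ j) r) ?_ ?_ ?_ ?_ hT
  · rintro _ ⟨β, j, rfl⟩
    exact ⟨Finsupp.single j β, fun r => by simp [qMonomial_apply]⟩
  · exact ⟨0, fun r => by simp⟩
  · rintro S T - - ⟨β, hβ⟩ ⟨γ, hγ⟩
    refine ⟨β + γ, fun r => ?_⟩
    rw [Finsupp.sum_add_index' (by simp) (by intros; ring), LinearMap.add_apply, hβ, hγ]
  · rintro s T - ⟨β, hβ⟩
    refine ⟨s • β, fun r => ?_⟩
    rw [Finsupp.sum_smul_index' (by simp), LinearMap.smul_apply, hβ, Finsupp.smul_sum]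
    simp

theorem isQDifferenceOperator_of_mem {q : ℝ} {u : ℂˣ} (hu : (u : ℂ) = q)
    {T : Module.End ℂ (RatFunc ℂ)} (hT : T ∈ qDiff u) : IsQDifferenceOperator q T := by
  obtain ⟨β, hβ⟩ := exists_finsupp_of_mem_qDiff hT
  refine ⟨β, fun r => (hβ r).trans (Finsupp.sum_congr fun j _ => ?_)⟩
  rw [← hu, ← Units.val_zpow_eq_zpow_val, scale_eq]

/-- The algebra homomorphism `p(x) ↦ p((z + 1/z)/2)`. -/
def zEval : ℂ[X] →ₐ[ℂ] RatFunc ℂ :=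
  aeval ((RatFunc.X + RatFunc.X⁻¹) / 2 : RatFunc ℂ)

theorem scaleHom_zEval (s : ℂˣ) (p : ℂ[X]) : scaleHom s (zEval p) =
    aeval ((RatFunc.C (s : ℂ) * RatFunc.X + (RatFunc.C (s : ℂ) * RatFunc.X)⁻¹) / 2 : RatFunc ℂ) p := by
  rw [zEval, ← aeval_algHom_apply]
  congr 2
  rw [map_div₀, map_add, map_inv₀, scaleHom_X, map_ofNat]

/-- A `q`-difference operator is determined by its values on the polynomials in `z + 1/z`. The
points `q^j z + q^{-j}/z`, `j ∈ ℤ`, are pairwise distinct, so that Lagrange interpolation isolates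
each coefficient. -/
theorem eq_zero_of_mem_qDiff {q : ℂˣ} (hq : ∀ n : ℕ, (q : ℂ) ^ (n + 1) ≠ 1)
    {T : Module.End ℂ (RatFunc ℂ)} (hT : T ∈ qDiff q) (h : ∀ p : ℂ[X], T (zEval p) = 0) :
    T = 0 := by
  obtain ⟨β, hβ⟩ := exists_finsupp_of_mem_qDiff hT
  set w : ℤ → RatFunc ℂ := fun j =>
    (RatFunc.C ((q ^ j : ℂˣ) : ℂ) * RatFunc.X + (RatFunc.C ((q ^ j : ℂˣ) : ℂ) * RatFunc.X)⁻¹) / 2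
    with hw
  have hX : (RatFunc.X : RatFunc ℂ) ≠ 0 := RatFunc.X_ne_zero
  have hne : ∀ {i j : ℤ}, i < j → q ^ i ≠ q ^ j := by
    intro i j hlt e
    apply hq (j - i - 1).toNat
    rw [← Units.val_pow_eq_pow_val, ← zpow_natCast, Nat.cast_succ,
      Int.toNat_of_nonneg (by omega), sub_add_cancel, zpow_sub, ← e, mul_inv_cancel, Units.val_one]
  have winj : Function.Injective w := by
    intro i j hij
    have hi : RatFunc.C ((q ^ i : ℂˣ) : ℂ) ≠ 0 := (_root_.map_ne_zero _).mpr (Units.ne_zero _)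
    have hj : RatFunc.C ((q ^ j : ℂˣ) : ℂ) ≠ 0 := (_root_.map_ne_zero _).mpr (Units.ne_zero _)
    have e : (RatFunc.C ((q ^ i : ℂˣ) : ℂ) - RatFunc.C ((q ^ j : ℂˣ) : ℂ)) *
        (RatFunc.C ((q ^ i : ℂˣ) : ℂ) * RatFunc.C ((q ^ j : ℂˣ) : ℂ) * RatFunc.X ^ 2 - 1) = 0 := by
      have h2 : (2 : RatFunc ℂ) ≠ 0 := two_ne_zero
      simp only [hw] at hij
      field_simp at hij
      linear_combination hij
    rcases mul_eq_zero.mp e with e | e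
    · have e' : q ^ i = q ^ j := Units.ext (RatFunc.C_injective (sub_eq_zero.mp e))
      rcases lt_trichotomy i j with hlt | heq | hlt
      · exact absurd e' (hne hlt)
      · exact heq
      · exact absurd e'.symm (hne hlt)
    · exfalso
      have : algebraMap ℂ[X] (RatFunc ℂ)
          (C (((q ^ i : ℂˣ) : ℂ) * ((q ^ j : ℂˣ) : ℂ)) * X ^ 2 - 1) = 0 := by
        rw [map_sub, map_mul, map_pow, RatFunc.algebraMap_X, RatFunc.algebraMap_C, map_mul, map_one]
        exact e
      rw [map_eq_zero_iff _ (RatFunc.algebraMap_injective ℂ)] at this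
      have := congrArg (fun p => p.eval 0) this
      simp at this
  have hpow : ∀ n : ℕ, ∑ j ∈ β.support, β j * w j ^ n = 0 := by
    intro n
    have := hβ (zEval (X ^ n))
    rw [h] at this
    rw [this]
    refine Finset.sum_congr rfl fun j _ => ?_
    change _ = β j * scaleHom (q ^ j) (zEval (X ^ n))
    rw [scaleHom_zEval, map_pow, aeval_X]
  have hpoly : ∀ P : (RatFunc ℂ)[X], ∑ j ∈ β.support, β j * P.eval (w j) = 0 := by
    intro P
    simp only [eval_eq_sum_range, Finset.mul_sum]
    rw [Finset.sum_comm]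
    refine Finset.sum_eq_zero fun n _ => ?_
    rw [← mul_zero (P.coeff n), ← hpow n, Finset.mul_sum]
    exact Finset.sum_congr rfl fun j _ => by ring
  have hβ0 : β = 0 := by
    by_contra hne
    obtain ⟨j₀, hj₀⟩ := Finsupp.support_nonempty_iff.mpr hne
    have := hpoly (∏ i ∈ β.support.erase j₀, (X - C (w i)))
    rw [Finset.sum_eq_single_of_mem j₀ hj₀] at this
    · rcases mul_eq_zero.mp this with h0 | h0
      · exact (Finsupp.mem_support_iff.mp hj₀) h0
      · rw [eval_prod, Finset.prod_eq_zero_iff] at h0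
        obtain ⟨i, hi, h0⟩ := h0
        rw [eval_sub, eval_X, eval_C, sub_eq_zero] at h0
        exact (Finset.mem_erase.mp hi).1 (winj h0).symm
    · intro j hj hne
      rw [eval_prod, Finset.prod_eq_zero (Finset.mem_erase.mpr ⟨hne, hj⟩) (by simp), mul_zero]
  ext r
  rw [hβ, hβ0]
  simp

/-! ### The Askey-Wilson operator -/

/-- The rational function `(1-αz)(1-γz)(1-δz)(β₀ + β₁z) / ((1-z²)(1-qz²))` at a point `z` of an
extension of `ℂ`. -/
def awWeight (q α γ δ β₀ β₁ : ℂ) (z : RatFunc ℂ) : RatFunc ℂ :=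
  (1 - RatFunc.C α * z) * (1 - RatFunc.C γ * z) * (1 - RatFunc.C δ * z) *
    (RatFunc.C β₀ + RatFunc.C β₁ * z) / ((1 - z ^ 2) * (1 - RatFunc.C q * z ^ 2))

/-- The second order operator `u(z)(D_z - 1) + u(1/z)(D_z⁻¹ - 1)` with the weight `awWeight`. For
`(β₀, β₁) = (1, -b)` it is the Askey-Wilson operator. -/
def awOperator (q : ℂˣ) (α γ δ β₀ β₁ : ℂ) : Module.End ℂ (RatFunc ℂ) :=
  qMonomial q (awWeight q α γ δ β₀ β₁ RatFunc.X) 1 - qMonomial q (awWeight q α γ δ β₀ β₁ RatFunc.X) 0 +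
    (qMonomial q (awWeight q α γ δ β₀ β₁ RatFunc.X⁻¹) (-1) -
      qMonomial q (awWeight q α γ δ β₀ β₁ RatFunc.X⁻¹) 0)

theorem awOperator_mem (q : ℂˣ) (α γ δ β₀ β₁ : ℂ) : awOperator q α γ δ β₀ β₁ ∈ qDiff q :=
  add_mem (sub_mem (qMonomial_mem _ _ _) (qMonomial_mem _ _ _))
    (sub_mem (qMonomial_mem _ _ _) (qMonomial_mem _ _ _))

theorem awOperator_apply (q : ℂˣ) (α γ δ β₀ β₁ : ℂ) (r : RatFunc ℂ) :
    awOperator q α γ δ β₀ β₁ r = awWeight q α γ δ β₀ β₁ RatFunc.X * (scaleHom q r - r) +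
      awWeight q α γ δ β₀ β₁ RatFunc.X⁻¹ * (scaleHom q⁻¹ r - r) := by
  simp only [awOperator, LinearMap.add_apply, LinearMap.sub_apply, qMonomial_apply, zpow_one,
    zpow_zero, scaleHom_one, zpow_neg]
  ring

section
variable (q : ℂˣ) (a c d β₀ β₁ : ℂ)

theorem zEval_factor (e : ℂ) (s : ℂˣ) :
    scaleHom s (zEval (1 - C (2 * e) * X + C (e ^ 2))) =
      (1 - RatFunc.C (e * s) * RatFunc.X) * (1 - RatFunc.C (e / s) * RatFunc.X⁻¹) := by
  have hs : RatFunc.C (s : ℂ) ≠ 0 := (_root_.map_ne_zero _).mpr s.ne_zero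
  have hX : (RatFunc.X : RatFunc ℂ) ≠ 0 := RatFunc.X_ne_zero
  rw [scaleHom_zEval]
  simp only [map_add, map_sub, map_mul, map_one, map_pow, aeval_X, aeval_C, map_div₀,
    RatFunc.algebraMap_eq_C, show RatFunc.C (2 : ℂ) = 2 from map_ofNat _ 2]
  field_simp
  ring

theorem awBasis_succ (l : ℕ) : awBasis q a (l + 1) =
    awBasis q a l * (1 - C (2 * (a * q ^ l)) * X + C ((a * q ^ l) ^ 2)) := by
  rw [awBasis, Finset.prod_range_succ, mul_assoc 2 a, mul_comm 2 l, pow_mul, ← mul_pow]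
  rfl

theorem one_sub_ne_zero (e : ℂ) : (1 : RatFunc ℂ) - RatFunc.C e * RatFunc.X ≠ 0 := by
  have : algebraMap ℂ[X] (RatFunc ℂ) (1 - C e * X) ≠ 0 := by
    rw [Ne, map_eq_zero_iff _ (RatFunc.algebraMap_injective ℂ)]
    intro h
    have := congrArg (fun p => p.eval 0) h
    simp at this
  simpa [RatFunc.algebraMap_X, RatFunc.algebraMap_C] using this

theorem one_sub_inv_ne_zero (e : ℂ) : (1 : RatFunc ℂ) - RatFunc.C e * RatFunc.X⁻¹ ≠ 0 := by
  have : algebraMap ℂ[X] (RatFunc ℂ) (X - C e) ≠ 0 := by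
    rw [Ne, map_eq_zero_iff _ (RatFunc.algebraMap_injective ℂ)]
    exact X_sub_C_ne_zero e
  intro h
  apply this
  have hX : (RatFunc.X : RatFunc ℂ) ≠ 0 := RatFunc.X_ne_zero
  rw [map_sub, RatFunc.algebraMap_X, RatFunc.algebraMap_C]
  field_simp at h
  rw [h, mul_zero]

theorem one_sub_sq_ne_zero (e : ℂ) : (1 : RatFunc ℂ) - RatFunc.C e * RatFunc.X ^ 2 ≠ 0 := by
  have : algebraMap ℂ[X] (RatFunc ℂ) (1 - C e * X ^ 2) ≠ 0 := by
    rw [Ne, map_eq_zero_iff _ (RatFunc.algebraMap_injective ℂ)]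
    intro h
    have := congrArg (fun p => p.eval 0) h
    simp at this
  simpa [RatFunc.algebraMap_X, RatFunc.algebraMap_C] using this

theorem scaleHom_awBasis (l : ℕ) :
    (1 - RatFunc.C a * RatFunc.X) * (1 - RatFunc.C (a * q ^ l / q) * RatFunc.X⁻¹) *
      scaleHom q (zEval (awBasis q a l)) =
    zEval (awBasis q a l) * ((1 - RatFunc.C (a * q ^ l) * RatFunc.X) *
      (1 - RatFunc.C (a / q) * RatFunc.X⁻¹)) := by
  induction l with
  | zero => simp [awBasis]
  | succ l ih =>
    have h1 := zEval_factor (a * (q : ℂ) ^ l) 1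
    have h2 := zEval_factor (a * (q : ℂ) ^ l) q
    rw [scaleHom_one, Units.val_one, mul_one, div_one] at h1
    rw [awBasis_succ, map_mul, map_mul, h2, h1, pow_succ, ← mul_assoc a,
      mul_div_cancel_right₀ _ q.ne_zero]
    linear_combination ((1 - RatFunc.C (a * (q : ℂ) ^ l) * RatFunc.X⁻¹) *
      (1 - RatFunc.C (a * (q : ℂ) ^ l * q) * RatFunc.X)) * ih

theorem scaleHom_inv_awBasis (l : ℕ) :
    (1 - RatFunc.C a * RatFunc.X⁻¹) * (1 - RatFunc.C (a * q ^ l / q) * RatFunc.X) *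
      scaleHom q⁻¹ (zEval (awBasis q a l)) =
    zEval (awBasis q a l) * ((1 - RatFunc.C (a * q ^ l) * RatFunc.X⁻¹) *
      (1 - RatFunc.C (a / q) * RatFunc.X)) := by
  induction l with
  | zero => simp [awBasis]
  | succ l ih =>
    have h1 := zEval_factor (a * (q : ℂ) ^ l) 1
    have h2 := zEval_factor (a * (q : ℂ) ^ l) q⁻¹
    rw [scaleHom_one, Units.val_one, mul_one, div_one] at h1
    rw [Units.val_inv_eq_inv_val, div_inv_eq_mul, ← div_eq_mul_inv] at h2
    rw [awBasis_succ, map_mul, map_mul, h2, h1, pow_succ, ← mul_assoc a,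
      mul_div_cancel_right₀ _ q.ne_zero]
    linear_combination ((1 - RatFunc.C (a * (q : ℂ) ^ l) * RatFunc.X) *
      (1 - RatFunc.C (a * (q : ℂ) ^ l * q) * RatFunc.X⁻¹)) * ih

/-- The operator `awOperator` lowers the index of the basis `(az, a/z; q)_l` up to a factor that is
linear in `z + 1/z`. -/
theorem awOperator_awBasis_succ (l : ℕ) {e : ℂ} (he : e = a * q ^ l) :
    awOperator q a c d β₀ β₁ (zEval (awBasis q a (l + 1))) =
      zEval (C (-(a - e * q) / q) * awBasis q a l *
        (C β₀ * (2 * X - C (e + c + d) + C (e * c * d)) +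
          C β₁ * (C (e * c * d) * (2 * X) + 1 - C (e * c + e * d + c * d)))) := by
  have hq : RatFunc.C (q : ℂ) ≠ 0 := (_root_.map_ne_zero _).mpr q.ne_zero
  have hX : (RatFunc.X : RatFunc ℂ) ≠ 0 := RatFunc.X_ne_zero
  have h1 := scaleHom_awBasis q a (l + 1)
  have h2 := scaleHom_inv_awBasis q a (l + 1)
  have h3 := zEval_factor e 1
  rw [scaleHom_one, Units.val_one, mul_one, div_one] at h3
  have h4 : zEval (awBasis q a (l + 1)) = zEval (awBasis q a l) *
      ((1 - RatFunc.C e * RatFunc.X) * (1 - RatFunc.C e * RatFunc.X⁻¹)) := by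
    rw [awBasis_succ, map_mul, ← he, h3]
  rw [pow_succ, ← mul_assoc, ← he, mul_div_cancel_right₀ _ q.ne_zero] at h1 h2
  have hn1 := one_sub_inv_ne_zero e
  have hn2 := one_sub_ne_zero e
  have h5 := one_sub_sq_ne_zero 1
  have h6 := one_sub_sq_ne_zero q
  have h7 := one_sub_sq_ne_zero (q⁻¹ : ℂ)
  have h8 : (zEval X : RatFunc ℂ) = (RatFunc.X + RatFunc.X⁻¹) / 2 := aeval_X _
  have h9 : ∀ x : ℂ, (zEval (C x) : RatFunc ℂ) = RatFunc.C x := fun x => aeval_C _ _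
  rw [awOperator_apply]
  -- The shifted basis elements, multiplied by the first factor of the weight.
  have s1 : (1 - RatFunc.C a * RatFunc.X) * (scaleHom q (zEval (awBasis q a (l + 1))) -
      zEval (awBasis q a (l + 1))) = zEval (awBasis q a l) * (1 - RatFunc.C e * RatFunc.X) *
        ((1 - RatFunc.C (e * q) * RatFunc.X) * (1 - RatFunc.C (a / q) * RatFunc.X⁻¹) -
          (1 - RatFunc.C a * RatFunc.X) * (1 - RatFunc.C e * RatFunc.X⁻¹)) := by
    apply mul_left_cancel₀ hn1
    linear_combination h1 + ((1 - RatFunc.C (e * q) * RatFunc.X) *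
      (1 - RatFunc.C (a / q) * RatFunc.X⁻¹) - (1 - RatFunc.C e * RatFunc.X⁻¹) *
        (1 - RatFunc.C a * RatFunc.X)) * h4
  have s2 : (1 - RatFunc.C a * RatFunc.X⁻¹) * (scaleHom q⁻¹ (zEval (awBasis q a (l + 1))) -
      zEval (awBasis q a (l + 1))) = zEval (awBasis q a l) * (1 - RatFunc.C e * RatFunc.X⁻¹) *
        ((1 - RatFunc.C (e * q) * RatFunc.X⁻¹) * (1 - RatFunc.C (a / q) * RatFunc.X) -
          (1 - RatFunc.C a * RatFunc.X⁻¹) * (1 - RatFunc.C e * RatFunc.X)) := by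
    apply mul_left_cancel₀ hn2
    linear_combination h2 + ((1 - RatFunc.C (e * q) * RatFunc.X⁻¹) *
      (1 - RatFunc.C (a / q) * RatFunc.X) - (1 - RatFunc.C e * RatFunc.X) *
        (1 - RatFunc.C a * RatFunc.X⁻¹)) * h4
  have e1 : ∀ (z r : RatFunc ℂ), awWeight q a c d β₀ β₁ z * r =
      (1 - RatFunc.C a * z) * r * ((1 - RatFunc.C c * z) * (1 - RatFunc.C d * z) *
    (RatFunc.C β₀ + RatFunc.C β₁ * z) / ((1 - z ^ 2) * (1 - RatFunc.C (q : ℂ) * z ^ 2))) := by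
    intro z r
    rw [awWeight]
    ring
  rw [e1, e1, s1, s2]
  rw [map_one, one_mul] at h5
  rw [map_inv₀] at h7
  have h7' : (RatFunc.X ^ 2 - RatFunc.C (q : ℂ) : RatFunc ℂ) ≠ 0 := by
    intro h; apply h7; field_simp; linear_combination -h
  have h5' : (RatFunc.X ^ 2 - 1 : RatFunc ℂ) ≠ 0 := by
    intro h; apply h5; linear_combination -h
  simp only [map_add, map_sub, map_mul, h8, h9, map_one, map_div₀, map_neg, map_ofNat]
  generalize zEval (awBasis q a l) = φ
  generalize RatFunc.C a = a
  generalize RatFunc.C e = e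
  generalize RatFunc.C c = c
  generalize RatFunc.C d = d
  generalize RatFunc.C β₀ = β₀
  generalize RatFunc.C β₁ = β₁
  generalize RatFunc.C (q : ℂ) = q at *
  generalize (RatFunc.X : RatFunc ℂ) = z at *
  have t1 : (1 - e * q * z) * (1 - a / q * z⁻¹) - (1 - a * z) * (1 - e * z⁻¹) =
      -(a - e * q) / (q * z) * (1 - q * z ^ 2) := by
    field_simp
    ring
  have t2 : (1 - e * q * z⁻¹) * (1 - a / q * z) - (1 - a * z⁻¹) * (1 - e * z) =
      -(a - e * q) * z / q * (1 - q * z⁻¹ ^ 2) := by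
    field_simp
    ring
  have h8' : 1 - q * z⁻¹ ^ 2 ≠ 0 := by
    intro h; apply h7'; field_simp at h; rw [h, mul_zero]
  have h9' : 1 - z⁻¹ ^ 2 ≠ 0 := by
    intro h; apply h5'; field_simp at h; rw [h, mul_zero]
  have t3 : ∀ x y u v w : RatFunc ℂ, u ≠ 0 → x * (y * u) * (v / (w * u)) = x * y * (v / w) := by
    intro x y u v w hu
    by_cases hw : w = 0
    · simp [hw]
    · field_simp
  rw [t1, t2, t3 _ _ _ _ _ h6, t3 _ _ _ _ _ h8',
    show (1 : RatFunc ℂ) - z⁻¹ ^ 2 = -(1 - z ^ 2) / z ^ 2 by field_simp; ring]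
  generalize hD : 1 - z ^ 2 = D at *
  field_simp
  subst hD
  ring

theorem awOperator_one : awOperator q a c d β₀ β₁ 1 = 0 := by
  rw [awOperator_apply, map_one, map_one, sub_self, mul_zero, mul_zero, add_zero]

theorem C_mul_two_X (ha : a ≠ 0) (l : ℕ) {e : ℂ} (he : e = a * q ^ l) :
    awBasis q a l * (C e * (2 * X)) = C (1 + e ^ 2) * awBasis q a l - awBasis q a (l + 1) := by
  have h := X_mul_awBasis q.ne_zero ha l
  rw [← he] at h
  have he0 : e ≠ 0 := he ▸ mul_ne_zero ha (pow_ne_zero l q.ne_zero)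
  have h1 : (C e * C e⁻¹ : ℂ[X]) = 1 := by rw [← C_mul, mul_inv_cancel₀ he0, C_1]
  simp only [C_add, C_1, map_pow] at h ⊢
  linear_combination C e * h + (awBasis q a l - awBasis q a (l + 1)) * h1

/-- The Askey-Wilson operator is triangular in the basis `(az, a/z; q)_l`. -/
theorem awOperator_eigen_awBasis (ha : a ≠ 0) (b : ℂ) (l : ℕ) :
    awOperator q a c d 1 (-b) (zEval (awBasis q a l)) =
      zEval (C ((1 - q ^ l) * (1 - a * b * c * d * q ^ l / q) / q ^ l) * awBasis q a l -
        C ((1 - q ^ l) * (1 - a * b * q ^ l / q) * (1 - a * c * q ^ l / q) *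
          (1 - a * d * q ^ l / q) / q ^ l) * awBasis q a (l - 1)) := by
  have hq := q.ne_zero
  rcases l with - | l
  · have : awBasis q a 0 = 1 := by simp [awBasis]
    rw [this, map_one, awOperator_one]
    simp
  rw [awOperator_awBasis_succ q a c d 1 (-b) l rfl, Nat.add_sub_cancel]
  set e := a * (q : ℂ) ^ l with he
  have hp := pow_ne_zero l hq
  have he0 : e ≠ 0 := mul_ne_zero ha hp
  congr 1
  have h := C_mul_two_X q a ha l he
  have k1 : ((1 - (q : ℂ) ^ (l + 1)) * (1 - a * b * c * d * q ^ (l + 1) / q) / q ^ (l + 1)) =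
      (a - e * q) / q * e⁻¹ * (1 - e * b * c * d) := by
    rw [pow_succ, he]; field_simp
  have k2 : ((1 - (q : ℂ) ^ (l + 1)) * (1 - a * b * q ^ (l + 1) / q) *
      (1 - a * c * q ^ (l + 1) / q) * (1 - a * d * q ^ (l + 1) / q) / q ^ (l + 1)) =
      (a - e * q) / q * e⁻¹ * ((1 - e * b) * (1 - e * c) * (1 - e * d)) := by
    rw [pow_succ, he]; field_simp
  have h1 : (C e * C e⁻¹ : ℂ[X]) = 1 := by rw [← C_mul, mul_inv_cancel₀ he0, C_1]
  rw [k1, k2, neg_div]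
  generalize (a - e * q) / q = w
  simp only [C_add, C_sub, C_mul, C_neg, C_1, map_pow] at h ⊢
  linear_combination -C w * C e⁻¹ * (1 - C e * C b * C c * C d) * h -
    C w * awBasis q a l * (C e - C b * C c * C d + C b + C c + C d -
      C e * (C b * C c + C b * C d + C c * C d) - 2 * X * (1 - C e * C b * C c * C d)) * h1

/-- The action of the first order part of the Askey-Wilson operator. -/
theorem awOperator_first_order_awBasis (ha : a ≠ 0) (l : ℕ) :
    awOperator q a c d 0 1 (zEval (awBasis q a l)) =
      zEval (C ((1 - q ^ l) * (a / q) * (c * d)) * awBasis q a l -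
        C ((1 - q ^ l) * (a / q) * ((1 - a * c * q ^ l / q) * (1 - a * d * q ^ l / q))) *
          awBasis q a (l - 1)) := by
  have hq := q.ne_zero
  rcases l with - | l
  · have : awBasis q a 0 = 1 := by simp [awBasis]
    rw [this, map_one, awOperator_one]
    simp
  rw [awOperator_awBasis_succ q a c d 0 1 l rfl, Nat.add_sub_cancel]
  set e := a * (q : ℂ) ^ l with he
  congr 1
  have h := C_mul_two_X q a ha l he
  have k1 : (1 - (q : ℂ) ^ (l + 1)) * (a / q) * (c * d) = (a - e * q) / q * (c * d) := by
    rw [pow_succ, he]; field_simp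
  have k2 : (1 - (q : ℂ) ^ (l + 1)) * (a / q) * ((1 - a * c * q ^ (l + 1) / q) *
      (1 - a * d * q ^ (l + 1) / q)) = (a - e * q) / q * ((1 - e * c) * (1 - e * d)) := by
    rw [pow_succ, he]; field_simp
  rw [k1, k2, neg_div]
  generalize (a - e * q) / q = w
  simp only [C_add, C_sub, C_mul, C_neg, C_1, C_0, map_pow] at h ⊢
  linear_combination -C w * C c * C d * h

end

section
variable {q : ℂˣ} {a b c d : ℂ}

/-- A linear map that lowers the index of the basis `(az, a/z; q)_l` by at most one, applied to a
polynomial. -/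
theorem lowering_sum {T : Module.End ℂ (RatFunc ℂ)} {κ μ : ℕ → ℂ} (hμ : μ 0 = 0)
    (hT : ∀ l, T (zEval (awBasis q a l)) =
      zEval (C (κ l) * awBasis q a l - C (μ l) * awBasis q a (l - 1)))
    (f : ℕ → ℂ) (N : ℕ) (hf : f N = 0) :
    T (zEval (∑ l ∈ Finset.range N, C (f l) * awBasis q a l)) =
      zEval (∑ l ∈ Finset.range N, C (f l * κ l - f (l + 1) * μ (l + 1)) * awBasis q a l) := by
  have hC : ∀ (x : ℂ) (p : ℂ[X]), C x * p = x • p := fun x p => (smul_eq_C_mul x).symm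
  have e1 : ∑ l ∈ Finset.range N, C (f l * κ l - f (l + 1) * μ (l + 1)) * awBasis q a l =
      ∑ l ∈ Finset.range N, f l • (C (κ l) * awBasis q a l - C (μ l) * awBasis q a (l - 1)) := by
    have h := Finset.sum_range_succ (fun l => C (f l * μ l) * awBasis q a (l - 1)) N
    rw [Finset.sum_range_succ', hf, hμ] at h
    simp only [zero_mul, mul_zero, C_0, add_zero, Nat.add_sub_cancel] at h
    simp only [C_sub, sub_mul, Finset.sum_sub_distrib, smul_sub, h]
    congr 1 <;> exact Finset.sum_congr rfl fun l _ => by rw [← hC, C_mul, mul_assoc]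
  rw [e1, map_sum, map_sum, map_sum]
  refine Finset.sum_congr rfl fun l _ => ?_
  rw [hC, map_smul, map_smul, hT, map_smul]

/-- The Askey-Wilson polynomials are eigenfunctions of the Askey-Wilson operator. -/
theorem awOperator_aw (G : Generic q (a * b * c * d)) (ha : a ≠ 0) (n : ℕ) :
    awOperator q a c d 1 (-b) (zEval (aw q a b c d n)) =
      (((q : ℂ) ^ n)⁻¹ + a * b * c * d * (q : ℂ) ^ n / q - 1 - a * b * c * d / q) •
        zEval (aw q a b c d n) := by
  have hq := q.ne_zero
  rw [aw, lowering_sum (by simp) (awOperator_eigen_awBasis q a c d ha b) _ _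
    (awCoeff_eq_zero hq (Nat.lt_succ_self n)), ← map_smul, Finset.smul_sum]
  congr 1
  refine Finset.sum_congr rfl fun l _ => ?_
  rw [smul_eq_C_mul, ← mul_assoc, ← C_mul]
  congr 2
  have h := awCoeff_succ_right G n l
  have hp := pow_ne_zero l hq
  have hQ := pow_ne_zero n hq
  have e : ∀ u : ℂ, u * (q : ℂ) ^ (l + 1) / q = u * q ^ l := fun u => by
    rw [pow_succ]; field_simp
  rw [e, e, e]
  have e2 : awCoeff q a b c d n (l + 1) * ((1 - (q : ℂ) ^ (l + 1)) * (1 - a * b * q ^ l) *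
      (1 - a * c * q ^ l) * (1 - a * d * q ^ l) / q ^ (l + 1)) =
      awCoeff q a b c d n l * ((1 - (q : ℂ) ^ l / q ^ n) * (q - a * b * c * d * q ^ n * q ^ l)) /
        q ^ (l + 1) := by
    rw [← h]; ring
  rw [e2, pow_succ]
  field_simp
  ring

/-- Shifting the parameter `b` to `bq`, compared with a shift of the summation index. -/
theorem awCoeff_shift (G : Generic q (a * b * c * d)) {n l : ℕ} (h : l < n) :
    awCoeff q a (b * q) c d n l *
      ((1 - (q : ℂ) ^ l / q ^ n) * (q - a * b * c * d * (q : ℂ) ^ n)) =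
    awCoeff q a b c d n (l + 1) * ((1 - a * c * (q : ℂ) ^ l) * (1 - a * d * (q : ℂ) ^ l) *
      (1 - (q : ℂ) ^ (l + 1)) * (1 - a * b * (q : ℂ) ^ n)) := by
  have hq := G.q_ne
  obtain ⟨j, rfl⟩ := Nat.exists_eq_add_of_lt h
  have hqq := G.qPoch_q_ne l
  have h1 := G.pow_sub l
  have hp := pow_ne_zero (l + j + 1) hq
  have e0 : a * (b * q) * (q : ℂ) ^ l * q ^ j = a * b * q ^ (l + j + 1) := by ring
  have e3 : a * (b * q) * c * d * ((q : ℂ) ^ (l + j + 1) / q) = a * b * c * d * q ^ (l + j + 1) := by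
    field_simp
  have e4 : a * b * c * d * ((q : ℂ) ^ (l + j + 1) / q) * q = a * b * c * d * q ^ (l + j + 1) := by
    field_simp
  unfold awCoeff
  rw [show l + j + 1 - (l + 1) = j by omega, show l + j + 1 - l = j + 1 by omega,
    qPoch_succ q q l, qPoch_succ q (q ^ _) l, zpow_sub₀ hq, zpow_neg, zpow_natCast, zpow_one, e3,
    qPoch_succ' _ (a * b * c * d * _) l, e4, qPoch_succ q (a * (b * q) * q ^ l) j, e0,
    qPoch_succ' q (a * c * q ^ l) j, qPoch_succ' q (a * d * q ^ l) j,
    show a * (b * q) * (q : ℂ) ^ l = a * b * q ^ (l + 1) by ring,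
    pow_succ (q : ℂ) l, ← mul_assoc (a * b), ← mul_assoc (a * c), ← mul_assoc (a * d)]
  rw [pow_succ] at h1
  generalize qPoch q (a * b * q ^ l * q) j = u1
  generalize qPoch q (a * c * q ^ l * q) j = u2
  generalize qPoch q (a * d * q ^ l * q) j = u3
  generalize qPoch q ((q : ℂ) ^ (l + j + 1))⁻¹ l = u4
  generalize qPoch q (a * b * c * d * q ^ (l + j + 1)) l = u5
  generalize qPoch q q l = u6 at *
  generalize (q : ℂ) ^ (l + j + 1) = Q at *
  generalize (q : ℂ) ^ l = y at *
  generalize (a ^ (l + j + 1))⁻¹ = u7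
  generalize (q : ℂ) = q at *
  have e1 : (u6 * (1 - q * y))⁻¹ * (1 - y * q) = u6⁻¹ := by
    rw [mul_inv, mul_comm q y, mul_assoc, inv_mul_cancel₀ h1, mul_one]
  have e2 : q - a * b * c * d * Q = (1 - a * b * c * d * (Q / q)) * q := by field_simp
  rw [div_eq_mul_inv _ (u6 * (1 - q * y)), div_eq_mul_inv _ u6, e2, ← e1]
  ring

theorem awCoeff_shift_self (G : Generic q (a * b * c * d)) (n : ℕ) :
    awCoeff q a (b * q) c d n n * (q - a * b * c * d * (q : ℂ) ^ n) =
    awCoeff q a b c d n n * (q - a * b * c * d * (q : ℂ) ^ n * q ^ n) := by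
  have hq := G.q_ne
  have e3 : a * (b * q) * c * d * ((q : ℂ) ^ n / q) = a * b * c * d * ((q : ℂ) ^ n / q) * q := by
    ring
  have e2 := qPoch_shift q (a * b * c * d * ((q : ℂ) ^ n / q)) n
  unfold awCoeff
  simp only [Nat.sub_self, qPoch_zero]
  rw [zpow_sub₀ hq, zpow_natCast, zpow_one, e3]
  have e5 : (q : ℂ) - a * b * c * d * (q : ℂ) ^ n = (1 - a * b * c * d * ((q : ℂ) ^ n / q)) * q := by
    field_simp
  have e6 : (q : ℂ) - a * b * c * d * (q : ℂ) ^ n * q ^ n =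
      (1 - a * b * c * d * ((q : ℂ) ^ n / q) * q ^ n) * q := by
    field_simp
  rw [e5, e6]
  generalize qPoch q (a * b * c * d * ((q : ℂ) ^ n / q) * q) n = u at *
  generalize qPoch q (a * b * c * d * ((q : ℂ) ^ n / q)) n = v at *
  generalize a * b * c * d * ((q : ℂ) ^ n / q) = w at *
  linear_combination ((a ^ n)⁻¹ * qPoch q ((q : ℂ) ^ (-n : ℤ)) n / qPoch q q n * q ^ n * q) * e2

/-- Lowering the degree together with the shift of `b` to `bq`. -/
theorem awCoeff_succ_left_shift (G : Generic q (a * b * c * d)) (ha : a ≠ 0) {n l : ℕ}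
    (h : l ≤ n) :
    awCoeff q a b c d (n + 1) l * (a * (1 - (q : ℂ) ^ l / q ^ (n + 1))) =
    awCoeff q a (b * q) c d n l * ((1 - a * b * (q : ℂ) ^ l) * (1 - a * c * (q : ℂ) ^ n) *
      (1 - a * d * (q : ℂ) ^ n) * (1 - 1 / (q : ℂ) ^ (n + 1))) := by
  have hq := G.q_ne
  obtain ⟨j, rfl⟩ := Nat.exists_eq_add_of_le h
  have e1 := qPoch_shift q ((q : ℂ) ^ (l + j + 1))⁻¹ l
  have e3 : ((q : ℂ) ^ (l + j + 1))⁻¹ * q = ((q : ℂ) ^ (l + j))⁻¹ := by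
    rw [pow_succ]; field_simp
  have e4 : a * (b * q) * c * d * ((q : ℂ) ^ (l + j) / q) = a * b * c * d * (q : ℂ) ^ (l + j) := by
    field_simp
  rw [e3] at e1
  have hp := pow_ne_zero (l + j) hq
  unfold awCoeff
  rw [show l + j + 1 - l = j + 1 by omega, show l + j - l = j by omega,
    qPoch_succ' q (a * b * q ^ l) j, qPoch_succ q (a * c * q ^ l) j,
    qPoch_succ q (a * d * q ^ l) j, zpow_sub₀ hq, zpow_sub₀ hq, zpow_neg,
    zpow_neg, zpow_natCast, zpow_one, zpow_natCast, mul_assoc (a * c),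
    mul_assoc (a * d), ← pow_add, pow_succ (q : ℂ) (l + j), mul_div_cancel_right₀ _ hq, e4,
    pow_succ a (l + j), mul_inv (a ^ (l + j)), show a * (b * q) * (q : ℂ) ^ l = a * b * q ^ l * q by ring]
  rw [pow_succ (q : ℂ) (l + j)] at e1
  generalize qPoch q (a * b * q ^ l * q) j = u1
  generalize qPoch q (a * c * q ^ l) j = u2
  generalize qPoch q (a * d * q ^ l) j = u3
  generalize qPoch q ((q : ℂ) ^ (l + j) * q)⁻¹ l = u4 at *
  generalize qPoch q ((q : ℂ) ^ (l + j))⁻¹ l = u5 at *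
  generalize qPoch q (a * b * c * d * q ^ (l + j)) l = u6 at *
  generalize qPoch q q l = u8 at *
  generalize (q : ℂ) ^ (l + j) = Q at *
  generalize (q : ℂ) ^ l = y at *
  generalize (a ^ (l + j))⁻¹ = u9
  generalize (q : ℂ) = q at *
  have e6 : u4 * (1 - y / (Q * q)) = u5 * (1 - 1 / (Q * q)) := by
    have h1 : (Q * q)⁻¹ = 1 / (Q * q) := by ring
    rw [h1] at e1
    linear_combination -e1
  have e7 : a⁻¹ * a = 1 := inv_mul_cancel₀ ha
  generalize 1 - 1 / (Q * q) = w1 at *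
  generalize 1 - y / (Q * q) = w2 at *
  generalize a⁻¹ = a' at *
  linear_combination (u9 * (1 - a * b * y) * u1 * u2 * (1 - a * c * Q) * u3 * (1 - a * d * Q) *
    u6 / u8 * y) * (e6 * (a' * a) + u5 * w1 * e7)

/-- The combination of the first order part of the Askey-Wilson operator with a multiple of the
identity that shifts the parameter `b` to `bq`. -/
theorem awOperator_shift (G : Generic q (a * b * c * d)) (ha : a ≠ 0) (n : ℕ) :
    b • awOperator q a c d 0 1 (zEval (aw q a b c d n)) +
        (((q : ℂ) ^ n)⁻¹ - a * b * c * d / q) • zEval (aw q a b c d n) =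
      (((q : ℂ) ^ n)⁻¹ * (1 - a * b * c * d * q ^ n / q)) • zEval (aw q a (b * q) c d n) := by
  have hq := q.ne_zero
  have hC : ∀ (x : ℂ) (p : ℂ[X]), x • p = C x * p := fun x p => smul_eq_C_mul x
  rw [aw, aw, lowering_sum (by simp) (awOperator_first_order_awBasis q a c d ha) _ _
    (awCoeff_eq_zero hq (Nat.lt_succ_self n)), ← map_smul, ← map_smul, ← map_smul, ← map_add,
    Finset.smul_sum, Finset.smul_sum, Finset.smul_sum, ← Finset.sum_add_distrib]
  congr 1
  refine Finset.sum_congr rfl fun l hl => ?_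
  have hl : l ≤ n := Nat.lt_succ_iff.mp (Finset.mem_range.mp hl)
  simp only [hC, ← mul_assoc, ← C_mul]
  rw [← add_mul, ← C_add]
  congr 2
  have hp := pow_ne_zero l hq
  have hQ := pow_ne_zero n hq
  have e : ∀ u : ℂ, u * (q : ℂ) ^ (l + 1) / q = u * q ^ l := fun u => by
    rw [pow_succ]; field_simp
  rw [e, e]
  rcases hl.lt_or_eq with h | rfl
  · have h1 := awCoeff_shift G h
    have h2 := awCoeff_succ_right G n l
    have h3 : (q : ℂ) ^ n - q ^ l ≠ 0 := sub_ne_zero.mpr fun h' => h.ne' (G.pow_inj h')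
    have h4 := G.t_sub n
    have hc' : awCoeff q a (b * q) c d n l = awCoeff q a b c d n (l + 1) *
        ((1 - a * c * (q : ℂ) ^ l) * (1 - a * d * (q : ℂ) ^ l) * (1 - (q : ℂ) ^ (l + 1)) *
          (1 - a * b * (q : ℂ) ^ n)) * q ^ n /
          ((q ^ n - q ^ l) * (q - a * b * c * d * (q : ℂ) ^ n)) := by
      rw [eq_div_iff (mul_ne_zero h3 h4), ← h1]
      field_simp
    have h5 : (q : ℂ) - a * b * c * d * (q : ℂ) ^ n * q ^ l ≠ 0 := by
      rw [mul_assoc _ ((q : ℂ) ^ n), ← pow_add]; exact G.t_sub _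
    have hc : awCoeff q a b c d n l = awCoeff q a b c d n (l + 1) *
        ((1 - a * b * (q : ℂ) ^ l) * (1 - a * c * (q : ℂ) ^ l) * (1 - a * d * (q : ℂ) ^ l) *
          (1 - (q : ℂ) ^ (l + 1))) * q ^ n /
          ((q ^ n - q ^ l) * (q - a * b * c * d * (q : ℂ) ^ n * q ^ l)) := by
      rw [eq_div_iff (mul_ne_zero h3 h5), h2]
      field_simp
    rw [hc, hc']
    generalize awCoeff q a b c d n (l + 1) = e0
    rw [pow_succ]
    generalize (q : ℂ) ^ l = y at *
    generalize (q : ℂ) ^ n = Q at *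
    generalize (q : ℂ) = q at *
    generalize hD1 : Q - y = D1 at *
    generalize hD2 : q - a * b * c * d * Q = D2 at *
    generalize hD3 : q - a * b * c * d * Q * y = D3 at *
    field_simp
    subst hD1 hD2 hD3
    ring
  · have h1 := awCoeff_shift_self G l
    rw [awCoeff_eq_zero hq (Nat.lt_succ_self l)]
    have : ((q : ℂ) ^ l)⁻¹ * (1 - a * b * c * d * q ^ l / q) * awCoeff q a (b * q) c d l l =
        ((q : ℂ) ^ l)⁻¹ / q * (awCoeff q a (b * q) c d l l * (q - a * b * c * d * q ^ l)) := by
      field_simp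
    rw [this, h1]
    field_simp
    ring

/-- The connection between the Askey-Wilson polynomials with parameters `b` and `bq`. -/
theorem aw_connection (G : Generic q (a * b * c * d)) (ha : a ≠ 0) (n : ℕ) :
    (q - a * b * c * d * (q : ℂ) ^ (n + 1) * q ^ (n + 1)) • aw q a b c d (n + 1) =
      (q - a * b * c * d * (q : ℂ) ^ (n + 1)) • aw q a (b * q) c d (n + 1) -
        (q * b * (1 - (q : ℂ) ^ (n + 1)) * (1 - c * d * q ^ n) * (1 - a * c * q ^ n) *
          (1 - a * d * q ^ n)) • aw q a (b * q) c d n := by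
  have hq := q.ne_zero
  rw [aw_eq_sum hq (show n + 1 < n + 2 by omega), aw_eq_sum hq (show n + 1 < n + 2 by omega),
    aw_eq_sum hq (show n < n + 2 by omega), Finset.smul_sum, Finset.smul_sum, Finset.smul_sum,
    ← Finset.sum_sub_distrib]
  refine Finset.sum_congr rfl fun l hl => ?_
  simp only [smul_eq_C_mul, ← mul_assoc, ← C_mul]
  rw [← sub_mul, ← C_sub]
  congr 2
  rcases (Nat.lt_succ_iff.mp (Finset.mem_range.mp hl)).lt_or_eq with h | rfl
  · have h1 := awCoeff_succ_left_shift G ha (Nat.lt_succ_iff.mp h)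
    have G' : Generic q (a * (b * q) * c * d) := by
      rw [show a * (b * q) * c * d = a * b * c * d * q by ring]; exact G.mul_q
    have h2 := awCoeff_succ_left G' ha n l
    have h3 : 1 - (q : ℂ) ^ l / q ^ (n + 1) ≠ 0 := by
      rw [Ne, sub_eq_zero, eq_comm, div_eq_one_iff_eq (pow_ne_zero _ hq)]
      exact fun h' => h.ne (G.pow_inj h')
    apply mul_right_cancel₀ (mul_ne_zero ha h3)
    have hp := pow_ne_zero l hq
    have hQ := pow_ne_zero n hq
    rw [pow_succ] at *
    generalize (q : ℂ) ^ l = y at *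
    generalize (q : ℂ) ^ n = Q at *
    generalize (q : ℂ) = q at *
    have e1 : a * (1 - y / (Q * q)) * (q - a * (b * q) * c * d * Q) =
      a * (1 - y / (Q * q)) * (q - a * b * c * d * (Q * q)) := by ring
    rw [e1] at h2
    generalize hD : awCoeff q a (b * q) c d n l = g at *
    have e2 : (q - a * b * c * d * (Q * q) * (Q * q)) * ((1 - a * b * y) * (1 - 1 / (Q * q))) =
        (1 - a * b * (Q * q)) * (1 - 1 / (Q * q)) * (q - a * b * c * d * (Q * q) * y) -
          q * b * (1 - Q * q) * (1 - c * d * Q) * (a * (1 - y / (Q * q))) := by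
      field_simp
      ring
    linear_combination (q - a * b * c * d * (Q * q) * (Q * q)) * h1 - h2 +
      g * (1 - a * c * Q) * (1 - a * d * Q) * e2
  · have h1 := awCoeff_shift_self G (n + 1)
    rw [awCoeff_eq_zero hq (Nat.lt_succ_self n)]
    linear_combination -h1

end

/-! ### Summation operators as q-difference operators -/

section
variable {q : ℂˣ} {a b c d : ℂ}

/-- The antisymmetric weight `c_n = q^{-n} - t q^{n-1}` as a function of `x = q^n`. -/
def weight (q t x : ℂ) : ℂ := x⁻¹ - t * x / q

/-- The operator attached to the parameter `b`: up to the factor `1/ξ^b_n` it acts on the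
Askey-Wilson polynomials by the trapezoidal sum with the weights `c_m ξ^b_m`. -/
theorem exists_trapezoid_aux (G : Generic q (a * b * c * d)) (ha : a ≠ 0) {x : ℕ → ℂ}
    (hx : ∀ n, x n ≠ 0)
    (hrec : ∀ n, x (n + 1) * (b * (1 - (q : ℂ) ^ (n + 1)) * (1 - c * d * q ^ n) *
      (1 - a * c * q ^ n) * (1 - a * d * q ^ n)) = x n * (q - a * b * c * d * q ^ n)) :
    ∃ T ∈ qDiff q, ∀ n, T (zEval (aw q a b c d n)) =
      (weight q (a * b * c * d) (q ^ n) / 2) • zEval (aw q a b c d n) +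
        (x n)⁻¹ • ∑ m ∈ Finset.range n,
          (weight q (a * b * c * d) (q ^ m) * x m) • zEval (aw q a b c d m) := by
  have hq := q.ne_zero
  have hC : ∀ (x : ℂ) (p : ℂ[X]), x • p = C x * p := fun x p => smul_eq_C_mul x
  set t := a * b * c * d with ht
  set Y : ℕ → RatFunc ℂ := fun n => b • awOperator q a c d 0 1 (zEval (aw q a b c d n)) +
    (((q : ℂ) ^ n)⁻¹ - t / q) • zEval (aw q a b c d n) with hY
  have hYn : ∀ n, Y n = (((q : ℂ) ^ n)⁻¹ * (1 - t * q ^ n / q)) • zEval (aw q a (b * q) c d n) :=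
    awOperator_shift G ha
  have hstep : ∀ n, x (n + 1) • (Y (n + 1) - weight q t (q ^ (n + 1)) • zEval (aw q a b c d (n + 1))) =
      x n • Y n := by
    intro n
    have hcon := congrArg zEval (aw_connection G ha n)
    rw [map_sub, map_smul, map_smul, map_smul] at hcon
    have ew : weight q t (q ^ (n + 1)) =
        ((q : ℂ) ^ (n + 1))⁻¹ / q * (q - t * (q : ℂ) ^ (n + 1) * q ^ (n + 1)) := by
      rw [weight]; field_simp
    have e2 : ((q : ℂ) ^ (n + 1))⁻¹ * (1 - t * q ^ (n + 1) / q) =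
        ((q : ℂ) ^ (n + 1))⁻¹ / q * (q - t * (q : ℂ) ^ (n + 1)) := by
      field_simp
    have e3 : ((q : ℂ) ^ n)⁻¹ * (1 - t * q ^ n / q) =
        ((q : ℂ) ^ (n + 1))⁻¹ * (q - t * (q : ℂ) ^ n) := by
      field_simp
      ring
    rw [← ht] at hcon
    have hw := congrArg ((((q : ℂ) ^ (n + 1))⁻¹ / q) • ·) hcon
    rw [smul_smul, ← ew] at hw
    rw [hw, hYn, hYn, e2, e3]
    simp only [smul_sub, smul_smul]
    rw [sub_sub_cancel]
    congr 1
    have h := hrec n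
    field_simp at h ⊢
    linear_combination h
  have hsum : ∀ n, x n • (Y n - weight q t (q ^ n) • zEval (aw q a b c d n)) =
      ∑ m ∈ Finset.range n, (weight q t (q ^ m) * x m) • zEval (aw q a b c d m) := by
    intro n
    induction n with
    | zero =>
      have h0 : ∀ b, aw q a b c d 0 = 1 := fun b => by simp [aw, awCoeff, awBasis, qPoch]
      rw [hYn, h0, h0, weight]
      simp
    | succ n ih =>
      rw [hstep, Finset.sum_range_succ, ← ih, mul_comm, mul_smul, ← smul_add, sub_add_cancel]
  refine ⟨b • awOperator q a c d 0 1 + (2⁻¹ : ℂ) • awOperator q a c d 1 (-b) +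
    algebraMap ℂ _ ((1 + t / q) / 2 - t / q), ?_, fun n => ?_⟩
  · exact add_mem (add_mem ((qDiff q).smul_mem (awOperator_mem _ _ _ _ _ _) _)
      ((qDiff q).smul_mem (awOperator_mem _ _ _ _ _ _) _)) ((qDiff q).algebraMap_mem _)
  rw [← hsum, inv_smul_smul₀ (hx n), LinearMap.add_apply, LinearMap.add_apply, LinearMap.smul_apply,
    LinearMap.smul_apply, awOperator_aw G ha, Module.algebraMap_end_apply, hY, weight]
  module

end

namespace Data
variable {k : ℕ} (D : Data k)

/-- The base `q` as a unit. -/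
def qU : ℂˣ := Units.mk0 (D.q : ℂ) (Complex.ofReal_ne_zero.mpr D.q_pos.ne')

theorem qU_val : (D.qU : ℂ) = D.q := rfl

/-- The eigenvalue `λ_γ` as a function of `x = q^γ`. -/
def lamX (x : ℂ) : ℂ := (x⁻¹ - 1) * (1 - D.abcd * x / D.q)

/-- For each of the four parameters, the `q`-difference operator that acts on the Askey-Wilson
polynomials by a trapezoidal sum. -/
theorem exists_trapezoid (G : Generic D.q D.abcd) (i : Fin 4) {x : ℕ → ℂ} (hx : ∀ n, x n ≠ 0)
    (hrec : ∀ n, x (n + 1) * (D.par i * (1 - (D.q : ℂ) ^ (n + 1)) *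
      (1 - D.par (i + 1) * D.par (i + 2) * D.q ^ n) *
      (1 - D.par (i + 1) * D.par (i + 3) * D.q ^ n) *
      (1 - D.par (i + 2) * D.par (i + 3) * D.q ^ n)) = x n * (D.q - D.abcd * D.q ^ n)) :
    ∃ T ∈ qDiff D.qU, ∀ n, T (zEval (D.awPoly n)) =
      (weight D.q D.abcd (D.q ^ n) / 2) • zEval (D.awPoly n) +
        (x n)⁻¹ • ∑ m ∈ Finset.range n,
          (weight D.q D.abcd (D.q ^ m) * x m) • zEval (D.awPoly m) := by
  simp only [awPoly_eq]
  have hp : ∀ n, aw D.q D.a D.c D.b D.d n = aw D.q D.a D.b D.c D.d n ∧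
    aw D.q D.a D.d D.c D.b n = aw D.q D.a D.b D.c D.d n := aw_perm_bcd _ _ _ _ _
  have hs : ∀ n, aw D.q D.b D.a D.c D.d n = aw D.q D.a D.b D.c D.d n :=
    aw_swap G D.a_ne_zero D.b_ne_zero D.c_ne_zero D.d_ne_zero
  have t1 : D.abcd = D.b * D.a * D.c * D.d := by unfold abcd; ring
  have t2 : D.abcd = D.a * D.c * D.b * D.d := by unfold abcd; ring
  have t3 : D.abcd = D.a * D.d * D.c * D.b := by unfold abcd; ring
  have hr := fun n => hrec n
  fin_cases i
  · obtain ⟨T, hT, h⟩ := exists_trapezoid_aux (q := D.qU) (a := D.b) (b := D.a) (c := D.c) (d := D.d)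
      (t1 ▸ G) D.b_ne_zero hx (fun n => by
        rw [← t1, qU_val, ← hr n]
        change _ = x (n + 1) * (D.a * _ * (1 - D.b * D.c * _) * (1 - D.b * D.d * _) *
          (1 - D.c * D.d * _))
        ring)
    refine ⟨T, hT, fun n => ?_⟩
    have := h n
    simpa only [qU_val, hs, ← t1] using this
  · obtain ⟨T, hT, h⟩ := exists_trapezoid_aux (q := D.qU) (a := D.a) (b := D.b) (c := D.c) (d := D.d)
      G D.a_ne_zero hx (fun n => by
        rw [qU_val]
        refine Eq.trans ?_ (hr n)
        change _ = x (n + 1) * (D.b * _ * (1 - D.c * D.d * _) * (1 - D.c * D.a * _) *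
          (1 - D.d * D.a * _))
        ring)
    exact ⟨T, hT, h⟩
  · obtain ⟨T, hT, h⟩ := exists_trapezoid_aux (q := D.qU) (a := D.a) (b := D.c) (c := D.b) (d := D.d)
      (t2 ▸ G) D.a_ne_zero hx (fun n => by
        rw [← t2, qU_val, ← hr n]
        change _ = x (n + 1) * (D.c * _ * (1 - D.d * D.a * _) * (1 - D.d * D.b * _) *
          (1 - D.a * D.b * _))
        ring)
    refine ⟨T, hT, fun n => ?_⟩
    have := h n
    simpa only [qU_val, hp, ← t2] using this
  · obtain ⟨T, hT, h⟩ := exists_trapezoid_aux (q := D.qU) (a := D.a) (b := D.d) (c := D.c) (d := D.b)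
      (t3 ▸ G) D.a_ne_zero hx (fun n => by
        rw [← t3, qU_val, ← hr n]
        change _ = x (n + 1) * (D.d * _ * (1 - D.a * D.b * _) * (1 - D.a * D.c * _) *
          (1 - D.b * D.c * _))
        ring)
    refine ⟨T, hT, fun n => ?_⟩
    have := h n
    simpa only [qU_val, hp, ← t3] using this

/-- The algebra generated by the Askey-Wilson operator and the trapezoidal operators, in the form
in which it acts on the Askey-Wilson polynomials. -/
theorem exists_qDiff_action (G : Generic D.q D.abcd) (x : Fin 4 → ℕ → ℂ)
    (hx : ∀ j n, x (D.δ j) n ≠ 0)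
    (hrec : ∀ j n, x (D.δ j) (n + 1) * (D.par (D.δ j) * (1 - (D.q : ℂ) ^ (n + 1)) *
      (1 - D.par (D.δ j + 1) * D.par (D.δ j + 2) * D.q ^ n) *
      (1 - D.par (D.δ j + 1) * D.par (D.δ j + 3) * D.q ^ n) *
      (1 - D.par (D.δ j + 2) * D.par (D.δ j + 3) * D.q ^ n)) =
        x (D.δ j) n * (D.q - D.abcd * D.q ^ n))
    (P : ℂ[X]) (r : Fin k → ℂ[X]) :
    ∃ T ∈ qDiff D.qU, ∀ n, T (zEval (D.awPoly n)) =
      P.eval (D.lamX (D.q ^ n)) • zEval (D.awPoly n) - ∑ j,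
        (D.φ j).eval (D.lamX (D.q ^ n)) •
        ((weight D.q D.abcd (D.q ^ n) / 2 * (r j).eval (D.lamX (D.q ^ n))) • zEval (D.awPoly n) +
          (x (D.δ j) n)⁻¹ • ∑ m ∈ Finset.range n,
            (weight D.q D.abcd (D.q ^ m) * x (D.δ j) m * (r j).eval (D.lamX (D.q ^ m))) •
              zEval (D.awPoly m)) := by
  have hq : (D.q : ℂ) ≠ 0 := D.qU.ne_zero
  choose S hS hSe using fun j => D.exists_trapezoid G (D.δ j) (hx j) (hrec j)
  set B := awOperator D.qU D.a D.c D.d 1 (-D.b) with hB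
  have hBm : B ∈ qDiff D.qU := awOperator_mem _ _ _ _ _ _
  have hBe : ∀ n, B (zEval (D.awPoly n)) = D.lamX (D.q ^ n) • zEval (D.awPoly n) := by
    intro n
    rw [awPoly_eq, hB, ← qU_val, awOperator_aw (q := D.qU) G D.a_ne_zero, qU_val]
    congr 1
    unfold lamX abcd
    field_simp
    ring
  have hBp : ∀ (f : ℂ[X]) n, aeval B f (zEval (D.awPoly n)) =
      f.eval (D.lamX (D.q ^ n)) • zEval (D.awPoly n) := by
    intro f n
    induction f using Polynomial.induction_on' with
    | add f g hf hg => rw [map_add, LinearMap.add_apply, hf, hg, eval_add, add_smul]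
    | monomial m s =>
      rw [aeval_monomial, eval_monomial, Module.End.mul_apply, Module.algebraMap_end_apply, mul_smul]
      congr 1
      induction m with
      | zero => simp
      | succ m ih => rw [pow_succ, Module.End.mul_apply, hBe, map_smul, ih, pow_succ', mul_smul]
  have hBmem : ∀ f : ℂ[X], aeval B f ∈ qDiff D.qU := fun f =>
    Algebra.adjoin_le (Set.singleton_subset_iff.mpr hBm) (aeval_mem_adjoin_singleton ℂ B)
  refine ⟨aeval B P - ∑ j, aeval B (r j) * S j * aeval B (D.φ j),
    sub_mem (hBmem P) (sum_mem fun j _ => mul_mem (mul_mem (hBmem _) (hS j)) (hBmem _)), fun n => ?_⟩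
  rw [LinearMap.sub_apply, hBp, LinearMap.sum_apply]
  congr 1
  refine Finset.sum_congr rfl fun j _ => ?_
  rw [Module.End.mul_apply, Module.End.mul_apply, hBp, map_smul, map_smul, hSe, map_add, map_smul,
    map_smul, map_sum, hBp]
  congr 2
  · rw [smul_smul]
  · congr 1
    refine Finset.sum_congr rfl fun m _ => ?_
    rw [map_smul, hBp, smul_smul]

end Data

/-! ### The infinite product -/

theorem summable_mul_pow {q : ℂ} (hq : ‖q‖ < 1) (x : ℂ) : Summable fun l : ℕ => ‖-(x * q ^ l)‖ := by
  simpa using (summable_geometric_of_lt_one (norm_nonneg q) hq).mul_left ‖x‖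

theorem multipliable_qPochInf {q : ℂ} (hq : ‖q‖ < 1) (x : ℂ) :
    Multipliable fun l : ℕ => 1 - x * q ^ l := by
  simpa only [sub_eq_add_neg] using multipliable_one_add_of_summable (summable_mul_pow hq x)

theorem qPochInf_eq_mul {q : ℂ} (hq : ‖q‖ < 1) (x : ℂ) :
    qPochInf q x = (1 - x) * qPochInf q (x * q) := by
  have e : (fun l : ℕ => 1 - x * q ^ (l + 1)) = fun l : ℕ => 1 - x * q * q ^ l := by
    funext l
    rw [pow_succ', mul_assoc]
  have h := tprod_eq_zero_mul' (f := fun l : ℕ => 1 - x * q ^ l)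
    (by rw [e]; exact multipliable_qPochInf hq _)
  rw [e, pow_zero, mul_one] at h
  exact h

theorem qPochInf_eq_qPoch_mul {q : ℂ} (hq : ‖q‖ < 1) (x : ℂ) (m : ℕ) :
    qPochInf q x = qPoch q x m * qPochInf q (x * q ^ m) := by
  induction m with
  | zero => simp [qPoch]
  | succ m ih =>
    rw [ih, qPochInf_eq_mul hq, qPoch, qPoch, Finset.prod_range_succ, pow_succ]
    ring_nf

theorem qPochInf_ne_zero_iff {q : ℂ} (hq : ‖q‖ < 1) {x : ℂ} :
    qPochInf q x ≠ 0 ↔ ∀ l : ℕ, x * q ^ l ≠ 1 := by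
  constructor
  · intro h l hl
    rw [qPochInf_eq_qPoch_mul hq x l, qPochInf_eq_mul hq, hl] at h
    simp at h
  · intro h
    have := tprod_one_add_ne_zero_of_summable (f := fun l : ℕ => -(x * q ^ l))
      (fun l => by rw [← sub_eq_add_neg]; exact sub_ne_zero.mpr (h l).symm) (summable_mul_pow hq x)
    simp only [← sub_eq_add_neg] at this
    exact this

theorem differentiable_qPochInf {q : ℂ} (hq : ‖q‖ < 1) : Differentiable ℂ (qPochInf q) := by
  have h : HasProdLocallyUniformlyOn (fun (l : ℕ) (x : ℂ) => 1 - x * q ^ l) (qPochInf q)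
      Set.univ := by
    unfold qPochInf
    simp_rw [sub_eq_add_neg]
    apply hasProdLocallyUniformlyOn_of_forall_compact isOpen_univ
    intro K _ hcK
    obtain ⟨M, hM⟩ := hcK.isBounded.exists_norm_le
    refine ((summable_geometric_of_lt_one (norm_nonneg q) hq).mul_left M).hasProdUniformlyOn_nat_one_add
      hcK (.of_forall fun n x hx => ?_) (fun _ => by fun_prop)
    rw [norm_neg, norm_mul, norm_pow]
    exact mul_le_mul_of_nonneg_right (hM x hx) (by positivity)
  have := h.differentiableOn (.of_forall fun _ => by
    simpa [Finset.prod_fn] using DifferentiableOn.finsetProd (fun _ _ => by fun_prop)) isOpen_univ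
  exact differentiableOn_univ.mp this

namespace Data
variable {k : ℕ} (D : Data k)

theorem q_ne : (D.q : ℂ) ≠ 0 := D.qU.ne_zero

theorem norm_q_lt : ‖(D.q : ℂ)‖ < 1 := by
  rw [Complex.norm_real, Real.norm_of_nonneg D.q_pos.le]
  exact D.q_lt_one

theorem qpow_ne (γ : ℂ) : D.qpow γ ≠ 0 := by
  simp [qpow, Complex.cpow_eq_zero_iff, D.q_ne]

theorem qpow_add (γ δ : ℂ) : D.qpow (γ + δ) = D.qpow γ * D.qpow δ := Complex.cpow_add _ _ D.q_ne

theorem qpow_natCast (n : ℕ) : D.qpow n = (D.q : ℂ) ^ n := Complex.cpow_natCast _ _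

theorem qpow_neg (γ : ℂ) : D.qpow (-γ) = (D.qpow γ)⁻¹ := Complex.cpow_neg _ _

theorem qpow_sub (γ δ : ℂ) : D.qpow (γ - δ) = D.qpow γ / D.qpow δ := Complex.cpow_sub _ _ D.q_ne

theorem qpow_one : D.qpow 1 = D.q := Complex.cpow_one _

theorem qpow_sub_nat (γ : ℂ) (n : ℕ) : D.qpow (γ - n) = D.qpow γ / D.q ^ n := by
  rw [qpow_sub, qpow_natCast]

theorem differentiable_qpow : Differentiable ℂ D.qpow := by
  unfold qpow
  exact differentiable_id.const_cpow (Or.inl D.q_ne)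

theorem continuous_qpow : Continuous D.qpow := D.differentiable_qpow.continuous

theorem pow_inj {m n : ℕ} (h : (D.q : ℂ) ^ m = D.q ^ n) : m = n := by
  have h' : D.q ^ m = D.q ^ n := by exact_mod_cast h
  exact pow_right_injective₀ D.q_pos D.q_lt_one.ne h'

theorem lam_eq (γ : ℂ) : D.lam γ = D.lamX (D.qpow γ) := by
  rw [lam, lamX, qpow_neg, qpow_sub, qpow_one, mul_div_assoc]

theorem par_ne (i : Fin 4) : D.par i ≠ 0 := by
  fin_cases i
  exacts [D.a_ne_zero, D.b_ne_zero, D.c_ne_zero, D.d_ne_zero]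

theorem par_prod (i : Fin 4) : D.par i * D.par (i + 1) * D.par (i + 2) * D.par (i + 3) = D.abcd := by
  fin_cases i
  · rfl
  · change D.b * D.c * D.d * D.a = _; unfold abcd; ring
  · change D.c * D.d * D.a * D.b = _; unfold abcd; ring
  · change D.d * D.a * D.b * D.c = _; unfold abcd; ring

theorem abcd_ne : D.abcd ≠ 0 := by
  have := D.par_prod 0
  rw [← this]
  simp [D.par_ne]

/-- The constant part of `ξ_γ`: the factors that do not depend on `γ`. -/
def xiConst (i : Fin 4) : ℂ :=
  qPochInf D.q (D.abcd / D.q) / (qPochInf D.q (D.par (i + 1) * D.par (i + 2)) *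
      qPochInf D.q (D.par (i + 1) * D.par (i + 3)) *
        qPochInf D.q (D.par (i + 2) * D.par (i + 3)) * qPochInf D.q D.q)

/-- The part of `ξ_γ` that is a meromorphic function of `y = q^γ`. -/
def xiY (i : Fin 4) (y : ℂ) : ℂ :=
  y * (qPochInf D.q (D.par (i + 1) * D.par (i + 2) * y) *
      qPochInf D.q (D.par (i + 1) * D.par (i + 3) * y) *
      qPochInf D.q (D.par (i + 2) * D.par (i + 3) * y) * qPochInf D.q (y * D.q)) /
    qPochInf D.q (D.abcd * y / D.q)

theorem xi_eq (i : Fin 4) (γ : ℂ) :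
    D.xi i γ = D.xiConst i * ((D.par i) ^ γ)⁻¹ * D.xiY i (D.qpow γ) := by
  rw [xi, xiOf, par_prod, xiConst, xiY, qpow_add, qpow_one, qpow_sub, qpow_one, mul_div_assoc]
  simp only [div_eq_mul_inv, mul_inv]
  ring_nf

theorem xiY_step (i : Fin 4) {y : ℂ} (hy : 1 - D.abcd * y / D.q ≠ 0) :
    D.xiY i (y * D.q) * ((1 - D.par (i + 1) * D.par (i + 2) * y) *
      (1 - D.par (i + 1) * D.par (i + 3) * y) * (1 - D.par (i + 2) * D.par (i + 3) * y) *
        (1 - y * D.q)) = D.q * (1 - D.abcd * y / D.q) * D.xiY i y := by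
  have hq := D.norm_q_lt
  have h0 := D.q_ne
  have e (x : ℂ) : qPochInf D.q (x * y) = (1 - x * y) * qPochInf D.q (x * (y * D.q)) := by
    rw [qPochInf_eq_mul hq, mul_assoc]
  have e' : qPochInf D.q (y * D.q) = (1 - y * D.q) * qPochInf D.q (y * D.q * D.q) :=
    qPochInf_eq_mul hq _
  have et : qPochInf D.q (D.abcd * y / D.q) =
      (1 - D.abcd * y / D.q) * qPochInf D.q (D.abcd * (y * D.q) / D.q) := by
    rw [qPochInf_eq_mul hq, div_mul_eq_mul_div, mul_assoc D.abcd]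
  rw [xiY, xiY, e, e, e, e', et]
  by_cases hT : qPochInf D.q (D.abcd * (y * D.q) / D.q) = 0
  · rw [hT]; simp
  generalize qPochInf D.q (D.abcd * (y * D.q) / D.q) = T at *
  generalize 1 - D.abcd * y / D.q = S at *
  field_simp

theorem xi_step (i : Fin 4) {γ : ℂ} (hy : 1 - D.abcd * D.qpow γ / D.q ≠ 0) :
    D.xi i (γ + 1) * (D.par i * ((1 - D.par (i + 1) * D.par (i + 2) * D.qpow γ) *
      (1 - D.par (i + 1) * D.par (i + 3) * D.qpow γ) *
      (1 - D.par (i + 2) * D.par (i + 3) * D.qpow γ) * (1 - D.qpow γ * D.q))) =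
        D.q * (1 - D.abcd * D.qpow γ / D.q) * D.xi i γ := by
  have h := D.xiY_step i hy
  have hp := D.par_ne i
  rw [xi_eq, xi_eq, qpow_add, qpow_one, Complex.cpow_add _ _ hp, Complex.cpow_one, mul_inv]
  generalize D.xiY i (D.qpow γ * D.q) = Y at *
  generalize ((D.par i) ^ γ)⁻¹ = U at *
  generalize (1 - D.par (i + 1) * D.par (i + 2) * D.qpow γ) *
      (1 - D.par (i + 1) * D.par (i + 3) * D.qpow γ) *
      (1 - D.par (i + 2) * D.par (i + 3) * D.qpow γ) * (1 - D.qpow γ * D.q) = F at *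
  field_simp at h ⊢
  linear_combination D.xiConst i * U * h

/-- The points `γ` for which no `A q^(γ+l)`, `l ≥ 0`, is equal to `1`, where `A` is a product of
two parameters, `1`, or `abcd`: at `γ + 1, γ + 2, …` all the functions `ξ` are finite and nonzero. -/
structure Good (γ : ℂ) : Prop where
  pair : ∀ i j, qPochInf D.q (D.par i * D.par j * D.qpow γ) ≠ 0 ∨ i = j
  one : qPochInf D.q (D.qpow γ) ≠ 0
  abcd : qPochInf D.q (D.abcd * D.qpow γ) ≠ 0

variable {D}

theorem qPochInf_qpow_add {A γ : ℂ} (h : qPochInf D.q (A * D.qpow γ) ≠ 0) (m : ℕ) :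
    qPochInf D.q (A * D.qpow (γ + m)) ≠ 0 := by
  rw [qPochInf_eq_qPoch_mul D.norm_q_lt _ m, mul_assoc, ← qpow_natCast, ← qpow_add] at h
  exact right_ne_zero_of_mul h

theorem one_sub_ne {x : ℂ} (h : qPochInf D.q x ≠ 0) : 1 - x ≠ 0 := by
  rw [qPochInf_eq_mul D.norm_q_lt] at h
  exact left_ne_zero_of_mul h

theorem Good.add {γ : ℂ} (h : D.Good γ) (m : ℕ) : D.Good (γ + m) where
  pair i j := (h.pair i j).imp_left fun h => qPochInf_qpow_add h m
  one := by
    have := qPochInf_qpow_add (A := 1) (by simpa using h.one) m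
    simpa using this
  abcd := qPochInf_qpow_add h.abcd m

theorem Good.of_add {γ δ : ℂ} (h : D.Good γ) (m : ℕ) (e : γ + m = δ) : D.Good δ := e ▸ h.add m

theorem Good.one_sub_pair {γ : ℂ} (h : D.Good γ) {i j : Fin 4} (hij : i ≠ j) :
    1 - D.par i * D.par j * D.qpow γ ≠ 0 :=
  one_sub_ne ((h.pair i j).resolve_right hij)

theorem Good.one_sub {γ : ℂ} (h : D.Good γ) : 1 - D.qpow γ ≠ 0 := one_sub_ne h.one

theorem Good.one_sub_abcd {γ : ℂ} (h : D.Good γ) : 1 - D.abcd * D.qpow γ ≠ 0 := one_sub_ne h.abcd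

theorem Good.xi_ne {γ : ℂ} (h : D.Good (γ - 1)) {i : Fin 4} (hi : D.xiConst i ≠ 0) :
    D.xi i γ ≠ 0 := by
  have h1 : D.Good γ := h.of_add 1 (by push_cast; ring)
  have h2 : D.Good (γ + 1) := h1.of_add 1 (by push_cast; rfl)
  have hd (m n : Fin 4) (hmn : m ≠ n) (i : Fin 4) : i + m ≠ i + n := fun e => hmn (add_left_cancel e)
  have ht := h.abcd
  rw [qpow_sub, qpow_one, ← mul_div_assoc] at ht
  have h3 := h2.one
  rw [qpow_add, qpow_one] at h3
  rw [xi_eq, xiY]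
  refine mul_ne_zero (mul_ne_zero hi (inv_ne_zero ?_)) (div_ne_zero (mul_ne_zero (D.qpow_ne _)
    (mul_ne_zero (mul_ne_zero (mul_ne_zero ?_ ?_) ?_) h3)) ht)
  · simp [Complex.cpow_eq_zero_iff, D.par_ne]
  · exact (h1.pair _ _).resolve_right (hd _ _ (by decide) i)
  · exact (h1.pair _ _).resolve_right (hd _ _ (by decide) i)
  · exact (h1.pair _ _).resolve_right (hd _ _ (by decide) i)

variable (D)

theorem differentiable_qPochInf_qpow (A : ℂ) :
    Differentiable ℂ fun γ => qPochInf D.q (A * D.qpow γ) :=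
  (differentiable_qPochInf D.norm_q_lt).comp (D.differentiable_qpow.const_mul A)

theorem tendsto_pow_mul (A : ℂ) : Tendsto (fun n : ℕ => A * (D.q : ℂ) ^ n) atTop (𝓝 0) := by
  simpa using (tendsto_pow_atTop_nhds_zero_of_norm_lt_one D.norm_q_lt).const_mul A

theorem eventually_qPochInf_ne (A : ℂ) : ∀ᶠ n : ℕ in atTop, qPochInf D.q (A * (D.q : ℂ) ^ n) ≠ 0 := by
  have h := ((differentiable_qPochInf D.norm_q_lt).continuous.tendsto 0).comp (D.tendsto_pow_mul A)
  refine h.eventually_ne ?_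
  rw [qPochInf_ne_zero_iff D.norm_q_lt]
  simp

theorem eventually_qPochInf_ne_nhds (A c : ℂ) :
    ∀ᶠ γ in 𝓝[≠] c, qPochInf D.q (A * D.qpow γ) ≠ 0 := by
  have han : AnalyticOnNhd ℂ (fun γ => qPochInf D.q (A * D.qpow γ)) Set.univ := fun γ _ =>
    (D.differentiable_qPochInf_qpow A).analyticAt γ
  by_contra h
  obtain ⟨n, hn⟩ := (D.eventually_qPochInf_ne A).exists
  rw [← qpow_natCast] at hn
  refine hn (han.eqOn_zero_of_preconnected_of_frequently_eq_zero isPreconnected_univ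
    (Set.mem_univ c) h (Set.mem_univ (n : ℂ)))

theorem eventually_good_nhds (c : ℂ) : ∀ᶠ γ in 𝓝[≠] c, D.Good γ := by
  have h1 : ∀ᶠ γ in 𝓝[≠] c, ∀ i j, qPochInf D.q (D.par i * D.par j * D.qpow γ) ≠ 0 :=
    eventually_all.mpr fun i => eventually_all.mpr fun j => D.eventually_qPochInf_ne_nhds _ c
  filter_upwards [h1, D.eventually_qPochInf_ne_nhds 1 c, D.eventually_qPochInf_ne_nhds D.abcd c] with
    γ h1 h2 h3
  exact ⟨fun i j => Or.inl (h1 i j), by simpa using h2, h3⟩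

theorem eventually_good_sub (K : ℂ) : ∀ᶠ n : ℕ in atTop, D.Good (n - K) := by
  have e (A : ℂ) (n : ℕ) : A * D.qpow (n - K) = A / D.qpow K * (D.q : ℂ) ^ n := by
    rw [qpow_sub, qpow_natCast]; ring
  have h1 : ∀ᶠ n : ℕ in atTop, ∀ i j, qPochInf D.q (D.par i * D.par j * D.qpow (n - K)) ≠ 0 :=
    eventually_all.mpr fun i => eventually_all.mpr fun j => by
      simpa only [e] using D.eventually_qPochInf_ne _
  have h2 (A : ℂ) : ∀ᶠ n : ℕ in atTop, qPochInf D.q (A * D.qpow (n - K)) ≠ 0 := by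
    simpa only [e] using D.eventually_qPochInf_ne _
  filter_upwards [h1, h2 1, h2 D.abcd] with n h1 h2 h3
  exact ⟨fun i j => Or.inl (h1 i j), by simpa using h2, h3⟩

/-- The parameters that occur in the construction: `a` and the `δ_j`. -/
def Occurs (i : Fin 4) : Prop := i = 0 ∨ ∃ j, D.δ j = i

/-- If the constants in the denominator of `ξ^i`, or the factor `(abcd/q;q)_∞`, vanish, then the
formulas for `χ` and `τ` are identically zero; hence the assumption on `τ` excludes this. -/
theorem xiConst_ne {n : ℂ} (htau : NonzeroAt D.tau n) {i : Fin 4} (hi : D.Occurs i) :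
    D.xiConst i ≠ 0 := by
  intro h0
  have hxi : ∀ γ, D.xi i γ = 0 := fun γ => by rw [xi_eq, h0]; simp
  have hchi : ∀ γ, D.chi γ = 0 := by
    intro γ
    rw [chi]
    rcases hi with rfl | ⟨j, rfl⟩
    · rw [hxi]; simp
    · rw [Finset.prod_eq_zero (Finset.mem_univ j) (hxi _)]; simp
  obtain ⟨v, hv, ht⟩ := htau
  have : D.tau = fun _ => 0 := by
    funext γ
    rw [tau, hchi]; simp
  rw [this] at ht
  exact hv (tendsto_nhds_unique ht tendsto_const_nhds)

variable {D}

theorem xiConst_abcd {i : Fin 4} (hi : D.xiConst i ≠ 0) (n : ℕ) : D.abcd * (D.q : ℂ) ^ n ≠ D.q := by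
  have h := (div_ne_zero_iff.mp hi).1
  rw [qPochInf_ne_zero_iff D.norm_q_lt] at h
  intro e
  apply h n
  rw [div_mul_eq_mul_div, e, div_self D.q_ne]

theorem generic {i : Fin 4} (hi : D.xiConst i ≠ 0) : Generic D.q D.abcd where
  q_ne := D.q_ne
  pow_ne n h := by
    have := D.pow_inj (m := n + 1) (n := 0) (by simpa using h)
    omega
  t_ne := xiConst_abcd hi

theorem xiConst_pair {i : Fin 4} (hi : D.xiConst i ≠ 0) {y : ℂ} {m : ℕ} (hy : y = (D.q : ℂ) ^ m) :
    qPochInf D.q (D.par (i + 1) * D.par (i + 2) * y) ≠ 0 ∧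
      qPochInf D.q (D.par (i + 1) * D.par (i + 3) * y) ≠ 0 ∧
      qPochInf D.q (D.par (i + 2) * D.par (i + 3) * y) ≠ 0 ∧ qPochInf D.q (y * D.q) ≠ 0 ∧
      qPochInf D.q (D.abcd * y / D.q) ≠ 0 := by
  have key {x : ℂ} (h : qPochInf D.q x ≠ 0) : qPochInf D.q (x * y) ≠ 0 := by
    rw [qPochInf_eq_qPoch_mul D.norm_q_lt _ m, ← hy] at h
    exact right_ne_zero_of_mul h
  obtain ⟨h1, h2⟩ := div_ne_zero_iff.mp hi
  simp only [mul_ne_zero_iff] at h2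
  obtain ⟨⟨⟨h2, h3⟩, h4⟩, h5⟩ := h2
  refine ⟨key h2, key h3, key h4, ?_, ?_⟩
  · rw [mul_comm]; exact key h5
  · rw [← div_mul_eq_mul_div]; exact key h1

theorem xi_natCast_ne {i : Fin 4} (hi : D.xiConst i ≠ 0) (m : ℕ) : D.xi i m ≠ 0 := by
  obtain ⟨h1, h2, h3, h4, h5⟩ := xiConst_pair hi (D.qpow_natCast m)
  rw [xi_eq, xiY]
  refine mul_ne_zero (mul_ne_zero hi (inv_ne_zero ?_)) (div_ne_zero (mul_ne_zero (D.qpow_ne _)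
    (mul_ne_zero (mul_ne_zero (mul_ne_zero h1 h2) h3) h4)) h5)
  simp [D.par_ne]

theorem continuousAt_xi {i : Fin 4} (hi : D.xiConst i ≠ 0) (m : ℕ) : ContinuousAt (D.xi i) m := by
  obtain ⟨h1, h2, h3, h4, h5⟩ := xiConst_pair hi (D.qpow_natCast m)
  have hc := (differentiable_qPochInf D.norm_q_lt).continuous
  have hx := D.continuous_qpow
  have e : D.xi i = fun γ => D.xiConst i * ((D.par i) ^ γ)⁻¹ * D.xiY i (D.qpow γ) := by
    funext γ; exact D.xi_eq i γ
  have hpow : Continuous fun γ : ℂ => (D.par i) ^ γ :=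
    (differentiable_id.const_cpow (Or.inl (D.par_ne i))).continuous
  rw [e]
  unfold xiY
  refine ContinuousAt.mul (ContinuousAt.mul continuousAt_const (ContinuousAt.inv₀ hpow.continuousAt
    (by simp [D.par_ne]))) (ContinuousAt.div ?_ ?_ h5)
  · exact Continuous.continuousAt (by fun_prop)
  · exact Continuous.continuousAt (by fun_prop)

end Data

/-! ### Laurent functions -/

/-- The Laurent polynomials, as functions of a complex variable (only their values at `x ≠ 0`
matter). -/
def laurentFun : Subalgebra ℂ (ℂ → ℂ) := Algebra.adjoin ℂ {fun x => x, fun x => x⁻¹}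

theorem id_mem_laurentFun : (fun x : ℂ => x) ∈ laurentFun :=
  Algebra.subset_adjoin (Set.mem_insert _ _)

theorem inv_mem_laurentFun : (fun x : ℂ => x⁻¹) ∈ laurentFun :=
  Algebra.subset_adjoin (Set.mem_insert_of_mem _ rfl)

theorem const_mem_laurentFun (s : ℂ) : (fun _ => s) ∈ laurentFun := laurentFun.algebraMap_mem s

theorem laurentFun_scale {F : ℂ → ℂ} (hF : F ∈ laurentFun) (s : ℂ) :
    (fun x => F (x * s)) ∈ laurentFun := by
  induction hF using Algebra.adjoin_induction with
  | mem f hf =>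
    rcases hf with rfl | rfl
    · exact mul_mem id_mem_laurentFun (const_mem_laurentFun s)
    · simp only [mul_inv]
      exact mul_mem inv_mem_laurentFun (const_mem_laurentFun s⁻¹)
  | algebraMap r => exact const_mem_laurentFun r
  | add f g _ _ hf hg => exact add_mem hf hg
  | mul f g _ _ hf hg => exact mul_mem hf hg

theorem laurentFun_continuousAt {F : ℂ → ℂ} (hF : F ∈ laurentFun) {x : ℂ} (hx : x ≠ 0) :
    ContinuousAt F x := by
  induction hF using Algebra.adjoin_induction with
  | mem f hf =>
    rcases hf with rfl | rfl
    · exact continuousAt_id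
    · exact continuousAt_inv₀ hx
  | algebraMap r => exact continuousAt_const
  | add f g _ _ hf hg => exact hf.add hg
  | mul f g _ _ hf hg => exact hf.mul hg

theorem exists_pow_mul_eq {F : ℂ → ℂ} (hF : F ∈ laurentFun) :
    ∃ (N : ℕ) (P : ℂ[X]), ∀ x ≠ 0, x ^ N * F x = P.eval x := by
  induction hF using Algebra.adjoin_induction with
  | mem f hf =>
    rcases hf with rfl | rfl
    · exact ⟨0, X, fun x _ => by simp⟩
    · exact ⟨1, 1, fun x hx => by simp [hx]⟩
  | algebraMap r => exact ⟨0, C r, fun x _ => by simp⟩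
  | add f g _ _ hf hg =>
    obtain ⟨N, P, hP⟩ := hf
    obtain ⟨M, Q, hQ⟩ := hg
    refine ⟨N + M, X ^ M * P + X ^ N * Q, fun x hx => ?_⟩
    rw [Pi.add_apply, eval_add, eval_mul, eval_mul, ← hP x hx, ← hQ x hx, eval_pow, eval_pow, eval_X]
    ring
  | mul f g _ _ hf hg =>
    obtain ⟨N, P, hP⟩ := hf
    obtain ⟨M, Q, hQ⟩ := hg
    refine ⟨N + M, P * Q, fun x hx => ?_⟩
    rw [Pi.mul_apply, eval_mul, ← hP x hx, ← hQ x hx]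
    ring

/-- A Laurent function that vanishes on an infinite set vanishes. -/
theorem laurentFun_eq_zero {F : ℂ → ℂ} (hF : F ∈ laurentFun) {s : Set ℂ} (hs : s.Infinite)
    (h : ∀ x ∈ s, F x = 0) {x : ℂ} (hx : x ≠ 0) : F x = 0 := by
  obtain ⟨N, P, hP⟩ := exists_pow_mul_eq hF
  have h0 : P = 0 := by
    refine eq_zero_of_infinite_isRoot P ((hs.sdiff (Set.finite_singleton 0)).mono fun y hy => ?_)
    have := hP y hy.2
    rw [h y hy.1, mul_zero] at this
    exact this.symm
  have := hP x hx
  rw [h0, eval_zero] at this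
  exact (mul_eq_zero.mp this).resolve_left (pow_ne_zero N hx)

theorem laurentFun_mul_eq_zero {F G : ℂ → ℂ} (hF : F ∈ laurentFun) (hG : G ∈ laurentFun)
    (h : ∀ x ≠ 0, F x * G x = 0) (hG0 : ∃ x ≠ 0, G x ≠ 0) {x : ℂ} (hx : x ≠ 0) : F x = 0 := by
  obtain ⟨y, hy, hGy⟩ := hG0
  by_contra hFx
  have hfin : ∀ {H : ℂ → ℂ}, H ∈ laurentFun → ∀ {w : ℂ}, w ≠ 0 → H w ≠ 0 →
      {u | H u = 0}.Finite := by
    intro H hH w hw hHw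
    by_contra hinf
    exact hHw (laurentFun_eq_zero hH hinf (fun _ hu => hu) hw)
  have hu := ((hfin hF hx hFx).union (hfin hG hy hGy)).union (Set.finite_singleton 0)
  obtain ⟨u, hu⟩ := hu.infinite_compl.nonempty
  simp only [Set.mem_compl_iff, Set.mem_union, Set.mem_ofPred_eq, Set.mem_singleton_iff, not_or] at hu
  exact (mul_ne_zero hu.1.1 hu.1.2) (h u hu.2)

theorem eval_comp_mem_laurentFun {F : ℂ → ℂ} (hF : F ∈ laurentFun) (P : ℂ[X]) :
    (fun x => P.eval (F x)) ∈ laurentFun := by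
  have : (fun x => P.eval (F x)) = aeval F P := by
    funext x
    rw [← coe_aeval_eq_eval, ← Pi.evalAlgHom_apply ℂ (fun _ => ℂ) x (aeval F P), ← aeval_algHom_apply]
    rfl
  rw [this]
  exact Algebra.adjoin_le (Set.singleton_subset_iff.mpr hF) (aeval_mem_adjoin_singleton ℂ F)

theorem det_mem_laurentFun {m : ℕ} {N : ℂ → Matrix (Fin m) (Fin m) ℂ}
    (h : ∀ i j, (fun x => N x i j) ∈ laurentFun) : (fun x => (N x).det) ∈ laurentFun := by
  have : (fun x => (N x).det) =
      ∑ σ : Equiv.Perm (Fin m), ((Equiv.Perm.sign σ : ℤ) : ℂ) • ∏ i, fun x => N x (σ i) i := by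
    funext x
    simp [Matrix.det_apply, Finset.sum_apply, Units.smul_def]
  rw [this]
  exact sum_mem fun σ _ => laurentFun.smul_mem (prod_mem fun i _ => h _ _) _

theorem adjugate_mem_laurentFun {m : ℕ} {N : ℂ → Matrix (Fin m) (Fin m) ℂ}
    (h : ∀ i j, (fun x => N x i j) ∈ laurentFun) (s j : Fin m) :
    (fun x => (N x).adjugate s j) ∈ laurentFun := by
  simp only [Matrix.adjugate_apply]
  refine det_mem_laurentFun fun i i' => ?_
  by_cases hij : i = j
  · subst hij
    simpa using const_mem_laurentFun _
  · simpa [Matrix.updateRow_apply, hij] using h i i'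

theorem qPoch_mem_laurentFun {F : ℂ → ℂ} (hF : F ∈ laurentFun) (q : ℂ) (n : ℕ) :
    (fun x => qPoch q (F x) n) ∈ laurentFun := by
  have : (fun x => qPoch q (F x) n) = ∏ l ∈ Finset.range n, ((fun _ => 1) - F * fun _ => q ^ l) := by
    funext x
    simp [qPoch, Finset.prod_apply]
  rw [this]
  exact prod_mem fun l _ => sub_mem (const_mem_laurentFun 1) (mul_mem hF (const_mem_laurentFun _))

namespace Data
variable {k : ℕ} (D : Data k)

theorem laurentAt_mem (r : LaurentPolynomial ℂ) :
    ∃ F ∈ laurentFun, ∀ n : ℕ, D.laurentAt n r = F ((D.q : ℂ) ^ n) := by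
  induction r using LaurentPolynomial.induction_on' with
  | add r s hr hs =>
    obtain ⟨F, hF, h⟩ := hr
    obtain ⟨G, hG, h'⟩ := hs
    exact ⟨F + G, add_mem hF hG, fun n => by rw [map_add, h, h']; rfl⟩
  | C_mul_T n s =>
    refine ⟨fun x => s * x ^ n, mul_mem (const_mem_laurentFun s) (b := fun x : ℂ => x ^ n) ?_,
      fun m => by simp [laurentAt, LaurentPolynomial.eval₂_C_mul_T, qUnit]⟩
    obtain ⟨m, rfl | rfl⟩ := n.eq_nat_or_neg
    · simp only [zpow_natCast]
      exact pow_mem id_mem_laurentFun m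
    · simp only [zpow_neg, zpow_natCast, ← inv_pow]
      exact pow_mem inv_mem_laurentFun m

theorem lamX_mem : D.lamX ∈ laurentFun := by
  have : D.lamX = ((fun x => x⁻¹) - fun _ => 1) *
      ((fun _ => 1) - (fun _ => D.abcd / D.q) * fun x => x) := by
    funext x
    simp only [lamX, Pi.mul_apply, Pi.sub_apply]
    ring
  rw [this]
  exact mul_mem (sub_mem inv_mem_laurentFun (const_mem_laurentFun _)) (sub_mem
    (const_mem_laurentFun _) (mul_mem (const_mem_laurentFun _) id_mem_laurentFun))

theorem lamX_reflect {x : ℂ} (hx : x ≠ 0) : D.lamX (D.q / (D.abcd * x)) = D.lamX x := by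
  have h1 := D.q_ne
  have h2 := D.abcd_ne
  unfold lamX
  field_simp
  ring

theorem weight_reflect {x : ℂ} (hx : x ≠ 0) :
    weight D.q D.abcd (D.q / (D.abcd * x)) = -weight D.q D.abcd x := by
  have h1 := D.q_ne
  have h2 := D.abcd_ne
  unfold weight
  field_simp
  ring

/-- The Laurent polynomials are a free module over the polynomials in `λ`, with basis `1` and the
antisymmetric weight. -/
theorem exists_eq_add_weight_mul {F : ℂ → ℂ} (hF : F ∈ laurentFun) :
    ∃ P R : ℂ[X], ∀ x ≠ 0, F x = P.eval (D.lamX x) + weight D.q D.abcd x * R.eval (D.lamX x) := by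
  have h1 := D.q_ne
  have h2 := D.abcd_ne
  induction hF using Algebra.adjoin_induction with
  | mem f hf =>
    rcases hf with rfl | rfl
    · refine ⟨C (D.q / (2 * D.abcd)) * (X + C (1 + D.abcd / D.q)), C (-(D.q / (2 * D.abcd))),
        fun x hx => ?_⟩
      simp only [eval_mul, eval_C, eval_add, eval_X, lamX, weight]
      field_simp
      ring
    · refine ⟨C 2⁻¹ * (X + C (1 + D.abcd / D.q)), C 2⁻¹, fun x hx => ?_⟩
      simp only [eval_mul, eval_C, eval_add, eval_X, lamX, weight]
      field_simp
      ring
  | algebraMap r => exact ⟨C r, 0, fun x _ => by simp⟩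
  | add f g _ _ hf hg =>
    obtain ⟨P, R, h⟩ := hf
    obtain ⟨P', R', h'⟩ := hg
    refine ⟨P + P', R + R', fun x hx => ?_⟩
    rw [Pi.add_apply, h x hx, h' x hx, eval_add, eval_add]
    ring
  | mul f g _ _ hf hg =>
    obtain ⟨P, R, h⟩ := hf
    obtain ⟨P', R', h'⟩ := hg
    refine ⟨P * P' + ((X + C (1 + D.abcd / D.q)) ^ 2 - C (4 * D.abcd / D.q)) * (R * R'),
      P * R' + R * P', fun x hx => ?_⟩
    have hw : weight D.q D.abcd x ^ 2 =
        (D.lamX x + (1 + D.abcd / D.q)) ^ 2 - 4 * D.abcd / D.q := by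
      unfold weight lamX
      field_simp
      ring
    simp only [Pi.mul_apply, h x hx, h' x hx, eval_add, eval_mul, eval_sub, eval_pow, eval_X, eval_C]
    linear_combination (R.eval (D.lamX x) * R'.eval (D.lamX x)) * hw

theorem exists_eq_eval_lamX {F : ℂ → ℂ} (hF : F ∈ laurentFun)
    (h : ∀ x ≠ 0, F (D.q / (D.abcd * x)) = F x) :
    ∃ P : ℂ[X], ∀ x ≠ 0, F x = P.eval (D.lamX x) := by
  obtain ⟨P, R, hPR⟩ := D.exists_eq_add_weight_mul hF
  refine ⟨P, fun x hx => ?_⟩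
  have e := h x hx
  have hx' : D.q / (D.abcd * x) ≠ 0 := div_ne_zero D.q_ne (mul_ne_zero D.abcd_ne hx)
  rw [hPR _ hx', hPR _ hx, lamX_reflect D hx, weight_reflect D hx] at e
  rw [hPR x hx]
  linear_combination (-1 / 2 : ℂ) * e

theorem exists_eq_weight_mul {F : ℂ → ℂ} (hF : F ∈ laurentFun)
    (h : ∀ x ≠ 0, F (D.q / (D.abcd * x)) = -F x) :
    ∃ R : ℂ[X], ∀ x ≠ 0, F x = weight D.q D.abcd x * R.eval (D.lamX x) := by
  obtain ⟨P, R, hPR⟩ := D.exists_eq_add_weight_mul hF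
  refine ⟨R, fun x hx => ?_⟩
  have e := h x hx
  have hx' : D.q / (D.abcd * x) ≠ 0 := div_ne_zero D.q_ne (mul_ne_zero D.abcd_ne hx)
  rw [hPR _ hx', hPR _ hx, lamX_reflect D hx, weight_reflect D hx] at e
  rw [hPR x hx]
  linear_combination (1 / 2 : ℂ) * e

theorem infinite_pow (N : ℕ) : {x : ℂ | ∃ n, N ≤ n ∧ x = (D.q : ℂ) ^ n}.Infinite := by
  have : Set.InjOn (fun n : ℕ => (D.q : ℂ) ^ n) (Set.Ici N) := fun m _ n _ h => D.pow_inj h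
  refine ((Set.Ici_infinite N).image this).mono ?_
  rintro _ ⟨n, hn, rfl⟩
  exact ⟨n, hn, rfl⟩

/-- Laurent functions that agree at `q^n` for all large `n` agree. -/
theorem laurentFun_eq {F G : ℂ → ℂ} (hF : F ∈ laurentFun) (hG : G ∈ laurentFun)
    (h : ∀ᶠ n : ℕ in atTop, F ((D.q : ℂ) ^ n) = G ((D.q : ℂ) ^ n)) {x : ℂ} (hx : x ≠ 0) :
    F x = G x := by
  obtain ⟨N, hN⟩ := eventually_atTop.mp h
  refine sub_eq_zero.mp (laurentFun_eq_zero (sub_mem hF hG) (D.infinite_pow N) ?_ hx)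
  rintro _ ⟨n, hn, rfl⟩
  exact sub_eq_zero.mpr (hN n hn)

end Data

/-! ### The quotients of the normalizing functions -/

/-- Reversal of the factors of a finite shifted factorial. -/
theorem qPoch_reverse {q y w : ℂ} (s : ℕ) (h : y * w * q ^ s = q) (hq : q ≠ 0) :
    qPoch q y s = (∏ l ∈ Finset.range s, (-y * q ^ l)) * qPoch q w s := by
  rw [qPoch, qPoch, ← Finset.prod_range_reflect, ← Finset.prod_range_reflect
    (fun l => -y * q ^ l), ← Finset.prod_mul_distrib]
  refine Finset.prod_congr rfl fun l hl => ?_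
  have hl' : s = s - 1 - l + l + 1 := by have := Finset.mem_range.mp hl; omega
  have h' : y * w * q ^ (s - 1 - l) * q ^ l = 1 := by
    rw [hl', pow_succ, pow_add, ← mul_assoc, ← mul_assoc] at h
    have h2 := mul_right_cancel₀ hq (h.trans (one_mul q).symm)
    simpa using h2
  linear_combination -h'

theorem prod_neg_mul_pow_sq (y q : ℂ) (s : ℕ) :
    (∏ l ∈ Finset.range s, (-y * q ^ l)) = (-y) ^ s * q ^ (∑ l ∈ Finset.range s, l) := by
  rw [Finset.prod_mul_distrib, Finset.prod_const, Finset.card_range, Finset.prod_pow_eq_pow_sum]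

namespace Data
variable {k : ℕ} (D : Data k)

/-- For `δ ≠ a`, the two parameters other than `a` and `δ` are `parC δ` and `parE δ`. -/
def parC : Fin 4 → ℂ := ![D.b, D.c, D.b, D.c]

/-- See `parC`. -/
def parE : Fin 4 → ℂ := ![D.c, D.d, D.d, D.b]

variable {D}

theorem par_mul_parC {i : Fin 4} (hi : i ≠ 0) : D.a * D.par i * D.parC i * D.parE i = D.abcd := by
  unfold abcd
  fin_cases i
  · exact absurd rfl hi
  · change D.a * D.b * D.c * D.d = _; ring
  · change D.a * D.c * D.b * D.d = _; ring
  · change D.a * D.d * D.c * D.b = _; ring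

theorem parC_ne {i : Fin 4} (hi : i ≠ 0) : D.parC i ≠ 0 := fun h => D.abcd_ne (by
  rw [← par_mul_parC hi, h]; ring)

theorem parE_ne {i : Fin 4} (hi : i ≠ 0) : D.parE i ≠ 0 := fun h => D.abcd_ne (by
  rw [← par_mul_parC hi, h]; ring)

theorem exists_pair {i : Fin 4} (hi : i ≠ 0) :
    ∃ m n : Fin 4, m ≠ n ∧ m ≠ 0 ∧ n ≠ 0 ∧ i ≠ m ∧ i ≠ n ∧ D.parC i = D.par m ∧ D.parE i = D.par n := by
  fin_cases i
  · exact absurd rfl hi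
  · exact ⟨2, 3, by decide, by decide, by decide, by decide, by decide, rfl, rfl⟩
  · exact ⟨1, 3, by decide, by decide, by decide, by decide, by decide, rfl, rfl⟩
  · exact ⟨2, 1, by decide, by decide, by decide, by decide, by decide, rfl, rfl⟩

theorem xi_step_par {i : Fin 4} (hi : i ≠ 0) {γ : ℂ} (hy : 1 - D.abcd * D.qpow γ / D.q ≠ 0) :
    D.xi i (γ + 1) * (D.par i * ((1 - D.a * D.parC i * D.qpow γ) * (1 - D.a * D.parE i * D.qpow γ) *
      (1 - D.parC i * D.parE i * D.qpow γ) * (1 - D.qpow γ * D.q))) =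
        D.q * (1 - D.abcd * D.qpow γ / D.q) * D.xi i γ := by
  rw [← D.xi_step i hy]
  congr 2
  fin_cases i
  · exact absurd rfl hi
  · change _ = (1 - D.c * D.d * _) * (1 - D.c * D.a * _) * (1 - D.d * D.a * _) * _
    change (1 - D.a * D.c * _) * (1 - D.a * D.d * _) * (1 - D.c * D.d * _) * _ = _
    ring
  · change _ = (1 - D.d * D.a * _) * (1 - D.d * D.b * _) * (1 - D.a * D.b * _) * _
    change (1 - D.a * D.b * _) * (1 - D.a * D.d * _) * (1 - D.b * D.d * _) * _ = _
    ring
  · change _ = (1 - D.a * D.b * _) * (1 - D.a * D.c * _) * (1 - D.b * D.c * _) * _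
    change (1 - D.a * D.c * _) * (1 - D.a * D.b * _) * (1 - D.c * D.b * _) * _ = _
    ring

theorem xi_zero_step_par {i : Fin 4} (hi : i ≠ 0) {γ : ℂ} (hy : 1 - D.abcd * D.qpow γ / D.q ≠ 0) :
    D.xi 0 (γ + 1) * (D.a * ((1 - D.par i * D.parC i * D.qpow γ) *
      (1 - D.par i * D.parE i * D.qpow γ) *
      (1 - D.parC i * D.parE i * D.qpow γ) * (1 - D.qpow γ * D.q))) =
        D.q * (1 - D.abcd * D.qpow γ / D.q) * D.xi 0 γ := by
  rw [← D.xi_step 0 hy]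
  congr 1
  change _ = D.a * ((1 - D.b * D.c * _) * (1 - D.b * D.d * _) * (1 - D.c * D.d * _) * _)
  fin_cases i
  · exact absurd rfl hi
  · change D.a * ((1 - D.b * D.c * _) * (1 - D.b * D.d * _) * (1 - D.c * D.d * _) * _) = _
    ring
  · change D.a * ((1 - D.c * D.b * _) * (1 - D.c * D.d * _) * (1 - D.b * D.d * _) * _) = _
    ring
  · change D.a * ((1 - D.d * D.c * _) * (1 - D.d * D.b * _) * (1 - D.c * D.b * _) * _) = _
    ring

variable (D)

/-- For `s < k`, the Laurent polynomial in `x = q^γ` which is proportional, as a function of `s`, to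
`ξ^a_{γ-s} / ξ^{δ_i}_{γ-s}`, normalized so that it equals `η^{δ_i}_γ` for `s = i`. -/
def kap (i : Fin k) (s : ℕ) (x : ℂ) : ℂ :=
  if D.δ i = 0 then 1 else
    (D.par (D.δ i) / D.a) ^ ((i : ℤ) - s) * (x ^ (k - 1))⁻¹ *
      (qPoch D.q (D.par (D.δ i) * D.parC (D.δ i) * (x / D.q ^ s)) s *
        qPoch D.q (D.par (D.δ i) * D.parE (D.δ i) * (x / D.q ^ s)) s) *
      (qPoch D.q (D.a * D.parC (D.δ i) * (x * D.q / D.q ^ k)) (k - 1 - s) *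
        qPoch D.q (D.a * D.parE (D.δ i) * (x * D.q / D.q ^ k)) (k - 1 - s))

/-- The denominator that extends `kap` to `s = k`. -/
def kapDen (i : Fin k) (x : ℂ) : ℂ :=
  if D.δ i = 0 then 1 else
    (1 - D.a * D.parC (D.δ i) * (x / D.q ^ k)) * (1 - D.a * D.parE (D.δ i) * (x / D.q ^ k))

/-- The product of `kap` and `kapDen`, which makes sense for `s ≤ k`. -/
def kapNum (i : Fin k) (s : ℕ) (x : ℂ) : ℂ :=
  if D.δ i = 0 then 1 else
    (D.par (D.δ i) / D.a) ^ ((i : ℤ) - s) * (x ^ (k - 1))⁻¹ *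
      (qPoch D.q (D.par (D.δ i) * D.parC (D.δ i) * (x / D.q ^ s)) s *
        qPoch D.q (D.par (D.δ i) * D.parE (D.δ i) * (x / D.q ^ s)) s) *
      (qPoch D.q (D.a * D.parC (D.δ i) * (x / D.q ^ k)) (k - s) *
        qPoch D.q (D.a * D.parE (D.δ i) * (x / D.q ^ k)) (k - s))

variable {D}

theorem kapNum_eq {i : Fin k} {s : ℕ} (hs : s < k) (x : ℂ) :
    D.kapNum i s x = D.kapDen i x * D.kap i s x := by
  unfold kapNum kapDen kap
  split_ifs
  · simp
  obtain ⟨m, rfl⟩ : ∃ m, k = s + 1 + m := ⟨k - s - 1, by omega⟩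
  have e1 : s + 1 + m - s = m + 1 := by omega
  have e2 : s + 1 + m - 1 - s = m := by omega
  have e3 : x / (D.q : ℂ) ^ (s + 1 + m) * D.q = x * D.q / D.q ^ (s + 1 + m) := by ring
  rw [e1, e2, qPoch_succ', qPoch_succ', mul_assoc, mul_assoc _ _ (D.q : ℂ), mul_assoc _ _ (D.q : ℂ), e3]
  ring

/-- The quotient of neighbouring values of `kapNum`, which is the quotient of the recursions of
`ξ^a` and of `ξ^{δ_i}`. -/
theorem kapNum_succ {i : Fin k} {s : ℕ} (hs : s < k) (hi : D.δ i ≠ 0) (x : ℂ) :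
    D.kapNum i (s + 1) x * (D.par (D.δ i) * ((1 - D.a * D.parC (D.δ i) * (x / D.q ^ (s + 1))) *
      (1 - D.a * D.parE (D.δ i) * (x / D.q ^ (s + 1))))) =
    D.kapNum i s x * (D.a * ((1 - D.par (D.δ i) * D.parC (D.δ i) * (x / D.q ^ (s + 1))) *
      (1 - D.par (D.δ i) * D.parE (D.δ i) * (x / D.q ^ (s + 1))))) := by
  unfold kapNum
  rw [if_neg hi, if_neg hi]
  obtain ⟨m, rfl⟩ : ∃ m, k = s + 1 + m := ⟨k - s - 1, by omega⟩
  have hq := D.q_ne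
  have ha := D.a_ne_zero
  have hB := D.par_ne (D.δ i)
  have e1 : s + 1 + m - s = m + 1 := by omega
  have e2 : s + 1 + m - (s + 1) = m := by omega
  have e3 : x / (D.q : ℂ) ^ (s + 1) * D.q = x / D.q ^ s := by rw [pow_succ]; field_simp
  have e4 : x / (D.q : ℂ) ^ (s + 1 + m) * D.q ^ m = x / D.q ^ (s + 1) := by
    rw [pow_add]; field_simp
  have e5 : (D.par (D.δ i) / D.a) ^ ((i : ℤ) - s) =
      (D.par (D.δ i) / D.a) ^ ((i : ℤ) - (s + 1 : ℕ)) * (D.par (D.δ i) / D.a) := by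
    rw [← zpow_add_one₀ (div_ne_zero hB ha)]
    congr 1
    push_cast; ring
  rw [e1, e2, qPoch_succ' _ _ s, qPoch_succ' _ _ s, mul_assoc _ _ (D.q : ℂ), mul_assoc _ _ (D.q : ℂ),
    e3, qPoch_succ _ _ m, qPoch_succ _ _ m, mul_assoc _ _ ((D.q : ℂ) ^ m),
    mul_assoc _ _ ((D.q : ℂ) ^ m), e4, e5]
  generalize (D.par (D.δ i) / D.a) ^ ((i : ℤ) - (s + 1 : ℕ)) = Z
  generalize qPoch D.q (D.par (D.δ i) * D.parC (D.δ i) * (x / D.q ^ s)) s = p1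
  generalize qPoch D.q (D.par (D.δ i) * D.parE (D.δ i) * (x / D.q ^ s)) s = p2
  generalize qPoch D.q (D.a * D.parC (D.δ i) * (x / D.q ^ (s + 1 + m))) m = p3
  generalize qPoch D.q (D.a * D.parE (D.δ i) * (x / D.q ^ (s + 1 + m))) m = p4
  generalize x / (D.q : ℂ) ^ (s + 1) = w
  generalize (x ^ (s + 1 + m - 1))⁻¹ = Y
  have hc : D.par (D.δ i) / D.a * D.a = D.par (D.δ i) := div_mul_cancel₀ _ ha
  generalize D.par (D.δ i) / D.a = R at hc ⊢
  rw [← hc]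
  ring

/-- The quotient `ξ^a/ξ^{δ_i}` along the lattice `γ, γ - 1, …, γ - k`. -/
theorem xi_mul_kapNum {γ : ℂ} (hγ : D.Good (γ - k - 2)) (i : Fin k) {s s' : ℕ} (hs : s ≤ k)
    (hs' : s' ≤ k) (h0 : D.xiConst 0 ≠ 0) :
    D.xi (D.δ i) (γ - s) * D.xi 0 (γ - s') * D.kapNum i s (D.qpow γ) =
      D.xi (D.δ i) (γ - s') * D.xi 0 (γ - s) * D.kapNum i s' (D.qpow γ) := by
  by_cases hδ : D.δ i = 0
  · simp only [kapNum, hδ, if_true]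
    ring
  have hg {s : ℕ} (hs : s ≤ k) (m : ℕ) (hm : m ≤ 2) : D.Good (γ - s - m) :=
    hγ.of_add (k - s + (2 - m)) (by push_cast [hs, hm]; ring)
  have hxi {s : ℕ} (hs : s ≤ k) {j : Fin 4} (hj : D.xiConst j ≠ 0) : D.xi j (γ - s) ≠ 0 :=
    Good.xi_ne (by simpa using hg hs 1 (by norm_num)) hj
  have key : ∀ s ≤ k, D.kapNum i s (D.qpow γ) * D.xi (D.δ i) (γ - s) / D.xi 0 (γ - s) =
      D.kapNum i 0 (D.qpow γ) * D.xi (D.δ i) (γ - (0 : ℕ)) / D.xi 0 (γ - (0 : ℕ)) := by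
    intro s hs
    induction s with
    | zero => rfl
    | succ s ih =>
      rw [← ih (by omega)]
      have hsk : s < k := by omega
      set β := γ - (s + 1 : ℕ) with hβ
      have eβ : γ - s = β + 1 := by rw [hβ]; push_cast; ring
      have gβ : D.Good β := by simpa only [Nat.cast_zero, sub_zero] using hg hs 0 (by norm_num)
      have gβ1 : D.Good (β - 1) := by simpa only [Nat.cast_one] using hg hs 1 (by norm_num)
      have hy : 1 - D.abcd * D.qpow β / D.q ≠ 0 := by
        have := gβ1.one_sub_abcd
        rwa [qpow_sub, qpow_one, ← mul_div_assoc] at this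
      have h1 := xi_step_par hδ hy
      have h2 := xi_zero_step_par hδ hy
      have h3 := kapNum_succ hsk hδ (D.qpow γ)
      rw [← qpow_natCast, ← qpow_sub, ← hβ] at h3
      obtain ⟨m, n, hmn, hm, hn, him, hin, eC, eE⟩ := exists_pair (D := D) hδ
      have p1 := gβ.one_sub_pair hmn
      have p2 := gβ.one_sub_pair hm.symm
      have p3 := gβ.one_sub_pair hn.symm
      have p4 := gβ.one_sub_pair him
      have p5 := gβ.one_sub_pair hin
      have p6 : 1 - D.qpow β * D.q ≠ 0 := by
        have := (gβ.of_add 1 (by push_cast; rfl) : D.Good (β + 1)).one_sub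
        rwa [qpow_add, qpow_one] at this
      rw [← eC] at p1 p2 p4
      rw [← eE] at p1 p3 p5
      change 1 - D.a * D.parC (D.δ i) * D.qpow β ≠ 0 at p2
      change 1 - D.a * D.parE (D.δ i) * D.qpow β ≠ 0 at p3
      have x1 := hxi hs h0
      have x2 := hxi (by omega : s ≤ k) h0
      rw [eβ] at x2 ⊢
      rw [← hβ] at x1
      have hB := D.par_ne (D.δ i)
      have ha := D.a_ne_zero
      rw [div_eq_div_iff x1 x2]
      generalize 1 - D.a * D.parC (D.δ i) * D.qpow β = A1 at *
      generalize 1 - D.a * D.parE (D.δ i) * D.qpow β = A2 at *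
      generalize 1 - D.par (D.δ i) * D.parC (D.δ i) * D.qpow β = A3 at *
      generalize 1 - D.par (D.δ i) * D.parE (D.δ i) * D.qpow β = A4 at *
      generalize 1 - D.parC (D.δ i) * D.parE (D.δ i) * D.qpow β = A5 at *
      generalize 1 - D.qpow β * D.q = A6 at *
      generalize D.xi (D.δ i) (β + 1) = X1 at *
      generalize D.xi (D.δ i) β = X0 at *
      generalize D.xi 0 (β + 1) = Z1 at *
      generalize D.xi 0 β = Z0 at *
      generalize D.kapNum i (s + 1) (D.qpow γ) = K1 at *
      generalize D.kapNum i s (D.qpow γ) = K0 at *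
      have hq := D.q_ne
      generalize 1 - D.abcd * D.qpow β / D.q = S at *
      have hc : D.q * S * (D.par (D.δ i) * (A1 * A2)) ≠ 0 := by
        simp only [ne_eq, mul_eq_zero, not_or]
        exact ⟨⟨hq, hy⟩, hB, p2, p3⟩
      refine mul_left_cancel₀ hc ?_
      linear_combination (D.q * S * X0 * Z1) * h3 - (K0 * Z1 * D.a * A3 * A4) * h1 +
        K0 * X1 * (D.par (D.δ i) * (A1 * A2)) * h2
  have e1 := key s hs
  rw [← key s' hs', div_eq_div_iff (hxi hs h0) (hxi hs' h0)] at e1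
  linear_combination e1

end Data

/-! ### Determinants as Laurent polynomials -/

namespace Data
variable {k : ℕ} {D : Data k}

theorem par_zero : D.par 0 = D.a := rfl

theorem xi_ne_sub {γ : ℂ} (hγ : D.Good (γ - k - 2)) {i : Fin 4} (hi : D.xiConst i ≠ 0) {s : ℕ}
    (hs : s ≤ k) : D.xi i (γ - s) ≠ 0 :=
  Good.xi_ne (hγ.of_add (k - s + 1) (by push_cast [hs]; ring)) hi

theorem kapDen_ne {γ : ℂ} (hγ : D.Good (γ - k - 2)) (i : Fin k) : D.kapDen i (D.qpow γ) ≠ 0 := by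
  unfold kapDen
  split_ifs with hi
  · exact one_ne_zero
  have g : D.Good (γ - k) := hγ.of_add 2 (by push_cast; ring)
  obtain ⟨m, n, hmn, hm, hn, him, hin, eC, eE⟩ := exists_pair (D := D) hi
  have p2 := g.one_sub_pair hm.symm
  have p3 := g.one_sub_pair hn.symm
  rw [par_zero] at p2 p3
  rw [← qpow_sub_nat, eC, eE]
  exact mul_ne_zero p2 p3

theorem xi_mul_kap {γ : ℂ} (hγ : D.Good (γ - k - 2)) (i : Fin k) {s s' : ℕ} (hs : s < k)
    (hs' : s' < k) (h0 : D.xiConst 0 ≠ 0) :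
    D.xi (D.δ i) (γ - s) * D.xi 0 (γ - s') * D.kap i s (D.qpow γ) =
      D.xi (D.δ i) (γ - s') * D.xi 0 (γ - s) * D.kap i s' (D.qpow γ) := by
  have h := xi_mul_kapNum hγ i hs.le hs'.le h0
  rw [kapNum_eq hs, kapNum_eq hs'] at h
  refine mul_left_cancel₀ (kapDen_ne hγ i) ?_
  linear_combination h

theorem etaOf_eq (A B C E : ℂ) (j : Fin k) (γ : ℂ) :
    D.etaOf A B C E j γ = (D.qpow γ ^ (k - 1))⁻¹ *
      (qPoch D.q (B * C * (D.qpow γ / D.q ^ (j : ℕ))) j *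
        qPoch D.q (B * E * (D.qpow γ / D.q ^ (j : ℕ))) j) *
      (qPoch D.q (A * C * (D.qpow γ * D.q / D.q ^ k)) (k - 1 - j) *
        qPoch D.q (A * E * (D.qpow γ * D.q / D.q ^ k)) (k - 1 - j)) := by
  have e : D.qpow (γ - k + 1) = D.qpow γ * D.q / D.q ^ k := by
    rw [qpow_add, qpow_sub_nat, qpow_one]; ring
  rw [etaOf, e, qpow_sub_nat]

theorem eta_eq (i : Fin k) (γ : ℂ) : D.eta (D.δ i) i γ = D.kap i i (D.qpow γ) := by
  unfold kap eta
  rw [sub_self, zpow_zero, one_mul, etaOf_eq, etaOf_eq, etaOf_eq]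
  generalize D.δ i = d
  fin_cases d <;> rfl

variable (D)

/-- The matrix of the functions `ξ^a_{γ-s} ψ^(i)_{γ-s}` up to the normalization of its rows, as a
function of `x = q^γ`. -/
def psiMat (x : ℂ) : Matrix (Fin k) (Fin k) ℂ :=
  Matrix.of fun i s => (D.φ i).eval (D.lamX (x / D.q ^ (s : ℕ))) * D.kap i s x

/-- `τ_γ` as a Laurent polynomial in `x = q^γ`. -/
def tauX (x : ℂ) : ℂ := (D.psiMat x).det

/-- The matrix whose determinant is, up to an explicit factor, the coefficient `Q^{(-l)}`. -/
def coeffMat (l : ℕ) (x : ℂ) : Matrix (Fin (k + 1)) (Fin (k + 1)) ℂ :=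
  Matrix.of (Fin.snoc (α := fun _ => Fin (k + 1) → ℂ)
    (fun i s => (D.φ i).eval (D.lamX (x / D.q ^ (s : ℕ))) * D.kapNum i s x)
    (fun s => if (s : ℕ) = l then 1 else 0))

variable {D}

theorem lam_sub_nat (γ : ℂ) (s : ℕ) : D.lam (γ - s) = D.lamX (D.qpow γ / D.q ^ s) := by
  rw [lam_eq, qpow_sub_nat]

theorem chi_eq (γ : ℂ) : D.chi γ = (∏ i : Fin k, D.xi (D.δ i) (γ - (i : ℕ)) * D.kap i i (D.qpow γ)) *
    D.xi 0 (γ - k) := by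
  simp only [chi, eta_eq]
  rw [Finset.prod_mul_distrib]
  ring

/-- In `τ_γ` the factors `ξ` cancel: what remains is a polynomial in `q^γ` and `q^{-γ}`. -/
theorem tau_eq {γ : ℂ} (hγ : D.Good (γ - k - 2)) (hc : ∀ i, D.Occurs i → D.xiConst i ≠ 0) :
    D.tau γ = D.tauX (D.qpow γ) := by
  have h0 := hc 0 (Or.inl rfl)
  have hδ (i : Fin k) := hc (D.δ i) (Or.inr ⟨i, rfl⟩)
  have hdet : (∏ i : Fin k, D.xi (D.δ i) (γ - (i : ℕ)) * D.kap i i (D.qpow γ)) *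
      casorati (fun j γ' => D.xi 0 γ' * D.psi j γ') γ =
        (∏ i : Fin k, D.xi 0 (γ - (i : ℕ))) * D.tauX (D.qpow γ) := by
    rw [casorati, ← Matrix.det_mul_column, tauX, ← Matrix.det_mul_column]
    congr 1
    ext i s
    simp only [Matrix.of_apply, psi, psiMat, lam_sub_nat]
    have h := xi_mul_kap hγ i i.2 s.2 h0
    have hx := xi_ne_sub hγ (hδ i) s.2.le
    field_simp
    linear_combination (D.φ i).eval (D.lamX (D.qpow γ / D.q ^ (s : ℕ))) * h
  have hp : (∏ i : Fin k, D.xi 0 (γ - (i : ℕ))) ≠ 0 :=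
    Finset.prod_ne_zero_iff.mpr fun i _ => xi_ne_sub hγ h0 i.2.le
  have hk := xi_ne_sub hγ h0 le_rfl
  rw [tau, chi_eq, Fin.prod_univ_castSucc, Finset.prod_inv_distrib]
  simp only [Fin.val_castSucc, Fin.val_last]
  field_simp
  linear_combination hdet

/-- The coefficient `Q^{(-l)}_γ` is `ξ^a_{γ-l}` times a rational function of `q^γ` with an explicit
denominator. -/
theorem coeffQ_eq {γ : ℂ} (hγ : D.Good (γ - k - 2)) (hc : ∀ i, D.Occurs i → D.xiConst i ≠ 0)
    (l : ℕ) : D.coeffQ l γ * ∏ i, D.kapDen i (D.qpow γ) =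
      D.xi 0 (γ - l) * (D.coeffMat l (D.qpow γ)).det := by
  have h0 := hc 0 (Or.inl rfl)
  have hδ (i : Fin k) := hc (D.δ i) (Or.inr ⟨i, rfl⟩)
  set M := Matrix.of fun i j : Fin (k + 1) => (Fin.snoc (α := fun _ => ℂ → ℂ) D.psi
    (fun γ' => if γ' = γ - l then 1 else 0)) i (γ - (j : ℕ)) with hM
  have hdet : (∏ i : Fin k, D.xi (D.δ i) (γ - (i : ℕ)) * D.kap i i (D.qpow γ) *
        D.kapDen i (D.qpow γ)) * ((∏ s : Fin (k + 1), D.xi 0 (γ - (s : ℕ))) * M.det) =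
      (∏ i : Fin k, D.xi 0 (γ - (i : ℕ))) * D.xi 0 (γ - l) * (D.coeffMat l (D.qpow γ)).det := by
    have e1 : (∏ i : Fin k, D.xi (D.δ i) (γ - (i : ℕ)) * D.kap i i (D.qpow γ) *
        D.kapDen i (D.qpow γ)) = ∏ i : Fin (k + 1), (Fin.snoc (α := fun _ => ℂ)
          (fun i : Fin k => D.xi (D.δ i) (γ - (i : ℕ)) * D.kap i i (D.qpow γ) *
            D.kapDen i (D.qpow γ)) 1) i := by
      rw [Fin.prod_univ_castSucc]
      simp
    have e2 : (∏ i : Fin k, D.xi 0 (γ - (i : ℕ))) * D.xi 0 (γ - l) =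
        ∏ i : Fin (k + 1), (Fin.snoc (α := fun _ => ℂ)
          (fun i : Fin k => D.xi 0 (γ - (i : ℕ))) (D.xi 0 (γ - l))) i := by
      rw [Fin.prod_univ_castSucc]
      simp
    rw [e1, e2, ← Matrix.det_mul_row, ← Matrix.det_mul_column, ← Matrix.det_mul_column]
    congr 1
    ext i s
    have hs : (s : ℕ) ≤ k := by omega
    refine Fin.lastCases ?_ (fun i => ?_) i
    · simp only [hM, coeffMat, Matrix.of_apply, Fin.snoc_last, one_mul, sub_right_inj, Nat.cast_inj]
      by_cases h : (s : ℕ) = l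
      · simp [h]
      · simp [h]
    · simp only [hM, coeffMat, Matrix.of_apply, Fin.snoc_castSucc, psi, lam_sub_nat]
      have h := xi_mul_kapNum hγ i i.2.le hs h0
      rw [kapNum_eq i.2] at h
      have hx := xi_ne_sub hγ (hδ i) hs
      field_simp
      linear_combination (D.φ i).eval (D.lamX (D.qpow γ / D.q ^ (s : ℕ))) * h
  have hp : (∏ i : Fin k, D.xi 0 (γ - (i : ℕ))) ≠ 0 :=
    Finset.prod_ne_zero_iff.mpr fun i _ => xi_ne_sub hγ h0 i.2.le
  have hcas : D.coeffQ l γ = D.chi γ * M.det := rfl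
  rw [hcas, chi_eq]
  rw [Fin.prod_univ_castSucc, Finset.prod_mul_distrib] at hdet
  simp only [Fin.val_castSucc, Fin.val_last] at hdet
  refine mul_left_cancel₀ hp ?_
  linear_combination hdet

theorem kap_zero_mul_kapDen (i : Fin k) (hi : D.δ i ≠ 0) {x : ℂ} (hx : x ≠ 0) :
    D.kap i 0 x * D.kapDen i x * (D.q : ℂ) ^ (k - 1) =
      D.kap i 0 (x / D.q) * ((1 - D.a * D.parC (D.δ i) * (x / D.q)) *
        (1 - D.a * D.parE (D.δ i) * (x / D.q))) := by
  have hq := D.q_ne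
  obtain ⟨m, hm⟩ : ∃ m, k = m + 1 := ⟨k - 1, by have := i.2; omega⟩
  have e1 : (D.q : ℂ) ^ k = D.q ^ m * D.q :=
    (congrArg (fun n => (D.q : ℂ) ^ n) hm).trans (pow_succ _ _)
  have e2 : x / (D.q : ℂ) ^ k * D.q = x * D.q / D.q ^ k := by ring
  have e3 : x / (D.q : ℂ) ^ k * D.q ^ m = x / D.q := by
    rw [e1]; field_simp
  have e4 : x / D.q * D.q / (D.q : ℂ) ^ k = x / D.q ^ k := by
    field_simp
  have key (A : ℂ) : (1 - A * (x / (D.q : ℂ) ^ k)) * qPoch D.q (A * (x * D.q / D.q ^ k)) (k - 1 - 0) =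
      qPoch D.q (A * (x / D.q ^ k)) (k - 1 - 0) * (1 - A * (x / D.q)) := by
    have e : k - 1 - 0 = m := by omega
    rw [e, ← e2, ← mul_assoc, ← qPoch_succ', qPoch_succ, mul_assoc, e3]
  have k1 := key (D.a * D.parC (D.δ i))
  have k2 := key (D.a * D.parE (D.δ i))
  unfold kap kapDen
  rw [if_neg hi, if_neg hi, if_neg hi, e4]
  simp only [qPoch_zero, mul_one, div_pow, inv_div]
  generalize (D.par (D.δ i) / D.a) ^ ((i : ℤ) - (0 : ℕ)) = Z
  rw [div_eq_mul_inv ((D.q : ℂ) ^ (k - 1))]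
  linear_combination Z * (x ^ (k - 1))⁻¹ * (D.q : ℂ) ^ (k - 1) *
    ((1 - D.a * D.parE (D.δ i) * (x / (D.q : ℂ) ^ k)) *
      qPoch D.q (D.a * D.parE (D.δ i) * (x * D.q / D.q ^ k)) (k - 1 - 0) * k1 +
    qPoch D.q (D.a * D.parC (D.δ i) * (x / D.q ^ k)) (k - 1 - 0) *
      (1 - D.a * D.parC (D.δ i) * (x / D.q)) * k2)

variable (D) in
/-- The factors by which the zeros of `χ_γ ξ^a_{γ-k-1} / χ_{γ-1}` differ from those of `ξ^a_γ`. -/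
def ratioNum (i : Fin k) (x : ℂ) : ℂ :=
  if D.δ i = 0 then 1 else D.a * ((1 - D.par (D.δ i) * D.parC (D.δ i) * (x / D.q)) *
    (1 - D.par (D.δ i) * D.parE (D.δ i) * (x / D.q)))

variable (D) in
/-- The constant factors in the quotient `χ_γ / χ_{γ-1}`. -/
def ratioConst (i : Fin k) : ℂ := if D.δ i = 0 then 1 else D.par (D.δ i) * D.q ^ (k - 1)

/-- The contribution of one row to the quotient `χ_γ / χ_{γ-1}`. -/
theorem ratio_row {γ : ℂ} (hγ : D.Good (γ - k - 4)) (i : Fin k) :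
    D.xi (D.δ i) γ * D.xi 0 (γ - 1) * D.kap i 0 (D.qpow γ) *
        (D.kapDen i (D.qpow γ) * D.ratioConst i) =
      D.xi (D.δ i) (γ - 1) * D.xi 0 γ * D.kap i 0 (D.qpow γ / D.q) * D.ratioNum i (D.qpow γ) := by
  by_cases hi : D.δ i = 0
  · unfold kap kapDen ratioConst ratioNum
    rw [if_pos hi, if_pos hi, if_pos hi, if_pos hi, if_pos hi, hi]
    ring
  have h3 := kap_zero_mul_kapDen i hi (D.qpow_ne γ)
  have gβ : D.Good (γ - 1) := hγ.of_add (k + 3) (by push_cast; ring)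
  have gβ1 : D.Good (γ - 1 - 1) := hγ.of_add (k + 2) (by push_cast; ring)
  have hy : 1 - D.abcd * D.qpow (γ - 1) / D.q ≠ 0 := by
    have := gβ1.one_sub_abcd
    rwa [qpow_sub, qpow_one, ← mul_div_assoc] at this
  have h1 := xi_step_par hi hy
  have h2 := xi_zero_step_par hi hy
  obtain ⟨m, n, hmn, hm, hn, him, hin, eC, eE⟩ := exists_pair (D := D) hi
  have p1 := gβ.one_sub_pair hmn
  have p6 : 1 - D.qpow (γ - 1) * D.q ≠ 0 := by
    have := (gβ.of_add 1 (by push_cast; rfl) : D.Good (γ - 1 + 1)).one_sub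
    rwa [qpow_add, qpow_one] at this
  rw [← eC, ← eE] at p1
  have e : D.qpow γ / D.q = D.qpow (γ - 1) := by rw [qpow_sub, qpow_one]
  unfold ratioConst ratioNum
  rw [if_neg hi, if_neg hi]
  rw [sub_add_cancel] at h1 h2
  rw [e] at h3 ⊢
  have hq := D.q_ne
  have hc : (1 - D.parC (D.δ i) * D.parE (D.δ i) * D.qpow (γ - 1)) * (1 - D.qpow (γ - 1) * D.q) ≠ 0 :=
    mul_ne_zero p1 p6
  refine mul_left_cancel₀ hc ?_
  generalize 1 - D.a * D.parC (D.δ i) * D.qpow (γ - 1) = A1 at *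
  generalize 1 - D.a * D.parE (D.δ i) * D.qpow (γ - 1) = A2 at *
  generalize 1 - D.par (D.δ i) * D.parC (D.δ i) * D.qpow (γ - 1) = A3 at *
  generalize 1 - D.par (D.δ i) * D.parE (D.δ i) * D.qpow (γ - 1) = A4 at *
  generalize 1 - D.parC (D.δ i) * D.parE (D.δ i) * D.qpow (γ - 1) = A5 at *
  generalize 1 - D.qpow (γ - 1) * D.q = A6 at *
  generalize D.q * (1 - D.abcd * D.qpow (γ - 1) / D.q) = S at *
  linear_combination A5 * A6 * D.xi (D.δ i) γ * D.xi 0 (γ - 1) * D.par (D.δ i) * h3 +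
    D.kap i 0 (D.qpow (γ - 1)) * D.xi 0 (γ - 1) * h1 -
    D.kap i 0 (D.qpow (γ - 1)) * D.xi (D.δ i) (γ - 1) * h2

/-- The function `χ_γ ξ^a_{γ-k-1} / χ_{γ-1}` is `ξ^a_γ` times an explicit rational function. -/
theorem chi_ratio {γ : ℂ} (hγ : D.Good (γ - k - 4)) (h0 : D.xiConst 0 ≠ 0) :
    D.chi γ * D.xi 0 (γ - k - 1) * (∏ i, D.kapDen i (D.qpow γ) * D.ratioConst i) =
      D.chi (γ - 1) * (D.xi 0 γ * ∏ i, D.ratioNum i (D.qpow γ)) := by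
  have g1 : D.Good (γ - k - 2) := hγ.of_add 2 (by push_cast; ring)
  have g2 : D.Good (γ - 1 - k - 2) := hγ.of_add 1 (by push_cast; ring)
  have x0 : D.xi 0 γ ≠ 0 := by simpa using xi_ne_sub g1 h0 (Nat.zero_le k)
  have x1 : D.xi 0 (γ - 1) ≠ 0 := by simpa using xi_ne_sub g2 h0 (Nat.zero_le k)
  have e : D.qpow γ / D.q = D.qpow (γ - 1) := by rw [qpow_sub, qpow_one]
  have c (γ : ℂ) (hγ : D.Good (γ - k - 2)) : D.chi γ * ∏ _i : Fin k, D.xi 0 γ =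
      (∏ i, D.xi (D.δ i) γ * D.kap i 0 (D.qpow γ)) * ((∏ i : Fin k, D.xi 0 (γ - (i : ℕ))) *
        D.xi 0 (γ - k)) := by
    rw [chi_eq, mul_right_comm, ← Finset.prod_mul_distrib, ← mul_assoc, ← Finset.prod_mul_distrib]
    congr 1
    refine Finset.prod_congr rfl fun i _ => ?_
    have h := xi_mul_kap hγ i i.2 (s' := 0) (by have := i.2; omega) h0
    simp only [Nat.cast_zero, sub_zero] at h
    linear_combination h
  have c0 := c γ g1
  have c1 := c (γ - 1) g2
  have hr : (∏ i, D.xi (D.δ i) γ * D.kap i 0 (D.qpow γ)) * (∏ _i : Fin k, D.xi 0 (γ - 1)) *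
      (∏ i, D.kapDen i (D.qpow γ) * D.ratioConst i) =
      (∏ i, D.xi (D.δ i) (γ - 1) * D.kap i 0 (D.qpow (γ - 1))) * (∏ _i : Fin k, D.xi 0 γ) *
        ∏ i, D.ratioNum i (D.qpow γ) := by
    simp only [← Finset.prod_mul_distrib]
    refine Finset.prod_congr rfl fun i _ => ?_
    have h := ratio_row hγ i
    rw [e] at h
    linear_combination h
  have ht : (∏ i : Fin k, D.xi 0 (γ - (i : ℕ))) * D.xi 0 (γ - k) =
      D.xi 0 γ * ∏ i : Fin k, D.xi 0 (γ - 1 - (i : ℕ)) := by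
    have h1 := Fin.prod_univ_castSucc fun i : Fin (k + 1) => D.xi 0 (γ - (i : ℕ))
    have h2 := Fin.prod_univ_succ fun i : Fin (k + 1) => D.xi 0 (γ - (i : ℕ))
    rw [h1] at h2
    simp only [Fin.val_castSucc, Fin.val_last, Fin.val_zero, Fin.val_succ, Nat.cast_zero,
      sub_zero] at h2
    rw [h2]
    congr 1
    refine Finset.prod_congr rfl fun i _ => ?_
    congr 1
    push_cast
    ring
  have hne : (∏ _i : Fin k, D.xi 0 γ) * (∏ _i : Fin k, D.xi 0 (γ - 1)) ≠ 0 :=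
    mul_ne_zero (Finset.prod_ne_zero_iff.mpr fun _ _ => x0)
      (Finset.prod_ne_zero_iff.mpr fun _ _ => x1)
  have ek : γ - k - 1 = γ - 1 - k := by ring
  rw [ek]
  rw [ht] at c0
  refine mul_left_cancel₀ hne ?_
  generalize (∏ _i : Fin k, D.xi 0 γ) = Y0 at *
  generalize (∏ _i : Fin k, D.xi 0 (γ - 1)) = Y1 at *
  generalize (∏ i : Fin k, D.xi 0 (γ - 1 - (i : ℕ))) = T at *
  generalize (∏ i, D.kapDen i (D.qpow γ) * D.ratioConst i) = DC at *
  generalize (∏ i, D.ratioNum i (D.qpow γ)) = U at *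
  generalize (∏ i, D.xi (D.δ i) γ * D.kap i 0 (D.qpow γ)) = G0 at *
  generalize (∏ i, D.xi (D.δ i) (γ - 1) * D.kap i 0 (D.qpow (γ - 1))) = G1 at *
  generalize D.xi 0 (γ - 1 - k) = Zk at *
  linear_combination Y1 * Zk * DC * c0 + D.xi 0 γ * T * Zk * hr - Y0 * D.xi 0 γ * U * c1

end Data

/-! ### Regularity at the nonnegative integers and the degree -/

namespace Data
variable {k : ℕ} (D : Data k)

/-- The assumptions on `τ` and `χ`. -/
structure Regular : Prop where
  tau : ∀ n : ℤ, -1 ≤ n → NonzeroAt D.tau n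
  chi : ∀ n : ℕ, NonzeroAt (fun γ => D.chi γ * D.xi 0 (γ - k - 1) / D.chi (γ - 1)) n

variable {D}

theorem Regular.const (H : D.Regular) : ∀ i, D.Occurs i → D.xiConst i ≠ 0 := fun _ hi =>
  D.xiConst_ne (H.tau 0 (by norm_num)) hi

theorem Regular.const_zero (H : D.Regular) : D.xiConst 0 ≠ 0 := H.const 0 (Or.inl rfl)

theorem Regular.const_row (H : D.Regular) (i : Fin k) : D.xiConst (D.δ i) ≠ 0 :=
  H.const _ (Or.inr ⟨i, rfl⟩)

theorem Regular.generic (H : D.Regular) : Generic D.q D.abcd := Data.generic H.const_zero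

theorem eventually_good_sub_nhds (c s : ℂ) : ∀ᶠ γ in 𝓝[≠] c, D.Good (γ - s) := by
  have h : Tendsto (fun γ : ℂ => γ - s) (𝓝[≠] c) (𝓝[≠] (c - s)) := by
    refine tendsto_nhdsWithin_of_tendsto_nhds_of_eventually_within _
      ((continuous_id.sub continuous_const).tendsto' c _ rfl |>.mono_left nhdsWithin_le_nhds) ?_
    filter_upwards [self_mem_nhdsWithin] with γ hγ e
    exact hγ (sub_left_injective e)
  exact h.eventually (D.eventually_good_nhds _)

variable (D) in
theorem div_pow_mem (s : ℕ) : (fun x : ℂ => x / D.q ^ s) ∈ laurentFun := by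
  simp only [div_eq_mul_inv]
  exact mul_mem id_mem_laurentFun (const_mem_laurentFun _)

variable (D) in
theorem phi_mem (i : Fin k) (s : ℕ) :
    (fun x : ℂ => (D.φ i).eval (D.lamX (x / D.q ^ s))) ∈ laurentFun := by
  simp only [div_eq_mul_inv]
  exact laurentFun_scale (eval_comp_mem_laurentFun D.lamX_mem (D.φ i)) _

theorem inv_pow_mem_laurentFun (m : ℕ) : (fun x : ℂ => (x ^ m)⁻¹) ∈ laurentFun := by
  simp only [← inv_pow]
  exact pow_mem inv_mem_laurentFun m

variable (D) in
theorem kap_mem (i : Fin k) (s : ℕ) : D.kap i s ∈ laurentFun := by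
  have e : D.kap i s = fun x => D.kap i s x := rfl
  rw [e]
  unfold kap
  split_ifs with h
  · exact const_mem_laurentFun 1
  have h1 (A : ℂ) : (fun x : ℂ => A * (x / D.q ^ s)) ∈ laurentFun :=
    mul_mem (const_mem_laurentFun A) (D.div_pow_mem s)
  have h2 (A : ℂ) : (fun x : ℂ => A * (x * D.q / D.q ^ k)) ∈ laurentFun := by
    simp only [mul_div_assoc]
    exact mul_mem (const_mem_laurentFun A) (mul_mem id_mem_laurentFun (const_mem_laurentFun _))
  exact mul_mem (mul_mem (mul_mem (const_mem_laurentFun _) (inv_pow_mem_laurentFun _))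
    (mul_mem (qPoch_mem_laurentFun (h1 _) _ _) (qPoch_mem_laurentFun (h1 _) _ _)))
    (mul_mem (qPoch_mem_laurentFun (h2 _) _ _) (qPoch_mem_laurentFun (h2 _) _ _))

variable (D) in
theorem kapNum_mem (i : Fin k) (s : ℕ) : D.kapNum i s ∈ laurentFun := by
  have e : D.kapNum i s = fun x => D.kapNum i s x := rfl
  rw [e]
  unfold kapNum
  split_ifs with h
  · exact const_mem_laurentFun 1
  have h1 (A : ℂ) (s : ℕ) : (fun x : ℂ => A * (x / D.q ^ s)) ∈ laurentFun :=
    mul_mem (const_mem_laurentFun A) (D.div_pow_mem s)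
  exact mul_mem (mul_mem (mul_mem (const_mem_laurentFun _) (inv_pow_mem_laurentFun _))
    (mul_mem (qPoch_mem_laurentFun (h1 _ _) _ _) (qPoch_mem_laurentFun (h1 _ _) _ _)))
    (mul_mem (qPoch_mem_laurentFun (h1 _ _) _ _) (qPoch_mem_laurentFun (h1 _ _) _ _))

variable (D) in
theorem kapDen_mem (i : Fin k) : D.kapDen i ∈ laurentFun := by
  have e : D.kapDen i = fun x => D.kapDen i x := rfl
  rw [e]
  unfold kapDen
  split_ifs with h
  · exact const_mem_laurentFun 1
  have h1 (A : ℂ) : (fun x : ℂ => A * (x / D.q ^ k)) ∈ laurentFun :=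
    mul_mem (const_mem_laurentFun A) (D.div_pow_mem k)
  exact mul_mem (sub_mem (const_mem_laurentFun 1) (h1 _)) (sub_mem (const_mem_laurentFun 1) (h1 _))

variable (D) in
theorem tauX_mem : D.tauX ∈ laurentFun :=
  det_mem_laurentFun fun i s => mul_mem (D.phi_mem i s) (D.kap_mem i s)

variable (D) in
theorem coeffMat_det_mem (l : ℕ) : (fun x => (D.coeffMat l x).det) ∈ laurentFun := by
  refine det_mem_laurentFun fun i s => ?_
  refine Fin.lastCases ?_ (fun i => ?_) i
  · simp only [coeffMat, Matrix.of_apply, Fin.snoc_last]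
    exact const_mem_laurentFun _
  · simp only [coeffMat, Matrix.of_apply, Fin.snoc_castSucc]
    exact mul_mem (D.phi_mem i s) (D.kapNum_mem i s)

theorem tendsto_laurent {F : ℂ → ℂ} (hF : F ∈ laurentFun) (n : ℂ) :
    Tendsto (fun γ => F (D.qpow γ)) (𝓝[≠] n) (𝓝 (F (D.qpow n))) :=
  (ContinuousAt.comp' (laurentFun_continuousAt hF (D.qpow_ne n))
    D.continuous_qpow.continuousAt).tendsto.mono_left nhdsWithin_le_nhds

theorem tendsto_xi {i : Fin 4} (hi : D.xiConst i ≠ 0) {n l : ℕ} (hl : l ≤ n) :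
    Tendsto (fun γ => D.xi i (γ - l)) (𝓝[≠] (n : ℂ)) (𝓝 (D.xi i (n - l : ℕ))) := by
  have h := continuousAt_xi hi (n - l)
  rw [Nat.cast_sub hl] at h ⊢
  have h1 : Tendsto (fun γ : ℂ => γ - l) (𝓝[≠] (n : ℂ)) (𝓝 (n - l : ℂ)) :=
    ((continuous_id.sub continuous_const).tendsto' _ _ rfl).mono_left nhdsWithin_le_nhds
  exact h.tendsto.comp h1

/-- At the positive integers the denominators of the coefficients `Q^{(-l)}` do not vanish. -/
theorem Regular.kapDen_ne (H : D.Regular) {n : ℕ} (hn : 1 ≤ n) :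
    ∏ i, D.kapDen i (D.qpow n) ≠ 0 := by
  obtain ⟨v, -, hv⟩ := H.chi n
  have hD : (fun x => ∏ i, D.kapDen i x * D.ratioConst i) ∈ laurentFun := by
    have : (fun x => ∏ i, D.kapDen i x * D.ratioConst i) =
        ∏ i, D.kapDen i * fun _ => D.ratioConst i := by
      funext x; simp [Finset.prod_apply]
    rw [this]
    exact prod_mem fun i _ => mul_mem (D.kapDen_mem i) (const_mem_laurentFun _)
  have hN : (fun x => ∏ i, D.ratioNum i x) ∈ laurentFun := by
    have : (fun x => ∏ i, D.ratioNum i x) = ∏ i, D.ratioNum i := by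
      funext x; simp [Finset.prod_apply]
    rw [this]
    refine prod_mem fun i _ => ?_
    have e : D.ratioNum i = fun x => D.ratioNum i x := rfl
    rw [e]
    unfold ratioNum
    split_ifs with h
    · exact const_mem_laurentFun 1
    have h1 (A : ℂ) : (fun x : ℂ => A * (x / D.q)) ∈ laurentFun := by
      have := D.div_pow_mem 1
      rw [pow_one] at this
      exact mul_mem (const_mem_laurentFun A) this
    exact mul_mem (const_mem_laurentFun _) (mul_mem (sub_mem (const_mem_laurentFun 1) (h1 _))
      (sub_mem (const_mem_laurentFun 1) (h1 _)))
  have h1 := hv.mul (tendsto_laurent (D := D) hD n)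
  have h2 := (tendsto_xi H.const_zero (Nat.zero_le n)).mul (tendsto_laurent (D := D) hN n)
  simp only [Nat.cast_zero, sub_zero, Nat.sub_zero] at h2
  have hne : ∀ᶠ γ in 𝓝[≠] (n : ℂ), D.chi γ * D.xi 0 (γ - k - 1) / D.chi (γ - 1) ≠ 0 := by
    obtain ⟨w, hw, hw'⟩ := H.chi n
    exact hw'.eventually_ne hw
  have heq : ∀ᶠ γ in 𝓝[≠] (n : ℂ), D.chi γ * D.xi 0 (γ - k - 1) / D.chi (γ - 1) *
      (∏ i, D.kapDen i (D.qpow γ) * D.ratioConst i) =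
        D.xi 0 γ * ∏ i, D.ratioNum i (D.qpow γ) := by
    have hg : ∀ᶠ γ in 𝓝[≠] (n : ℂ), D.Good (γ - k - 4) := by
      simpa only [sub_sub] using eventually_good_sub_nhds (D := D) n (k + 4)
    filter_upwards [hg, hne] with γ hγ h
    have hd : D.chi (γ - 1) ≠ 0 := (div_ne_zero_iff.mp h).2
    rw [div_mul_eq_mul_div, chi_ratio hγ H.const_zero, mul_div_cancel_left₀ _ hd]
  have hlim := tendsto_nhds_unique (h1.congr' heq) h2
  intro h0
  rw [Finset.prod_mul_distrib, h0, zero_mul, mul_zero] at hlim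
  refine mul_ne_zero (xi_natCast_ne H.const_zero n) (Finset.prod_ne_zero_iff.mpr fun i _ => ?_) hlim.symm
  unfold ratioNum
  split_ifs with hi
  · exact one_ne_zero
  obtain ⟨m, rfl⟩ : ∃ m, n = m + 1 := ⟨n - 1, by omega⟩
  have e : D.qpow (m + 1 : ℕ) / D.q = (D.q : ℂ) ^ m := by
    rw [qpow_natCast, pow_succ, mul_div_cancel_right₀ _ D.q_ne]
  obtain ⟨p1, p2, p3, -, -⟩ := xiConst_pair H.const_zero e
  have p1 : 1 - D.b * D.c * _ ≠ 0 := one_sub_ne p1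
  have p2 : 1 - D.b * D.d * _ ≠ 0 := one_sub_ne p2
  have p3 : 1 - D.c * D.d * _ ≠ 0 := one_sub_ne p3
  refine mul_ne_zero D.a_ne_zero ?_
  generalize D.δ i = d at hi
  fin_cases d
  · exact absurd rfl hi
  · exact mul_ne_zero p1 p2
  · change (1 - D.c * D.b * _) * (1 - D.c * D.d * _) ≠ 0
    rw [mul_comm D.c D.b]
    exact mul_ne_zero p1 p3
  · change (1 - D.d * D.c * _) * (1 - D.d * D.b * _) ≠ 0
    rw [mul_comm D.d D.c, mul_comm D.d D.b]
    exact mul_ne_zero p3 p2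

/-- The leading coefficient `Q^{(0)}` in terms of `τ` and of the quotient of the values of `χ`. -/
theorem coeffQ_zero_eq {γ : ℂ} (hγ : D.Good (γ - 1 - k - 2)) (h0 : D.xiConst 0 ≠ 0)
    (hχ : D.chi (γ - 1) ≠ 0) :
    D.coeffQ 0 γ = (-1) ^ k * (D.tau (γ - 1) *
      (D.chi γ * D.xi 0 (γ - k - 1) / D.chi (γ - 1))) := by
  have hcas : casorati (Fin.snoc (α := fun _ => ℂ → ℂ) D.psi
      (fun γ' => if γ' = γ - (0 : ℕ) then 1 else 0)) γ = (-1) ^ k * casorati D.psi (γ - 1) := by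
    rw [casorati, Matrix.det_succ_row _ (Fin.last k), Finset.sum_eq_single 0]
    · simp only [Fin.val_last, Fin.val_zero, Matrix.of_apply, Fin.snoc_last, add_zero]
      rw [if_pos trivial, mul_one, casorati]
      congr 2
      ext i j
      simp only [Matrix.submatrix_apply, Matrix.of_apply, Fin.succAbove_last, Fin.snoc_castSucc,
        Fin.succAbove_zero, Fin.val_succ]
      congr 1
      push_cast
      ring
    · intro j _ hj
      have : (j : ℕ) ≠ 0 := fun h => hj (Fin.ext h)
      simp [this]
    · simp
  have htau : casorati (fun j γ' => D.xi 0 γ' * D.psi j γ') (γ - 1) =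
      (∏ s : Fin k, D.xi 0 (γ - 1 - (s : ℕ))) * casorati D.psi (γ - 1) := by
    rw [casorati, casorati, ← Matrix.det_mul_row]
    rfl
  have hp : (∏ i : Fin k, D.xi 0 (γ - 1 - (i : ℕ))) ≠ 0 :=
    Finset.prod_ne_zero_iff.mpr fun i _ => xi_ne_sub hγ h0 i.2.le
  have hk := xi_ne_sub hγ h0 le_rfl
  have ek : γ - k - 1 = γ - 1 - k := by ring
  rw [coeffQ, hcas, tau, htau, Fin.prod_univ_castSucc, Finset.prod_inv_distrib, ek]
  simp only [Fin.val_castSucc, Fin.val_last]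
  field_simp

/-- The leading coefficient `Q^{(0)}_n` of `p̂_n` is nonzero: this is where both assumptions enter. -/
theorem Regular.coeffQ_zero (H : D.Regular) (n : ℕ) : NonzeroAt (D.coeffQ 0) n := by
  obtain ⟨v, hv, hv'⟩ := H.tau (n - 1) (by omega)
  obtain ⟨w, hw, hw'⟩ := H.chi n
  refine ⟨(-1) ^ k * (v * w), by simp [hv, hw], ?_⟩
  have h : Tendsto (fun γ : ℂ => γ - 1) (𝓝[≠] (n : ℂ)) (𝓝[≠] ((n - 1 : ℤ) : ℂ)) := by
    refine tendsto_nhdsWithin_of_tendsto_nhds_of_eventually_within _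
      ((continuous_id.sub continuous_const).tendsto' _ _ (by simp) |>.mono_left nhdsWithin_le_nhds) ?_
    filter_upwards [self_mem_nhdsWithin] with γ hγ e
    refine hγ ?_
    have e' : γ - 1 = ((n - 1 : ℤ) : ℂ) := e
    push_cast at e'
    exact sub_left_injective e'
  refine (((hv'.comp h).mul hw').const_mul ((-1) ^ k)).congr' ?_
  have hg : ∀ᶠ γ in 𝓝[≠] (n : ℂ), D.Good (γ - 1 - k - 2) := by
    simpa only [sub_sub] using eventually_good_sub_nhds (D := D) n (1 + k + 2)
  filter_upwards [hg, hw'.eventually_ne hw] with γ hγ h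
  rw [coeffQ_zero_eq hγ H.const_zero (div_ne_zero_iff.mp h).2]
  rfl

/-- The coefficients `Q^{(-l)}` that occur in `p̂_n` have finite values at `n`. -/
theorem Regular.tendsto_coeffQ (H : D.Regular) {n l : ℕ} (hl : l ≤ n) :
    Tendsto (D.coeffQ l) (𝓝[≠] (n : ℂ)) (𝓝 (valueAt (D.coeffQ l) n)) := by
  suffices ∃ v, Tendsto (D.coeffQ l) (𝓝[≠] (n : ℂ)) (𝓝 v) by
    obtain ⟨v, hv⟩ := this
    rwa [valueAt, hv.limUnder_eq]
  rcases Nat.eq_zero_or_pos n with rfl | hn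
  · obtain rfl : l = 0 := by omega
    obtain ⟨v, -, hv⟩ := H.coeffQ_zero 0
    exact ⟨v, hv⟩
  have hden := H.kapDen_ne hn
  have hD : (fun x => ∏ i, D.kapDen i x) ∈ laurentFun := by
    have : (fun x => ∏ i, D.kapDen i x) = ∏ i, D.kapDen i := by
      funext x; simp [Finset.prod_apply]
    rw [this]
    exact prod_mem fun i _ => D.kapDen_mem i
  refine ⟨_, (((tendsto_xi H.const_zero hl).mul (tendsto_laurent (D := D) (D.coeffMat_det_mem l) n)).div
    (tendsto_laurent (D := D) hD n) hden).congr' ?_⟩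
  have hg : ∀ᶠ γ in 𝓝[≠] (n : ℂ), D.Good (γ - k - 2) := by
    simpa only [sub_sub] using eventually_good_sub_nhds (D := D) n (k + 2)
  filter_upwards [hg] with γ hγ
  have hne : ∏ i, D.kapDen i (D.qpow γ) ≠ 0 :=
    Finset.prod_ne_zero_iff.mpr fun i _ => Data.kapDen_ne hγ i
  rw [Pi.div_apply, ← coeffQ_eq hγ H.const l, mul_div_cancel_right₀ _ hne]

theorem Regular.degree_pHat (H : D.Regular) (n : ℕ) : (D.pHat n).degree = n := by
  have h0 : valueAt (D.coeffQ 0) n ≠ 0 := by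
    obtain ⟨v, hv, hv'⟩ := H.coeffQ_zero n
    rwa [valueAt, hv'.limUnder_eq]
  have hdeg (m : ℕ) : (D.awPoly m).degree = m := by
    rw [awPoly_eq]; exact degree_aw H.generic D.a_ne_zero m
  rw [pHat, Finset.sum_range_succ', if_pos (Nat.zero_le n), Nat.sub_zero]
  have h1 : (C (valueAt (D.coeffQ 0) n) * D.awPoly n).degree = n := by
    rw [degree_C_mul h0, hdeg]
  rw [add_comm, degree_add_eq_left_of_degree_lt, h1]
  rw [h1]
  refine lt_of_le_of_lt (degree_sum_le _ _) ?_
  refine (Finset.sup_lt_iff (WithBot.bot_lt_coe n)).mpr fun l _ => ?_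
  split_ifs with h
  · rw [C_mul']
    refine lt_of_le_of_lt (degree_smul_le _ _) ?_
    rw [hdeg]
    exact WithBot.coe_lt_coe.mpr (show n - (l + 1) < n by omega)
  · rw [degree_zero]
    exact WithBot.bot_lt_coe n

end Data

/-! ### The reflection symmetry -/

theorem laurentFun_inv {F : ℂ → ℂ} (hF : F ∈ laurentFun) (s : ℂ) :
    (fun x => F (s / x)) ∈ laurentFun := by
  induction hF using Algebra.adjoin_induction with
  | mem f hf =>
    rcases hf with rfl | rfl
    · exact mul_mem (const_mem_laurentFun s) inv_mem_laurentFun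
    · simp only [inv_div]
      exact mul_mem id_mem_laurentFun (const_mem_laurentFun s⁻¹)
  | algebraMap r => exact const_mem_laurentFun r
  | add f g _ _ hf hg => exact add_mem hf hg
  | mul f g _ _ hf hg => exact mul_mem hf hg

/-- The powers of `q` that arise in `kap_reflect` when the factors of the four shifted factorials are
reversed. -/
theorem reflect_aux {q Z x x' y₁ y₂ y₃ y₄ : ℂ} (hq : q ≠ 0) (hZ : Z ≠ 0) (hx : x ≠ 0) (hx' : x' ≠ 0)
    (s m : ℕ) (i : ℤ) (h₁ : y₁ * y₂ = x' * (Z / x) * (q ^ (2 * (m + 1)) / q ^ (s + m + 1)))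
    (h₂ : y₃ * y₄ = x' * (1 / (Z * x)) * (q ^ 2 / q ^ (s + m + 1))) :
    Z ^ (i - s) * (x' ^ (s + m))⁻¹ *
      ((∏ l ∈ Finset.range s, (-y₁ * q ^ l)) * (∏ l ∈ Finset.range s, (-y₂ * q ^ l))) *
      ((∏ l ∈ Finset.range m, (-y₃ * q ^ l)) * (∏ l ∈ Finset.range m, (-y₄ * q ^ l))) =
    Z ^ (i - m) * (x ^ (s + m))⁻¹ := by
  rw [prod_neg_mul_pow_sq, prod_neg_mul_pow_sq, prod_neg_mul_pow_sq, prod_neg_mul_pow_sq]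
  have hS := Finset.sum_range_id_mul_two s
  have hM := Finset.sum_range_id_mul_two m
  have hs : s * (s - 1) + s = s * s := by cases s <;> simp [Nat.mul_succ]
  have hm : m * (m - 1) + m = m * m := by cases m <;> simp [Nat.mul_succ]
  generalize ∑ l ∈ Finset.range s, l = S at *
  generalize ∑ l ∈ Finset.range m, l = M at *
  have e1 : (-y₁) ^ s * q ^ S * ((-y₂) ^ s * q ^ S) = (y₁ * y₂) ^ s * q ^ (S * 2) := by
    rw [mul_pow, neg_pow y₁, neg_pow y₂, pow_mul]
    have : ((-1 : ℂ) ^ s) * (-1) ^ s = 1 := by rw [← mul_pow]; simp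
    linear_combination (y₁ ^ s * y₂ ^ s * (q ^ S) ^ 2) * this
  have e2 : (-y₃) ^ m * q ^ M * ((-y₄) ^ m * q ^ M) = (y₃ * y₄) ^ m * q ^ (M * 2) := by
    rw [mul_pow, neg_pow y₃, neg_pow y₄, pow_mul]
    have : ((-1 : ℂ) ^ m) * (-1) ^ m = 1 := by rw [← mul_pow]; simp
    linear_combination (y₃ ^ m * y₄ ^ m * (q ^ M) ^ 2) * this
  have e3 : (q ^ (2 * (m + 1)) / q ^ (s + m + 1)) ^ s * (q ^ 2 / q ^ (s + m + 1)) ^ m *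
      (q ^ (S * 2) * q ^ (M * 2)) = 1 := by
    have hne : q ^ ((s + m + 1) * (s + m)) ≠ 0 := pow_ne_zero _ hq
    have e : (s + m + 1) * (s + m) = 2 * (m + 1) * s + 2 * m + (S * 2 + M * 2) := by
      rw [hS, hM]
      nlinarith
    rw [div_pow, div_pow, ← pow_mul, ← pow_mul, ← pow_mul, ← pow_mul, div_mul_div_comm,
      ← pow_add, ← pow_add, ← pow_add, ← mul_add, div_mul_eq_mul_div, ← pow_add, e]
    exact div_self (e ▸ hne)
  have e4 : Z ^ (i - s) * Z ^ s = Z ^ (i - m) * Z ^ m := by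
    rw [← zpow_natCast, ← zpow_natCast, ← zpow_add₀ hZ, ← zpow_add₀ hZ]
    congr 1; ring
  rw [e1, e2, h₁, h₂, mul_pow _ (q ^ (2 * (m + 1)) / q ^ (s + m + 1)),
    mul_pow _ (q ^ 2 / q ^ (s + m + 1))]
  generalize (q ^ (2 * (m + 1)) / q ^ (s + m + 1)) ^ s = p1 at *
  generalize (q ^ 2 / q ^ (s + m + 1)) ^ m = p2 at *
  generalize q ^ (S * 2) = p3 at *
  generalize q ^ (M * 2) = p4 at *
  generalize Z ^ (i - s) = z1 at *
  generalize Z ^ (i - m) = z2 at *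
  simp only [mul_pow, div_pow, one_pow, pow_add]
  have hZs := pow_ne_zero m hZ
  have hxs := pow_ne_zero s hx
  have hxm := pow_ne_zero m hx
  have hxs' := pow_ne_zero s hx'
  have hxm' := pow_ne_zero m hx'
  generalize Z ^ m = Zm at *
  generalize Z ^ s = Zs at *
  generalize x ^ s = xs at *
  generalize x ^ m = xm at *
  generalize x' ^ s = xs' at *
  generalize x' ^ m = xm' at *
  field_simp
  linear_combination z1 * Zs * e3 + e4

namespace Data
variable {k : ℕ} {D : Data k}

/-- The symmetry `x ↦ q^k/(abcd x)` of `λ` at the centre of the lattice `γ, γ - 1, …, γ - k + 1`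
reverses the order of the factors `kap`. -/
theorem kap_reflect (i : Fin k) {s m : ℕ} (h : s + m + 1 = k) {x : ℂ} (hx : x ≠ 0) :
    D.kap i s (D.q ^ k / (D.abcd * x)) = D.kap i m x := by
  unfold kap
  split_ifs with hi
  · rfl
  have hq := D.q_ne
  have ha := D.a_ne_zero
  have hB := D.par_ne (D.δ i)
  have hC := parC_ne (D := D) hi
  have hE := parE_ne (D := D) hi
  have ht := par_mul_parC (D := D) hi
  have ht0 := D.abcd_ne
  have hx' : (D.q : ℂ) ^ k / (D.abcd * x) ≠ 0 := div_ne_zero (pow_ne_zero _ hq) (mul_ne_zero ht0 hx)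
  set x' := (D.q : ℂ) ^ k / (D.abcd * x) with hx'e
  have ek : (D.q : ℂ) ^ k = D.q ^ s * D.q ^ m * D.q := by
    rw [← pow_add, ← pow_succ]
    exact congrArg (fun n => (D.q : ℂ) ^ n) h.symm
  have es : k - 1 - s = m := by omega
  have em : k - 1 - m = s := by omega
  have e1 : k - 1 = s + m := by omega
  have hqs := pow_ne_zero s hq
  have hqm := pow_ne_zero m hq
  rw [es, em, e1]
  have r1 := qPoch_reverse (y := D.par (D.δ i) * D.parC (D.δ i) * (x' / D.q ^ s))
    (w := D.a * D.parE (D.δ i) * (x * D.q / D.q ^ k)) s (by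
      rw [hx'e, ek, ← ht]; field_simp) hq
  have r2 := qPoch_reverse (y := D.par (D.δ i) * D.parE (D.δ i) * (x' / D.q ^ s))
    (w := D.a * D.parC (D.δ i) * (x * D.q / D.q ^ k)) s (by
      rw [hx'e, ek, ← ht]; field_simp) hq
  have r3 := qPoch_reverse (y := D.a * D.parC (D.δ i) * (x' * D.q / D.q ^ k))
    (w := D.par (D.δ i) * D.parE (D.δ i) * (x / D.q ^ m)) m (by
      rw [hx'e, ek, ← ht]; field_simp) hq
  have r4 := qPoch_reverse (y := D.a * D.parE (D.δ i) * (x' * D.q / D.q ^ k))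
    (w := D.par (D.δ i) * D.parC (D.δ i) * (x / D.q ^ m)) m (by
      rw [hx'e, ek, ← ht]; field_simp) hq
  rw [r1, r2, r3, r4]
  have key := reflect_aux hq (div_ne_zero hB ha) hx hx' s m i
    (y₁ := D.par (D.δ i) * D.parC (D.δ i) * (x' / D.q ^ s))
    (y₂ := D.par (D.δ i) * D.parE (D.δ i) * (x' / D.q ^ s))
    (y₃ := D.a * D.parC (D.δ i) * (x' * D.q / D.q ^ k))
    (y₄ := D.a * D.parE (D.δ i) * (x' * D.q / D.q ^ k))
    (by rw [hx'e, ek, ← ht, pow_succ _ (s + m), pow_add, mul_comm 2, pow_mul, pow_succ _ m]; field_simp)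
    (by rw [hx'e, ek, ← ht, pow_succ _ (s + m), pow_add]; field_simp)
  rw [← key]
  ring

/-- The sign of the order reversing permutation. -/
def revSign (k : ℕ) : ℂ := ((Equiv.Perm.sign (Fin.revPerm : Equiv.Perm (Fin k)) : ℤ) : ℂ)

theorem revSign_sq (k : ℕ) : revSign k * revSign k = 1 := by
  unfold revSign
  rw [← Int.cast_mul, Int.units_coe_mul_self, Int.cast_one]

theorem psiMat_reflect {x : ℂ} (hx : x ≠ 0) : D.psiMat (D.q ^ k / (D.abcd * x)) =
    (D.psiMat x).submatrix id (Fin.revPerm : Equiv.Perm (Fin k)) := by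
  have hq := D.q_ne
  ext i s
  simp only [psiMat, Matrix.of_apply, Matrix.submatrix_apply, id, Fin.revPerm_apply]
  have hs : (s : ℕ) + (Fin.rev s : ℕ) + 1 = k := by rw [Fin.val_rev]; omega
  have ek : (D.q : ℂ) ^ k = D.q ^ (s : ℕ) * D.q ^ (Fin.rev s : ℕ) * D.q := by
    rw [← pow_add, ← pow_succ, hs]
  rw [kap_reflect i hs hx, ← D.lamX_reflect (div_ne_zero hx (pow_ne_zero (Fin.rev s : ℕ) hq))]
  congr 3
  have h1 := pow_ne_zero (s : ℕ) hq
  have h2 := pow_ne_zero (Fin.rev s : ℕ) hq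
  have h3 := D.abcd_ne
  rw [ek]
  field_simp

theorem tauX_reflect {x : ℂ} (hx : x ≠ 0) :
    D.tauX (D.q ^ k / (D.abcd * x)) = revSign k * D.tauX x := by
  rw [tauX, psiMat_reflect hx, Matrix.det_permute']
  rfl

theorem adjugate_submatrix_rev (N : Matrix (Fin k) (Fin k) ℂ) (s j : Fin k) :
    (N.submatrix id (Fin.revPerm : Equiv.Perm (Fin k))).adjugate s j =
      revSign k * N.adjugate (Fin.rev s) j := by
  rw [Matrix.adjugate_apply, Matrix.adjugate_apply]
  have : (N.submatrix id (Fin.revPerm : Equiv.Perm (Fin k))).updateRow j (Pi.single s 1) =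
      (N.updateRow j (Pi.single (Fin.rev s) 1)).submatrix id (Fin.revPerm : Equiv.Perm (Fin k)) := by
    ext i s'
    rw [Matrix.submatrix_apply, Matrix.updateRow_apply, Matrix.updateRow_apply]
    simp [Pi.single_apply, Fin.rev_eq_iff]
  rw [this, Matrix.det_permute']
  rfl

variable (D) in
/-- The Laurent polynomial `h(λ_{γ-k/2})` of `x = q^γ`. -/
def halfShift (h : ℂ[X]) (x : ℂ) : ℂ := h.eval (D.lamX (x * D.qpow (-(k / 2))))

theorem halfShift_mem (h : ℂ[X]) : D.halfShift h ∈ laurentFun :=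
  laurentFun_scale (eval_comp_mem_laurentFun D.lamX_mem h) _

theorem eval_lam_sub (h : ℂ[X]) (γ : ℂ) :
    h.eval (D.lam (γ - k / 2)) = D.halfShift h (D.qpow γ) := by
  rw [halfShift, lam_eq, sub_eq_add_neg, qpow_add]

theorem halfShift_reflect (h : ℂ[X]) {x : ℂ} (hx : x ≠ 0) :
    D.halfShift h (D.q / (D.abcd * x)) = D.halfShift h (x * D.q ^ k) := by
  have hp : D.qpow (-(k / 2)) * D.qpow (-(k / 2)) * (D.q : ℂ) ^ k = 1 := by
    rw [← qpow_natCast, ← qpow_add, ← qpow_add]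
    have : -((k : ℂ) / 2) + -(k / 2) + k = (0 : ℕ) := by push_cast; ring
    rw [this, qpow_natCast, pow_zero]
  have h1 := D.q_ne
  have h2 := D.abcd_ne
  have h3 := D.qpow_ne (-(k / 2))
  have h4 := pow_ne_zero k h1
  rw [halfShift, halfShift, ← D.lamX_reflect (mul_ne_zero (mul_ne_zero hx h4) h3)]
  congr 2
  field_simp
  linear_combination hp

theorem Regular.exists_tauX_ne (H : D.Regular) : ∃ x ≠ 0, D.tauX x ≠ 0 := by
  obtain ⟨v, hv, hv'⟩ := H.tau 0 (by norm_num)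
  have hg : ∀ᶠ γ in 𝓝[≠] ((0 : ℤ) : ℂ), D.Good (γ - k - 2) := by
    simpa only [sub_sub] using eventually_good_sub_nhds (D := D) ((0 : ℤ) : ℂ) (k + 2)
  obtain ⟨γ, hγ, hne⟩ := (hg.and (hv'.eventually_ne hv)).exists
  rw [tau_eq hγ H.const] at hne
  exact ⟨_, D.qpow_ne γ, hne⟩

/-- The defining condition of `𝔄_n` as an identity of Laurent polynomials. -/
theorem Regular.exists_quotient (H : D.Regular) {h : ℂ[X]} (hh : h ∈ D.algN) :
    ∃ g ∈ laurentFun, ∀ x ≠ 0,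
      D.halfShift h (x * D.q) - D.halfShift h x = g (x * D.q) * D.tauX x := by
  obtain ⟨r, hr⟩ := hh
  obtain ⟨g, hg, hgr⟩ := D.laurentAt_mem r
  refine ⟨g, hg, fun x hx => ?_⟩
  have hq := D.q_ne
  refine D.laurentFun_eq (F := fun x => D.halfShift h (x * D.q) - D.halfShift h x)
    (G := fun x => g (x * D.q) * D.tauX x)
    (sub_mem (laurentFun_scale (halfShift_mem h) _) (halfShift_mem h))
    (mul_mem (laurentFun_scale hg _) D.tauX_mem) ?_ hx
  have h1 := (tendsto_add_atTop_nat 1).eventually hr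
  have h2 := D.eventually_good_sub (k + 2)
  filter_upwards [h1, h2] with n h1 h2
  have e1 : ((n + 1 : ℕ) : ℂ) - 1 = n := by push_cast; ring
  have e2 : ((n + 1 : ℕ) : ℂ) - k / 2 - 1 = n - k / 2 := by push_cast; ring
  rw [e1, e2, hgr, eval_lam_sub, eval_lam_sub, tau_eq (by rwa [sub_sub]) H.const, qpow_natCast,
    qpow_natCast, pow_succ] at h1
  exact h1

/-- Under the reflection `h(λ_{γ+1-k/2}) - h(λ_{γ-k/2})` changes its sign and `τ_γ` is multiplied by
`revSign k`; hence their quotient is multiplied by `-revSign k`. -/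
theorem Regular.quotient_reflect (H : D.Regular) {h : ℂ[X]} {g : ℂ → ℂ} (hg : g ∈ laurentFun)
    (hgt : ∀ x ≠ 0, D.halfShift h (x * D.q) - D.halfShift h x = g (x * D.q) * D.tauX x)
    {x : ℂ} (hx : x ≠ 0) :
    g (D.q ^ k / (D.abcd * x) * D.q) = -revSign k * g (x * D.q) := by
  have hq := D.q_ne
  have ht := D.abcd_ne
  have hqk := pow_ne_zero k hq
  have hmem : (fun x => g (D.q ^ k / (D.abcd * x) * D.q) + revSign k * g (x * D.q)) ∈ laurentFun := by
    have e : (fun x => g (D.q ^ k / (D.abcd * x) * D.q)) =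
        fun x => g ((D.q ^ k / D.abcd * D.q) / x) := by
      funext x
      congr 1
      rw [← div_div]; ring
    refine add_mem (a := fun x => g (D.q ^ k / (D.abcd * x) * D.q)) ?_
      (mul_mem (const_mem_laurentFun _) (laurentFun_scale hg _))
    rw [e]
    exact laurentFun_inv hg _
  have key := laurentFun_mul_eq_zero hmem D.tauX_mem (fun x hx => ?_) H.exists_tauX_ne hx
  · linear_combination key
  · have h1 := hgt x hx
    have hx' : (D.q : ℂ) ^ k / (D.abcd * x) ≠ 0 := div_ne_zero hqk (mul_ne_zero ht hx)
    have h2 := hgt _ hx'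
    have e1 : D.halfShift h ((D.q : ℂ) ^ k / (D.abcd * x)) = D.halfShift h (x * D.q) := by
      have := halfShift_reflect (D := D) h (div_ne_zero (mul_ne_zero hx hq) hqk)
      rw [div_mul_cancel₀ _ hqk] at this
      rw [← this]
      congr 1
      field_simp
    have e2 : D.halfShift h ((D.q : ℂ) ^ k / (D.abcd * x) * D.q) = D.halfShift h x := by
      have := halfShift_reflect (D := D) h (div_ne_zero hx hqk)
      rw [div_mul_cancel₀ _ hqk] at this
      rw [← this]
      congr 1
      field_simp
    rw [e1, e2, tauX_reflect hx] at h2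
    have := revSign_sq k
    linear_combination (-revSign k) * h2 - (revSign k) * h1 -
      g (D.q ^ k / (D.abcd * x) * D.q) * D.tauX x * this

variable (D) in
/-- The weight with which `p_m` enters the sum attached to the index `j`, up to the factor `ξ_m`. -/
def sumWeight (g : ℂ → ℂ) (j : Fin k) (x : ℂ) : ℂ :=
  ∑ s : Fin k, g (x * D.q ^ (s : ℕ) * D.q) * D.kap j s (x * D.q ^ (s : ℕ)) *
    (D.psiMat (x * D.q ^ (s : ℕ))).adjugate s j

theorem sumWeight_mem {g : ℂ → ℂ} (hg : g ∈ laurentFun) (j : Fin k) :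
    D.sumWeight g j ∈ laurentFun := by
  have : D.sumWeight g j = ∑ s : Fin k, fun x => g (x * D.q ^ (s : ℕ) * D.q) *
      D.kap j s (x * D.q ^ (s : ℕ)) * (D.psiMat (x * D.q ^ (s : ℕ))).adjugate s j := by
    funext x
    simp [sumWeight, Finset.sum_apply]
  rw [this]
  refine sum_mem fun s _ => mul_mem (mul_mem ?_ (laurentFun_scale (D.kap_mem j s) _)) ?_
  · simp only [mul_assoc]
    exact laurentFun_scale hg _
  · exact laurentFun_scale (F := fun x => (D.psiMat x).adjugate s j)
      (adjugate_mem_laurentFun (fun i s => mul_mem (D.phi_mem i s) (D.kap_mem i s)) s j) _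

/-- The weights are antisymmetric under the symmetry `q^γ ↦ q^{1-γ}/(abcd)` of `λ_γ`. -/
theorem Regular.sumWeight_reflect (H : D.Regular) {h : ℂ[X]} {g : ℂ → ℂ} (hg : g ∈ laurentFun)
    (hgt : ∀ x ≠ 0, D.halfShift h (x * D.q) - D.halfShift h x = g (x * D.q) * D.tauX x)
    (j : Fin k) {x : ℂ} (hx : x ≠ 0) :
    D.sumWeight g j (D.q / (D.abcd * x)) = -D.sumWeight g j x := by
  have hq := D.q_ne
  have ht := D.abcd_ne
  rw [sumWeight, sumWeight, ← Equiv.sum_comp (Fin.revPerm : Equiv.Perm (Fin k)),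
    ← Finset.sum_neg_distrib]
  refine Finset.sum_congr rfl fun s _ => ?_
  rw [Fin.revPerm_apply]
  have hs : (Fin.rev s : ℕ) + (s : ℕ) + 1 = k := by rw [Fin.val_rev]; omega
  have ek : (D.q : ℂ) ^ k = D.q ^ (Fin.rev s : ℕ) * D.q ^ (s : ℕ) * D.q := by
    rw [← pow_add, ← pow_succ, hs]
  have h1 := pow_ne_zero (s : ℕ) hq
  have hy : x * (D.q : ℂ) ^ (s : ℕ) ≠ 0 := mul_ne_zero hx h1
  have e : (D.q : ℂ) / (D.abcd * x) * D.q ^ (Fin.rev s : ℕ) =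
      D.q ^ k / (D.abcd * (x * D.q ^ (s : ℕ))) := by
    rw [ek]
    field_simp
  rw [e, H.quotient_reflect hg hgt hy, kap_reflect j hs hy, psiMat_reflect hy,
    adjugate_submatrix_rev, Fin.rev_rev]
  have := revSign_sq k
  linear_combination (-g (x * D.q ^ (s : ℕ) * D.q) * D.kap j s (x * D.q ^ (s : ℕ)) *
    (D.psiMat (x * D.q ^ (s : ℕ))).adjugate s j) * this

/-- The Laurent polynomials that describe the action of the operator attached to `h ∈ 𝔄_n`. By the
reflection symmetry they are polynomials in `λ_γ`, up to the weight, so that they can be realized by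
polynomials in the Askey-Wilson operator. -/
theorem Regular.exists_symmetric (H : D.Regular) {h : ℂ[X]} (hh : h ∈ D.algN) :
    ∃ (g : ℂ → ℂ) (P : ℂ[X]) (r : Fin k → ℂ[X]),
      (∀ x ≠ 0, D.halfShift h (x * D.q) - D.halfShift h x = g (x * D.q) * D.tauX x) ∧
      (∀ x ≠ 0, (D.halfShift h x + D.halfShift h (x * D.q ^ k)) / 2 = P.eval (D.lamX x)) ∧
      ∀ j, ∀ x ≠ 0, D.sumWeight g j x = weight D.q D.abcd x * (r j).eval (D.lamX x) := by
  obtain ⟨g, hg, hgt⟩ := H.exists_quotient hh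
  have hq := D.q_ne
  have ht := D.abcd_ne
  have hqk := pow_ne_zero k hq
  obtain ⟨P, hP⟩ := D.exists_eq_eval_lamX
    (F := fun x => 2⁻¹ * (D.halfShift h x + D.halfShift h (x * D.q ^ k)))
    (mul_mem (const_mem_laurentFun _) (add_mem (halfShift_mem h) (laurentFun_scale (halfShift_mem h) _)))
    (fun x hx => by
      have e1 := halfShift_reflect (D := D) h hx
      have e2 := halfShift_reflect (D := D) h (div_ne_zero hx hqk)
      rw [div_mul_cancel₀ _ hqk] at e2
      have e3 : (D.q : ℂ) / (D.abcd * (x / D.q ^ k)) = D.q / (D.abcd * x) * D.q ^ k := by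
        field_simp
      rw [e3] at e2
      rw [e1, e2, add_comm])
  choose r hr using fun j => D.exists_eq_weight_mul (sumWeight_mem hg j)
    (fun x hx => H.sumWeight_reflect hg hgt j hx)
  refine ⟨g, P, r, hgt, fun x hx => ?_, hr⟩
  rw [← hP x hx]
  ring

end Data

/-! ### The q-difference operators -/

section Lattice
variable {k : ℕ} {ψ : Fin k → ℤ → ℂ} {H : ℕ → ℂ} {a : ℕ → Fin k → Fin k → ℂ}

/-- The discrete integral of a sequence against the solutions of the adjoint equation: the
functions `a i s j` invert the Casorati matrices of `ψ` up to the factor `H (i + 1) - H i`. -/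
def latticeSum (a : ℕ → Fin k → Fin k → ℂ) (u : ℕ → ℂ) (j : Fin k) (m : ℕ) : ℂ :=
  ∑ i ∈ Finset.range m, ∑ s : Fin k, if (s : ℕ) ≤ i then a i s j * u (i - s) else 0

theorem latticeSum_eq (u : ℕ → ℂ) (j : Fin k) (m : ℕ) : latticeSum a u j m =
    ∑ m' ∈ Finset.range m, ∑ s : Fin k, if m' + s < m then a (m' + s) s j * u m' else 0 := by
  rw [latticeSum, Finset.sum_comm, Finset.sum_comm (s := Finset.range m)]
  refine Finset.sum_congr rfl fun s _ => ?_
  rw [← Finset.sum_filter, ← Finset.sum_filter]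
  refine Finset.sum_nbij' (fun i => i - s) (fun m' => m' + s) ?_ ?_ ?_ ?_ ?_
  · intro i hi
    simp only [Finset.mem_filter, Finset.mem_range] at hi ⊢
    omega
  · intro i hi
    simp only [Finset.mem_filter, Finset.mem_range] at hi ⊢
    omega
  · intro i hi
    simp only [Finset.mem_filter, Finset.mem_range] at hi
    omega
  · intro i hi
    omega
  · intro i hi
    simp only [Finset.mem_filter, Finset.mem_range] at hi
    rw [Nat.sub_add_cancel hi.2]

variable (ha : ∀ (i : ℕ) (s s' : Fin k), ∑ j, a i s j * ψ j (i - (s' : ℕ)) =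
  if s = s' then H (i + 1) - H i else 0)
include ha

/-- Summed against `ψ`, the partial sums of the terms `a i s j * u (i - s)` may be rearranged by the
index `i - s`: the terms with `i - s < m ≤ i` do not contribute, since `ψ j m` is orthogonal to
them. -/
theorem sum_mul_latticeSum (u : ℕ → ℂ) (m : ℕ) : ∑ j, ψ j m * latticeSum a u j m =
    ∑ j, ψ j m * ∑ m' ∈ Finset.range m, (∑ s : Fin k, a (m' + s) s j) * u m' := by
  simp only [latticeSum_eq, Finset.mul_sum, Finset.sum_mul]
  refine Finset.sum_comm.trans (Eq.trans ?_ Finset.sum_comm)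
  refine Finset.sum_congr rfl fun m' hm' => ?_
  refine Finset.sum_comm.trans (Eq.trans ?_ Finset.sum_comm)
  refine Finset.sum_congr rfl fun s _ => ?_
  have hm := Finset.mem_range.mp hm'
  split_ifs with h
  · rfl
  · have := ha (m' + s) s ⟨m' + s - m, by omega⟩
    rw [if_neg (by intro e; have := congrArg Fin.val e; simp only at this; omega)] at this
    have e : ((m' + s : ℕ) : ℤ) - ((⟨m' + s - m, by omega⟩ : Fin k) : ℕ) = m := by
      simp only
      omega
    rw [e] at this
    simp only [mul_zero, Finset.sum_const_zero]
    rw [← zero_mul (u m'), ← this, Finset.sum_mul]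
    exact Finset.sum_congr rfl fun j _ => by ring

theorem sum_mul_sum_diag (m : ℕ) : ∑ j, ψ j m * ∑ s : Fin k, a (m + s) s j = H (m + k) - H m := by
  simp only [Finset.mul_sum]
  rw [Finset.sum_comm]
  have h1 : ∀ s : Fin k, ∑ j, ψ j m * a (m + s) s j = H (m + s + 1) - H (m + s) := by
    intro s
    have := ha (m + s) s s
    rw [if_pos rfl] at this
    rw [← this]
    refine Finset.sum_congr rfl fun j _ => ?_
    have e : ((m + s : ℕ) : ℤ) - (s : ℕ) = m := by omega
    rw [e, mul_comm]
  rw [Finset.sum_congr rfl fun s _ => h1 s,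
    Fin.sum_univ_eq_sum_range (fun s => H (m + s + 1) - H (m + s)) k]
  exact Finset.sum_range_sub (fun s => H (m + s)) k

/-- Moving the end point of `latticeSum` by `d ≤ k` produces a multiple of the single value `u m`. -/
theorem sum_mul_latticeSum_sub (u : ℕ → ℂ) (m : ℕ) {d : ℕ} (hd : d ≤ k) :
    ∑ j, ψ j m * (latticeSum a u j (m + d) - latticeSum a u j m) = (H (m + d) - H m) * u m := by
  induction d with
  | zero => simp
  | succ d ih =>
    have h := ih (by omega)
    have e1 : ∀ j, latticeSum a u j (m + (d + 1)) = latticeSum a u j (m + d) +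
        ∑ s : Fin k, if (s : ℕ) ≤ m + d then a (m + d) s j * u (m + d - s) else 0 := by
      intro j
      rw [latticeSum, ← add_assoc, Finset.sum_range_succ]
      rfl
    have e2 : ∑ j, ψ j m * ∑ s : Fin k,
        (if (s : ℕ) ≤ m + d then a (m + d) s j * u (m + d - s) else 0) =
        (H (m + d + 1) - H (m + d)) * u m := by
      simp only [Finset.mul_sum]
      rw [Finset.sum_comm, Finset.sum_eq_single ⟨d, by omega⟩]
      · have := ha (m + d) ⟨d, by omega⟩ ⟨d, by omega⟩
        rw [if_pos rfl] at this
        rw [← this, Finset.sum_mul]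
        refine Finset.sum_congr rfl fun j _ => ?_
        have e : ((m + d : ℕ) : ℤ) - (d : ℕ) = m := by omega
        simp only [e]
        rw [if_pos (by omega), Nat.add_sub_cancel]
        ring
      · intro s _ hs
        have := ha (m + d) s ⟨d, by omega⟩
        rw [if_neg hs] at this
        split_ifs with h
        · rw [← zero_mul (u (m + d - s)), ← this, Finset.sum_mul]
          refine Finset.sum_congr rfl fun j _ => ?_
          have e : ((m + d : ℕ) : ℤ) - (d : ℕ) = m := by omega
          simp only [e]
          ring
        · simp
      · simp
    have e3 : ∑ j, ψ j m * (latticeSum a u j (m + (d + 1)) - latticeSum a u j m) =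
        ∑ j, ψ j m * (latticeSum a u j (m + d) - latticeSum a u j m) + ∑ j, ψ j m * ∑ s : Fin k,
        (if (s : ℕ) ≤ m + d then a (m + d) s j * u (m + d - s) else 0) := by
      rw [← Finset.sum_add_distrib]
      refine Finset.sum_congr rfl fun j _ => ?_
      rw [e1]
      ring
    rw [e3, e2, h, ← add_assoc]
    ring

/-- At a negative index `n - l` the functions `ψ` are orthogonal to `latticeSum` at `n`. Therefore the
absence of `p_{n-l}` for `l > n` does no harm. -/
theorem sum_mul_latticeSum_neg (u : ℕ → ℂ) {n l : ℕ} (hn : n < l) (hl : l ≤ k) :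
    ∑ j, ψ j (n - l) * latticeSum a u j n = 0 := by
  simp only [latticeSum, Finset.mul_sum]
  rw [Finset.sum_comm]
  refine Finset.sum_eq_zero fun i hi => ?_
  have hi := Finset.mem_range.mp hi
  rw [Finset.sum_comm]
  refine Finset.sum_eq_zero fun s _ => ?_
  split_ifs with h
  · have := ha i s ⟨i + l - n, by omega⟩
    rw [if_neg (by intro e; have := congrArg Fin.val e; simp only at this; omega)] at this
    have e : (i : ℤ) - ((⟨i + l - n, by omega⟩ : Fin k) : ℕ) = n - l := by
      simp only
      omega
    rw [e] at this
    rw [← zero_mul (u (i - s)), ← this, Finset.sum_mul]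
    exact Finset.sum_congr rfl fun j _ => by ring
  · simp

/-- The lattice form of the bispectral identity: if the sequence `c` annihilates all the `ψ`, then
it intertwines the trapezoidal summation operator with multiplication by `H n`. -/
theorem sum_mul_trapezoid_eq_zero (u : ℕ → ℂ) (c : ℕ → ℂ) (n : ℕ)
    (hc : ∀ j, ∑ l ∈ Finset.range (k + 1), c l * ψ j (n - l) = 0) :
    ∑ l ∈ Finset.range (k + 1), (if l ≤ n then
      c l * ((H (n - l) + H (n - l + k)) / 2 * u (n - l) - (∑ j, ψ j (n - l : ℕ) *
        (∑ m ∈ Finset.range (n - l), (∑ s : Fin k, a (m + s) s j) * u m +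
          (∑ s : Fin k, a (n - l + s) s j) * u (n - l) / 2)) - H n * u (n - l)) else 0) = 0 := by
  have h1 : ∀ l ∈ Finset.range (k + 1), (if l ≤ n then
      c l * ((H (n - l) + H (n - l + k)) / 2 * u (n - l) - (∑ j, ψ j (n - l : ℕ) *
        (∑ m ∈ Finset.range (n - l), (∑ s : Fin k, a (m + s) s j) * u m +
          (∑ s : Fin k, a (n - l + s) s j) * u (n - l) / 2)) - H n * u (n - l)) else 0) =
      -∑ j, c l * ψ j (n - l) * latticeSum a u j n := by
    intro l hl
    have hl' : l ≤ k := by have := Finset.mem_range.mp hl; omega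
    simp only [mul_assoc]
    rw [← Finset.mul_sum]
    split_ifs with h
    · have e : (n : ℤ) - l = (n - l : ℕ) := by omega
      have s1 := sum_mul_latticeSum ha u (n - l)
      have s2 := sum_mul_sum_diag ha (n - l)
      have s3 := sum_mul_latticeSum_sub ha u (n - l) hl'
      rw [Nat.sub_add_cancel h] at s3
      rw [e]
      simp only [mul_sub, mul_add, Finset.sum_sub_distrib, Finset.sum_add_distrib] at s3 ⊢
      have s4 : ∑ j, ψ j (n - l : ℕ) * ((∑ s : Fin k, a (n - l + s) s j) * u (n - l) / 2) =
          (H (n - l + k) - H (n - l)) * u (n - l) / 2 := by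
        rw [← s2, Finset.sum_mul, Finset.sum_div]
        exact Finset.sum_congr rfl fun j _ => by ring
      rw [s4]
      linear_combination c l * s3 + c l * s1
    · rw [sum_mul_latticeSum_neg ha u (by omega) hl', mul_zero, neg_zero]
  rw [Finset.sum_congr rfl h1, Finset.sum_neg_distrib, Finset.sum_comm]
  simp only [← Finset.sum_mul, hc]
  simp

end Lattice

namespace Data
variable {k : ℕ} {D : Data k}

/-- The operator with the coefficients `Q^{(-l)}` annihilates the functions `ψ^(j)`. -/
theorem sum_coeffQ_mul_psi (γ : ℂ) (j : Fin k) :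
    ∑ l ∈ Finset.range (k + 1), D.coeffQ l γ * D.psi j (γ - l) = 0 := by
  set M : Matrix (Fin (k + 1)) (Fin (k + 1)) ℂ := Matrix.of fun i j =>
    (Fin.snoc (α := fun _ => ℂ → ℂ) D.psi 0) i (γ - (j : ℕ)) with hM
  have h1 : ∀ l : Fin (k + 1), D.coeffQ l γ = D.chi γ * M.adjugate l (Fin.last k) := by
    intro l
    rw [coeffQ, casorati, Matrix.adjugate_apply]
    congr 2
    ext i s
    refine Fin.lastCases ?_ (fun i => ?_) i
    · rw [Matrix.updateRow_self, Matrix.of_apply, Fin.snoc_last, Pi.single_apply]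
      simp only [sub_right_inj, Nat.cast_inj, Fin.ext_iff]
    · rw [Matrix.updateRow_ne (Fin.castSucc_lt_last i).ne]
      simp [hM]
  rw [← Fin.sum_univ_eq_sum_range (fun l => D.coeffQ l γ * D.psi j (γ - l)) (k + 1)]
  have h2 := congrFun (congrFun (Matrix.mul_adjugate M) j.castSucc) (Fin.last k)
  rw [Matrix.mul_apply, Matrix.smul_apply, Matrix.one_apply_ne (Fin.castSucc_lt_last j).ne,
    smul_zero] at h2
  rw [← mul_zero (D.chi γ), ← h2, Finset.mul_sum]
  refine Finset.sum_congr rfl fun l _ => ?_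
  rw [h1, hM, Matrix.of_apply, Fin.snoc_castSucc]
  ring

theorem Regular.xi_natCast_rec (H : D.Regular) {i : Fin 4} (n : ℕ) :
    D.xi i (n + 1 : ℕ) * (D.par i * (1 - (D.q : ℂ) ^ (n + 1)) *
      (1 - D.par (i + 1) * D.par (i + 2) * D.q ^ n) *
      (1 - D.par (i + 1) * D.par (i + 3) * D.q ^ n) *
      (1 - D.par (i + 2) * D.par (i + 3) * D.q ^ n)) =
        D.xi i n * (D.q - D.abcd * D.q ^ n) := by
  have hq := D.q_ne
  have hy : 1 - D.abcd * D.qpow n / D.q ≠ 0 := by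
    have := H.generic.t_sub n
    rw [qpow_natCast]
    intro h
    apply this
    field_simp at h
    rwa [mul_zero] at h
  have h := D.xi_step i hy
  rw [qpow_natCast] at h
  have e : (D.q : ℂ) * (1 - D.abcd * D.q ^ n / D.q) = D.q - D.abcd * D.q ^ n := by
    field_simp
  rw [e] at h
  push_cast
  rw [pow_succ]
  linear_combination h

/-- The Casorati matrices of `ψ` on a lattice `β + ℤ` and their inverses in terms of Laurent
polynomials. -/
theorem sum_psi_mul_adjugate (hc : ∀ i, D.Occurs i → D.xiConst i ≠ 0) {γ : ℂ}
    (hγ : D.Good (γ - k - 2)) (y : ℂ) (s s' : Fin k) :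
    ∑ j, y * D.xi (D.δ j) (γ - (s : ℕ)) * D.kap j s (D.qpow γ) *
      (D.psiMat (D.qpow γ)).adjugate s j * D.psi j (γ - (s' : ℕ)) =
        if s = s' then y * D.tauX (D.qpow γ) else 0 := by
  have h0 := hc 0 (Or.inl rfl)
  have hδ (i : Fin k) := hc (D.δ i) (Or.inr ⟨i, rfl⟩)
  have h2 := congrFun (congrFun (Matrix.adjugate_mul (D.psiMat (D.qpow γ))) s) s'
  rw [Matrix.mul_apply, Matrix.smul_apply, Matrix.one_apply] at h2
  have x1 := xi_ne_sub hγ h0 s'.2.le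
  have e : ∀ j, y * D.xi (D.δ j) (γ - (s : ℕ)) * D.kap j s (D.qpow γ) *
      (D.psiMat (D.qpow γ)).adjugate s j * D.psi j (γ - (s' : ℕ)) =
      y * D.xi 0 (γ - (s : ℕ)) / D.xi 0 (γ - (s' : ℕ)) *
        ((D.psiMat (D.qpow γ)).adjugate s j * D.psiMat (D.qpow γ) j s') := by
    intro j
    have x2 := xi_ne_sub hγ (hδ j) s'.2.le
    have h := xi_mul_kap hγ j s.2 s'.2 h0
    generalize (D.psiMat (D.qpow γ)).adjugate s j = A
    rw [psi, psiMat, Matrix.of_apply, lam_sub_nat]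
    field_simp
    linear_combination (y * A * (D.φ j).eval (D.lamX (D.qpow γ / D.q ^ (s' : ℕ)))) * h
  rw [Finset.sum_congr rfl fun j _ => e j, ← Finset.mul_sum, h2]
  split_ifs with h
  · subst h
    rw [smul_eq_mul, mul_one, mul_div_cancel_right₀ _ x1]
    rfl
  · simp

/-- The identity of which the limit `β → 0` says that the `q`-difference operator attached to
`h ∈ 𝔄_n` acts on `p̂_n` by multiplication by `h(λ_{n-k/2})`. -/
theorem lattice_identity (hc : ∀ i, D.Occurs i → D.xiConst i ≠ 0) {β : ℂ}
    (hβ : D.Good (β - k - 2)) {h : ℂ[X]} {g : ℂ → ℂ} {P : ℂ[X]} {r : Fin k → ℂ[X]}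
    (hg : ∀ x ≠ 0, D.halfShift h (x * D.q) - D.halfShift h x = g (x * D.q) * D.tauX x)
    (hP : ∀ x ≠ 0, (D.halfShift h x + D.halfShift h (x * D.q ^ k)) / 2 = P.eval (D.lamX x))
    (hr : ∀ j, ∀ x ≠ 0, D.sumWeight g j x = weight D.q D.abcd x * (r j).eval (D.lamX x))
    (u : ℕ → ℂ) (n : ℕ) :
    ∑ l ∈ Finset.range (k + 1), (if l ≤ n then D.coeffQ l (β + n) *
      (P.eval (D.lamX (D.qpow (β + (n - l : ℕ)))) * u (n - l) - (∑ j, D.psi j (β + (n - l : ℕ)) *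
        (∑ m ∈ Finset.range (n - l), D.xi (D.δ j) (β + m) * (weight D.q D.abcd (D.qpow (β + m)) *
            (r j).eval (D.lamX (D.qpow (β + m)))) * u m +
          D.xi (D.δ j) (β + (n - l : ℕ)) * (weight D.q D.abcd (D.qpow (β + (n - l : ℕ))) *
            (r j).eval (D.lamX (D.qpow (β + (n - l : ℕ))))) * u (n - l) / 2)) -
        D.halfShift h (D.qpow (β + n)) * u (n - l)) else 0) = 0 := by
  set a : ℕ → Fin k → Fin k → ℂ := fun i s j => g (D.qpow (β + i) * D.q) *
    D.xi (D.δ j) (β + i - (s : ℕ)) * D.kap j s (D.qpow (β + i)) *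
      (D.psiMat (D.qpow (β + i))).adjugate s j with ha_def
  have hx (m s : ℕ) : D.qpow (β + (m + s : ℕ)) = D.qpow (β + m) * D.q ^ s := by
    rw [Nat.cast_add, ← add_assoc, qpow_add, qpow_natCast]
  have ha : ∀ (i : ℕ) (s s' : Fin k), ∑ j, a i s j *
      (fun j (m : ℤ) => D.psi j (β + m)) j (i - (s' : ℕ)) =
      if s = s' then D.halfShift h (D.qpow (β + (i + 1 : ℕ))) - D.halfShift h (D.qpow (β + i))
        else 0 := by
    intro i s s'
    rw [hx, pow_one, hg _ (D.qpow_ne _), ← sum_psi_mul_adjugate hc (γ := β + i)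
      (hβ.of_add i (by ring))]
    refine Finset.sum_congr rfl fun j _ => ?_
    dsimp only
    congr 2
    push_cast
    ring
  have hE : ∀ (m : ℕ) (j : Fin k), ∑ s : Fin k, a (m + s) s j = D.xi (D.δ j) (β + m) *
      (weight D.q D.abcd (D.qpow (β + m)) * (r j).eval (D.lamX (D.qpow (β + m)))) := by
    intro m j
    rw [← hr j _ (D.qpow_ne _), sumWeight, Finset.mul_sum]
    refine Finset.sum_congr rfl fun s _ => ?_
    simp only [ha_def]
    rw [hx, Nat.cast_add, ← add_assoc, add_sub_cancel_right]
    ring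
  have key := sum_mul_trapezoid_eq_zero (ψ := fun j (m : ℤ) => D.psi j (β + m))
    (H := fun m => D.halfShift h (D.qpow (β + m))) ha u (fun l => D.coeffQ l (β + n)) n
    (fun j => by
      rw [← sum_coeffQ_mul_psi (D := D) (β + n) j]
      refine Finset.sum_congr rfl fun l _ => ?_
      congr 2
      push_cast
      ring)
  refine Eq.trans (Finset.sum_congr rfl fun l _ => ?_) key
  split_ifs with hl
  · simp only [hE]
    rw [hx (n - l) k, hP _ (D.qpow_ne _)]
    simp only [Int.cast_natCast]
  · rfl

/-- Every `h ∈ 𝔄_n` is realized by a `q`-difference operator in `z`. The operator is assembled from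
the Askey-Wilson operator and the trapezoidal sums; its action on `p̂_n` is the limit `β → 0` of
the lattice identity, since the coefficients of `p̂_n` are values of meromorphic functions. -/
theorem Regular.exists_qDiff (H : D.Regular) {h : ℂ[X]} (hh : h ∈ D.algN) :
    ∃ T ∈ qDiff D.qU, ∀ n : ℕ, T (D.pHatZ n) = h.eval (D.lam (n - k / 2)) • D.pHatZ n := by
  obtain ⟨g, P, r, hg, hP, hr⟩ := H.exists_symmetric hh
  obtain ⟨T, hT, hTe⟩ := D.exists_qDiff_action H.generic (fun i n => D.xi i n)
    (fun j n => xi_natCast_ne (H.const_row j) n) (fun j n => H.xi_natCast_rec n) P r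
  refine ⟨T, hT, fun n => ?_⟩
  rw [← sub_eq_zero, ← Module.forall_dual_apply_eq_zero_iff ℂ]
  intro f
  set u : ℕ → ℂ := fun m => f (zEval (D.awPoly m)) with hu
  have hpz : D.pHatZ n = ∑ l ∈ Finset.range (k + 1), if l ≤ n then
      valueAt (D.coeffQ l) n • zEval (D.awPoly (n - l)) else 0 := by
    change zEval (D.pHat n) = _
    rw [pHat, map_sum]
    refine Finset.sum_congr rfl fun l _ => ?_
    split_ifs
    · rw [C_mul', map_smul]
    · exact map_zero _
  have hsh : Tendsto (fun β : ℂ => β + n) (𝓝[≠] 0) (𝓝[≠] (n : ℂ)) := by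
    refine tendsto_nhdsWithin_of_tendsto_nhds_of_eventually_within _
      ((continuous_id.add continuous_const).tendsto' _ _ (by simp) |>.mono_left nhdsWithin_le_nhds) ?_
    filter_upwards [self_mem_nhdsWithin] with β hβ e
    refine hβ ?_
    have e' : β + n = (n : ℂ) := e
    simpa using e'
  have hsh' (m : ℕ) : Tendsto (fun β : ℂ => β + m) (𝓝[≠] 0) (𝓝 (m : ℂ)) :=
    (continuous_id.add continuous_const).tendsto' _ _ (by simp) |>.mono_left nhdsWithin_le_nhds
  have hL {F : ℂ → ℂ} (hF : F ∈ laurentFun) (m : ℕ) :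
      Tendsto (fun β => F (D.qpow (β + m))) (𝓝[≠] 0) (𝓝 (F ((D.q : ℂ) ^ m))) := by
    have := (ContinuousAt.comp' (laurentFun_continuousAt hF (D.qpow_ne m))
      D.continuous_qpow.continuousAt).tendsto.comp (hsh' m)
    rw [qpow_natCast] at this
    exact this
  have hxi (j : Fin k) (m : ℕ) :
      Tendsto (fun β => D.xi (D.δ j) (β + m)) (𝓝[≠] 0) (𝓝 (D.xi (D.δ j) m)) :=
    (continuousAt_xi (H.const_row j) m).tendsto.comp (hsh' m)
  have hpsi (j : Fin k) (m : ℕ) : Tendsto (fun β => D.psi j (β + m)) (𝓝[≠] 0)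
      (𝓝 ((D.φ j).eval (D.lamX ((D.q : ℂ) ^ m)) / D.xi (D.δ j) m)) := by
    unfold psi
    simp only [lam_eq]
    exact (hL (eval_comp_mem_laurentFun D.lamX_mem (D.φ j)) m).div (hxi j m)
      (xi_natCast_ne (H.const_row j) m)
  have hw : weight D.q D.abcd ∈ laurentFun := by
    have e : weight D.q D.abcd = (fun x => x⁻¹) - (fun _ => D.abcd / D.q) * fun x => x := by
      funext x
      simp only [weight, Pi.sub_apply, Pi.mul_apply]
      ring
    rw [e]
    exact sub_mem inv_mem_laurentFun (mul_mem (const_mem_laurentFun _) id_mem_laurentFun)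
  have hwr (j : Fin k) (m : ℕ) := (hxi j m).mul ((hL hw m).mul
    (hL (eval_comp_mem_laurentFun D.lamX_mem (r j)) m))
  have hlim : Tendsto (fun β => ∑ l ∈ Finset.range (k + 1), (if l ≤ n then D.coeffQ l (β + n) *
      (P.eval (D.lamX (D.qpow (β + (n - l : ℕ)))) * u (n - l) - (∑ j, D.psi j (β + (n - l : ℕ)) *
        (∑ m ∈ Finset.range (n - l), D.xi (D.δ j) (β + m) * (weight D.q D.abcd (D.qpow (β + m)) *
            (r j).eval (D.lamX (D.qpow (β + m)))) * u m +
          D.xi (D.δ j) (β + (n - l : ℕ)) * (weight D.q D.abcd (D.qpow (β + (n - l : ℕ))) *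
            (r j).eval (D.lamX (D.qpow (β + (n - l : ℕ))))) * u (n - l) / 2)) -
        D.halfShift h (D.qpow (β + n)) * u (n - l)) else 0)) (𝓝[≠] 0)
      (𝓝 (∑ l ∈ Finset.range (k + 1), (if l ≤ n then valueAt (D.coeffQ l) n *
      (P.eval (D.lamX ((D.q : ℂ) ^ (n - l))) * u (n - l) - (∑ j, (D.φ j).eval (D.lamX
        ((D.q : ℂ) ^ (n - l))) / D.xi (D.δ j) (n - l : ℕ) *
        (∑ m ∈ Finset.range (n - l), D.xi (D.δ j) m * (weight D.q D.abcd ((D.q : ℂ) ^ m) *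
            (r j).eval (D.lamX ((D.q : ℂ) ^ m))) * u m +
          D.xi (D.δ j) (n - l : ℕ) * (weight D.q D.abcd ((D.q : ℂ) ^ (n - l)) *
            (r j).eval (D.lamX ((D.q : ℂ) ^ (n - l)))) * u (n - l) / 2)) -
        D.halfShift h ((D.q : ℂ) ^ n) * u (n - l)) else 0))) := by
    refine tendsto_finsetSum _ fun l _ => ?_
    split_ifs with hl
    · refine ((H.tendsto_coeffQ hl).comp hsh).mul (((((hL (eval_comp_mem_laurentFun D.lamX_mem P)
        (n - l)).mul_const _).sub (tendsto_finsetSum _ fun j _ => (hpsi j _).mul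
          ((tendsto_finsetSum _ fun m _ => (hwr j m).mul_const _).add
            (((hwr j _).mul_const _).div_const _)))).sub ((hL (halfShift_mem h) n).mul_const _)))
    · exact tendsto_const_nhds
  have hg0 : ∀ᶠ β in 𝓝[≠] (0 : ℂ), D.Good (β - k - 2) := by
    simpa only [sub_sub] using eventually_good_sub_nhds (D := D) 0 (k + 2)
  have hzero := tendsto_nhds_unique (hlim.congr' (hg0.mono fun β hβ =>
    lattice_identity H.const hβ hg hP hr u n)) tendsto_const_nhds
  rw [← hzero, hpz, eval_lam_sub, qpow_natCast, map_sum, Finset.smul_sum, ← Finset.sum_sub_distrib,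
    map_sum]
  refine Finset.sum_congr rfl fun l _ => ?_
  split_ifs with hl
  · rw [map_smul, hTe, smul_comm, ← smul_sub, map_smul, map_sub, map_sub, map_smul, map_smul,
      map_sum, smul_eq_mul]
    congr 3
    refine Finset.sum_congr rfl fun j _ => ?_
    simp only [map_smul, map_add, map_sum, smul_eq_mul]
    have hx := xi_natCast_ne (H.const_row j) (n - l)
    have hs : ∑ m ∈ Finset.range (n - l), D.xi (D.δ j) m * (weight D.q D.abcd ((D.q : ℂ) ^ m) *
        (r j).eval (D.lamX ((D.q : ℂ) ^ m))) * u m = ∑ m ∈ Finset.range (n - l),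
        weight D.q D.abcd ((D.q : ℂ) ^ m) * D.xi (D.δ j) m * (r j).eval (D.lamX ((D.q : ℂ) ^ m)) *
          f (zEval (D.awPoly m)) :=
      Finset.sum_congr rfl fun m _ => by simp only [hu]; ring
    rw [hs]
    simp only [hu]
    field_simp
    ring
  · simp

end Data

/-! ### Transfer between lattices -/

section Germs
variable {q : ℂ}

theorem tendsto_mul_pow_punctured (hq0 : q ≠ 0) (hq : ‖q‖ < 1) {y : ℂ} (hy : y ≠ 0) :
    Tendsto (fun n : ℕ => y * q ^ n) atTop (𝓝[≠] 0) := by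
  refine tendsto_nhdsWithin_of_tendsto_nhds_of_eventually_within _ ?_
    (Eventually.of_forall fun n => mul_ne_zero hy (pow_ne_zero n hq0))
  simpa using (tendsto_pow_atTop_nhds_zero_of_norm_lt_one hq).const_mul y

theorem meromorphicAt_scale {F : ℂ → ℂ} (hF : MeromorphicAt F 0) :
    MeromorphicAt (fun x => F (x * q)) 0 := by
  have h : AnalyticAt ℂ (fun x : ℂ => x * q) 0 := by fun_prop
  refine MeromorphicAt.comp_analyticAt (f := F) (g := fun x => x * q) ?_ h
  simpa using hF

/-- A meromorphic germ with `B F(q x) = F(x)` vanishes, unless `B` is a power of `q`. -/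
theorem eventually_eq_zero_of_scale (hq0 : q ≠ 0) {B : ℂ} {F : ℂ → ℂ} (hF : MeromorphicAt F 0)
    (hB : ∀ m : ℤ, B * q ^ m ≠ 1) (h : ∀ᶠ x in 𝓝[≠] (0 : ℂ), B * F (x * q) = F x) :
    ∀ᶠ x in 𝓝[≠] (0 : ℂ), F x = 0 := by
  by_contra hne
  rw [← meromorphicOrderAt_eq_top_iff, ← ne_eq, meromorphicOrderAt_ne_top_iff hF] at hne
  obtain ⟨g, hg, hg0, hFg⟩ := hne
  set m := (meromorphicOrderAt F 0).untop₀
  have hsc : Tendsto (fun x : ℂ => x * q) (𝓝[≠] 0) (𝓝[≠] 0) := by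
    refine tendsto_nhdsWithin_of_tendsto_nhds_of_eventually_within _ ?_ ?_
    · exact ((continuous_id.mul continuous_const).tendsto' _ _ (by simp)).mono_left nhdsWithin_le_nhds
    · filter_upwards [self_mem_nhdsWithin] with x hx
      exact mul_ne_zero hx hq0
  have h1 : ∀ᶠ x in 𝓝[≠] (0 : ℂ), B * q ^ m * g (x * q) = g x := by
    filter_upwards [h, hFg, hsc.eventually hFg, self_mem_nhdsWithin] with x h1 h2 h3 hx
    have hx : x ≠ 0 := hx
    rw [h2, h3, sub_zero, sub_zero, smul_eq_mul, smul_eq_mul, mul_zpow] at h1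
    have := zpow_ne_zero m hx
    refine mul_left_cancel₀ this ?_
    linear_combination h1
  have hgc : Tendsto g (𝓝[≠] 0) (𝓝 (g 0)) := hg.continuousAt.tendsto.mono_left nhdsWithin_le_nhds
  have h2 := tendsto_nhds_unique (((hgc.comp (hsc.mono_right le_rfl)).const_mul (B * q ^ m)).congr' h1)
    hgc
  exact hB m (mul_right_cancel₀ hg0 (h2.trans (one_mul _).symm))

/-- Exponential sums with meromorphic coefficients in `q^n`: if no quotient of two of the bases is
a power of `q`, then the terms are independent. -/
theorem eventually_eq_zero_of_sum (hq0 : q ≠ 0) (hq : ‖q‖ < 1) {ι : Type*} [DecidableEq ι]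
    (S : Finset ι) {y : ℂ} (hy : y ≠ 0) (A : ι → ℂ) (F : ι → ℂ → ℂ) (hA : ∀ i ∈ S, A i ≠ 0)
    (hAA : ∀ i ∈ S, ∀ j ∈ S, i ≠ j → ∀ m : ℤ, A i * q ^ m ≠ A j) (hF : ∀ i ∈ S, MeromorphicAt (F i) 0)
    (h : ∀ᶠ n : ℕ in atTop, ∑ i ∈ S, A i ^ n * F i (y * q ^ n) = 0) :
    ∀ i ∈ S, ∀ᶠ x in 𝓝[≠] (0 : ℂ), F i x = 0 := by
  induction S using Finset.induction generalizing A F with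
  | empty => simp
  | insert s S hs ih =>
    have ht := tendsto_mul_pow_punctured hq0 hq hy
    have hsS {i : ι} (hi : i ∈ S) : i ∈ insert s S := Finset.mem_insert_of_mem hi
    have hss : s ∈ insert s S := Finset.mem_insert_self s S
    by_cases h0 : ∀ᶠ x in 𝓝[≠] (0 : ℂ), F s x = 0
    · have := ih A F (fun i hi => hA i (hsS hi)) (fun i hi j hj => hAA i (hsS hi) j (hsS hj))
        (fun i hi => hF i (hsS hi)) (by
          filter_upwards [h, ht.eventually h0] with n h1 h2
          rw [Finset.sum_insert hs, h2, mul_zero, zero_add] at h1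
          exact h1)
      intro i hi
      rcases Finset.mem_insert.mp hi with rfl | hi
      · exact h0
      · exact this i hi
    exfalso
    have h1 := ((hF s hss).eventually_eq_zero_or_eventually_ne_zero).resolve_left h0
    have hs0 := hA s hss
    set G : ι → ℂ → ℂ := fun i x => F i x / F s x with hG
    have hGm : ∀ i ∈ S, MeromorphicAt (G i) 0 := fun i hi => (hF i (hsS hi)).div (hF s hss)
    have hsum : ∀ᶠ n : ℕ in atTop, ∑ i ∈ S, (A i / A s) ^ n * G i (y * q ^ n) = -1 := by
      filter_upwards [h, ht.eventually h1] with n h2 h3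
      rw [Finset.sum_insert hs] at h2
      have e : ∑ i ∈ S, (A i / A s) ^ n * G i (y * q ^ n) =
          (∑ i ∈ S, A i ^ n * F i (y * q ^ n)) / (A s ^ n * F s (y * q ^ n)) := by
        rw [Finset.sum_div]
        refine Finset.sum_congr rfl fun i _ => ?_
        rw [div_pow, hG, div_mul_div_comm]
      have hne : A s ^ n * F s (y * q ^ n) ≠ 0 := mul_ne_zero (pow_ne_zero n hs0) h3
      rw [e, eq_neg_of_add_eq_zero_right h2, neg_div, div_self hne]
    have hB : ∀ i ∈ S, ∀ᶠ x in 𝓝[≠] (0 : ℂ), A i / A s * G i (x * q) - G i x = 0 := by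
      refine ih (fun i => A i / A s) (fun i x => A i / A s * G i (x * q) - G i x)
        (fun i hi => div_ne_zero (hA i (hsS hi)) hs0) (fun i hi j hj hij m e => ?_) (fun i hi => ?_) ?_
      · refine hAA i (hsS hi) j (hsS hj) hij m ?_
        field_simp at e
        exact e
      · exact ((MeromorphicAt.const _ _).mul (meromorphicAt_scale (hGm i hi))).sub (hGm i hi)
      · filter_upwards [hsum, (tendsto_add_atTop_nat 1).eventually hsum] with n h2 h3
        rw [← sub_eq_zero.mpr (h3.trans h2.symm), ← Finset.sum_sub_distrib]
        refine Finset.sum_congr rfl fun i _ => ?_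
        rw [pow_succ, pow_succ, mul_assoc y]
        ring
    have hG0 : ∀ i ∈ S, ∀ᶠ x in 𝓝[≠] (0 : ℂ), G i x = 0 := fun i hi =>
      eventually_eq_zero_of_scale hq0 (hGm i hi) (fun m e => by
        refine hAA i (hsS hi) s hss (fun e' => hs (e' ▸ hi)) m ?_
        field_simp at e
        exact e) ((hB i hi).mono fun x hx => sub_eq_zero.mp hx)
    have hall : ∀ᶠ n : ℕ in atTop, ∀ i ∈ S, G i (y * q ^ n) = 0 :=
      (Filter.eventually_all_finset S).mpr fun i hi => ht.eventually (hG0 i hi)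
    obtain ⟨n, h2, h3⟩ := (hsum.and hall).exists
    rw [Finset.sum_eq_zero fun i hi => by rw [h3 i hi, mul_zero]] at h2
    norm_num at h2

end Germs

namespace Data
variable {k : ℕ} (D : Data k)

theorem cpow_mul_zpow {A : ℂ} (hA : A ≠ 0) (m : ℤ) (γ : ℂ) :
    (A * (D.q : ℂ) ^ m) ^ γ = A ^ γ * D.qpow γ ^ m := by
  have hm : 0 < D.q ^ m := zpow_pos D.q_pos m
  have e : ((D.q ^ m : ℝ) : ℂ) = (D.q : ℂ) ^ m := by push_cast; rfl
  have hqm := zpow_ne_zero m D.q_ne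
  rw [Complex.cpow_def_of_ne_zero (mul_ne_zero hA hqm), Complex.cpow_def_of_ne_zero hA, qpow,
    Complex.cpow_def_of_ne_zero D.q_ne, ← e, Complex.log_mul_ofReal _ hm _ hA, Real.log_zpow,
    ← Complex.exp_int_mul, ← Complex.exp_add, ← Complex.ofReal_log D.q_pos.le]
  congr 1
  push_cast
  ring

/-- If a sum of exponentials with coefficients meromorphic in `q^γ` vanishes on the lattice
`ε + ℤ` near `+∞`, then it vanishes at all large integers. -/
theorem transfer {ι : Type*} [DecidableEq ι] (S : Finset ι) (ε : ℂ) (A : ι → ℂ) (F : ι → ℂ → ℂ)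
    (hA : ∀ i ∈ S, A i ≠ 0) (hF : ∀ i ∈ S, MeromorphicAt (F i) 0)
    (h : ∀ᶠ n : ℕ in atTop, ∑ i ∈ S, A i ^ (n + ε) * F i (D.qpow (n + ε)) = 0) :
    ∀ᶠ n : ℕ in atTop, ∑ i ∈ S, A i ^ (n : ℂ) * F i (D.qpow n) = 0 := by
  induction hc : S.card using Nat.strong_induction_on generalizing S F with
  | _ c ih =>
  by_cases hAA : ∀ i ∈ S, ∀ j ∈ S, i ≠ j → ∀ m : ℤ, A i * (D.q : ℂ) ^ m ≠ A j
  · have h1 := eventually_eq_zero_of_sum D.q_ne D.norm_q_lt S (D.qpow_ne ε) A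
      (fun i x => A i ^ ε * F i x) hA hAA
      (fun i hi => (MeromorphicAt.const _ _).mul (hF i hi)) (by
        filter_upwards [h] with n hn
        rw [← hn]
        refine Finset.sum_congr rfl fun i hi => ?_
        rw [Complex.cpow_add _ _ (hA i hi), Complex.cpow_natCast, qpow_add, qpow_natCast,
          mul_comm (D.qpow ε)]
        ring)
    have ht := tendsto_mul_pow_punctured D.q_ne D.norm_q_lt (one_ne_zero (α := ℂ))
    have hall : ∀ᶠ n : ℕ in atTop, ∀ i ∈ S, A i ^ ε * F i (1 * (D.q : ℂ) ^ n) = 0 :=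
      (Filter.eventually_all_finset S).mpr fun i hi => ht.eventually (h1 i hi)
    filter_upwards [hall] with n hn
    refine Finset.sum_eq_zero fun i hi => ?_
    have := hn i hi
    rw [one_mul] at this
    have hne : A i ^ ε ≠ 0 := by simp [Complex.cpow_eq_zero_iff, hA i hi]
    rw [qpow_natCast, (mul_eq_zero.mp this).resolve_left hne, mul_zero]
  · push Not at hAA
    obtain ⟨i, hi, j, hj, hij, m, hm⟩ := hAA
    -- the terms with the indices `i` and `j` are merged
    set F' : ι → ℂ → ℂ := Function.update F i (fun x => F i x + x ^ m * F j x) with hF'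
    have key : ∀ γ, ∑ i ∈ S.erase j, A i ^ γ * F' i (D.qpow γ) = ∑ i ∈ S, A i ^ γ * F i (D.qpow γ) := by
      intro γ
      have hi' : i ∈ S.erase j := Finset.mem_erase.mpr ⟨hij, hi⟩
      rw [← Finset.add_sum_erase S _ hj, ← Finset.add_sum_erase (S.erase j) _ hi',
        ← Finset.add_sum_erase (S.erase j) (fun i => A i ^ γ * F i (D.qpow γ)) hi', hF',
        Function.update_self, ← hm, D.cpow_mul_zpow (hA i hi)]
      rw [Finset.sum_congr rfl fun l hl => by
        rw [Function.update_of_ne (Finset.ne_of_mem_erase hl)]]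
      ring
    have hmer : ∀ l ∈ S.erase j, MeromorphicAt (F' l) 0 := by
      intro l hl
      by_cases hli : l = i
      · subst hli
        rw [hF', Function.update_self]
        exact (hF l hi).add (((MeromorphicAt.id 0).zpow m).mul (hF j hj))
      · rw [hF', Function.update_of_ne hli]
        exact hF l (Finset.mem_of_mem_erase hl)
    have := ih (S.erase j).card (hc ▸ Finset.card_erase_lt_of_mem hj) (S.erase j) F'
      (fun l hl => hA l (Finset.mem_of_mem_erase hl)) hmer (by simpa only [key] using h) rfl
    simpa only [key] using this

/-- The recurrence operator as an operator on functions of the complex variable `γ`. -/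
def recOpC : Module.End ℂ (ℂ → ℂ) where
  toFun u := fun γ => D.recA γ * u (γ + 1) + D.recB γ * u γ + D.recC γ * u (γ - 1)
  map_add' u v := by
    funext n
    simp only [Pi.add_apply]
    ring
  map_smul' s u := by
    funext n
    simp only [Pi.smul_apply, smul_eq_mul, RingHom.id_apply]
    ring

theorem aeval_recOp_restrict (ε : ℂ) (f : ℂ[X]) (u : ℂ → ℂ) :
    aeval (D.recOp ε) f (fun n : ℤ => u (n + ε)) = fun n : ℤ => aeval D.recOpC f u (n + ε) := by
  induction f using Polynomial.induction_on' generalizing u with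
  | add f g hf hg =>
    rw [map_add, map_add, LinearMap.add_apply, hf, hg]
    rfl
  | monomial m s =>
    rw [aeval_monomial, aeval_monomial, Module.End.mul_apply, Module.algebraMap_end_apply]
    have : ∀ m : ℕ, (D.recOp ε ^ m) (fun n : ℤ => u (n + ε)) =
        fun n : ℤ => (D.recOpC ^ m) u (n + ε) := by
      intro m
      induction m with
      | zero => rfl
      | succ m ih =>
        rw [pow_succ', Module.End.mul_apply, ih, pow_succ', Module.End.mul_apply]
        funext n
        simp only [recOp, recOpC, LinearMap.coe_mk, AddHom.coe_mk]
        have e1 : ((n + 1 : ℤ) : ℂ) + ε = n + ε + 1 := by push_cast; ring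
        have e2 : ((n - 1 : ℤ) : ℂ) + ε = n + ε - 1 := by push_cast; ring
        rw [e1, e2]
    rw [this]
    rfl

/-- Functions of the form `A^γ F(q^γ)` with `F` meromorphic at `0`. -/
def IsGerm (A : ℂ) (u : ℂ → ℂ) : Prop :=
  ∃ F : ℂ → ℂ, MeromorphicAt F 0 ∧ ∀ γ, u γ = A ^ γ * F (D.qpow γ)

variable {D}

theorem IsGerm.add {A : ℂ} {u v : ℂ → ℂ} (hu : D.IsGerm A u) (hv : D.IsGerm A v) :
    D.IsGerm A (u + v) := by
  obtain ⟨F, hF, hu⟩ := hu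
  obtain ⟨G, hG, hv⟩ := hv
  exact ⟨F + G, hF.add hG, fun γ => by rw [Pi.add_apply, hu, hv, Pi.add_apply]; ring⟩

theorem IsGerm.smul {A : ℂ} {u : ℂ → ℂ} (hu : D.IsGerm A u) (s : ℂ) : D.IsGerm A (s • u) := by
  obtain ⟨F, hF, hu⟩ := hu
  exact ⟨fun x => s * F x, (MeromorphicAt.const _ _).mul hF, fun γ => by
    rw [Pi.smul_apply, hu, smul_eq_mul]; ring⟩

theorem recA_eq (γ : ℂ) : D.recA γ = awRecA D.q D.a D.b D.c D.d (D.qpow γ) := by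
  have e : D.qpow (2 * γ) = D.qpow γ ^ 2 := by rw [two_mul, qpow_add, sq]
  rw [recA, awRecA, qpow_sub, qpow_sub, e, qpow_one]
  rfl

theorem recB_eq (γ : ℂ) : D.recB γ = awRecB D.q D.a D.b D.c D.d (D.qpow γ) := by
  have e : D.qpow (2 * γ) = D.qpow γ ^ 2 := by rw [two_mul, qpow_add, sq]
  have e2 : D.qpow 2 = (D.q : ℂ) ^ 2 := by
    have := D.qpow_natCast 2
    exact_mod_cast this
  rw [recB, awRecB, qpow_sub, qpow_sub, qpow_sub, e, qpow_one, e2]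
  rfl

theorem recC_eq (γ : ℂ) : D.recC γ = awRecC D.q D.a D.b D.c D.d (D.qpow γ) := by
  have e : D.qpow (2 * γ) = D.qpow γ ^ 2 := by rw [two_mul, qpow_add, sq]
  have e2 : D.qpow 2 = (D.q : ℂ) ^ 2 := by
    have := D.qpow_natCast 2
    exact_mod_cast this
  rw [recC, awRecC, qpow_sub, qpow_sub, qpow_sub, e, qpow_one, e2]
  rfl

theorem IsGerm.recOpC {A : ℂ} (hA : A ≠ 0) {u : ℂ → ℂ} (hu : D.IsGerm A u) :
    D.IsGerm A (D.recOpC u) := by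
  obtain ⟨F, hF, hu⟩ := hu
  have hid : MeromorphicAt (fun x : ℂ => x) 0 := MeromorphicAt.id 0
  have h1 : MeromorphicAt (awRecA D.q D.a D.b D.c D.d) 0 := by
    unfold awRecA
    fun_prop
  have h2 : MeromorphicAt (awRecB D.q D.a D.b D.c D.d) 0 := by
    unfold awRecB
    fun_prop
  have h3 : MeromorphicAt (awRecC D.q D.a D.b D.c D.d) 0 := by
    unfold awRecC
    fun_prop
  refine ⟨fun x => awRecA D.q D.a D.b D.c D.d x * (A * F (x * D.q)) +
    awRecB D.q D.a D.b D.c D.d x * F x + awRecC D.q D.a D.b D.c D.d x * (A⁻¹ * F (x * (D.q : ℂ)⁻¹)),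
    ?_, fun γ => ?_⟩
  · exact ((h1.mul ((MeromorphicAt.const _ _).mul (meromorphicAt_scale hF))).add
      (h2.mul hF)).add (h3.mul ((MeromorphicAt.const _ _).mul
        (meromorphicAt_scale hF)))
  · change D.recA γ * u (γ + 1) + D.recB γ * u γ + D.recC γ * u (γ - 1) = _
    rw [hu, hu, hu, Complex.cpow_add _ _ hA, Complex.cpow_sub _ _ hA, Complex.cpow_one, qpow_add,
      qpow_sub, qpow_one, recA_eq, recB_eq, recC_eq, div_eq_mul_inv, div_eq_mul_inv]
    ring

theorem IsGerm.aeval {A : ℂ} (hA : A ≠ 0) {u : ℂ → ℂ} (hu : D.IsGerm A u) (f : ℂ[X]) :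
    D.IsGerm A (Polynomial.aeval D.recOpC f u) := by
  induction f using Polynomial.induction_on' with
  | add f g hf hg =>
    rw [map_add, LinearMap.add_apply]
    exact hf.add hg
  | monomial m s =>
    rw [aeval_monomial, Module.End.mul_apply, Module.algebraMap_end_apply]
    refine IsGerm.smul ?_ s
    induction m with
    | zero => simpa using hu
    | succ m ih =>
      rw [pow_succ', Module.End.mul_apply]
      exact ih.recOpC hA

/-- The function `ψ^(j)` is `(δ_j)^γ` times a meromorphic function of `q^γ`, also at `q^γ = 0`. -/
theorem isGerm_psi (j : Fin k) : D.IsGerm (D.par (D.δ j)) (D.psi j) := by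
  have hP (A : ℂ) : MeromorphicAt (fun x => qPochInf D.q (A * x)) 0 :=
    ((differentiable_qPochInf D.norm_q_lt).comp
      (differentiable_id.const_mul A)).analyticAt 0 |>.meromorphicAt
  have hid : MeromorphicAt (fun x : ℂ => x) 0 := MeromorphicAt.id 0
  have hxi : MeromorphicAt (D.xiY (D.δ j)) 0 := by
    have e : D.xiY (D.δ j) = fun y => D.xiY (D.δ j) y := rfl
    rw [e]
    unfold xiY
    have e1 : (fun y : ℂ => qPochInf D.q (y * D.q)) = fun y => qPochInf D.q (D.q * y) := by
      funext y; rw [mul_comm]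
    have e2 : (fun y : ℂ => qPochInf D.q (D.abcd * y / D.q)) =
        fun y => qPochInf D.q (D.abcd / D.q * y) := by
      funext y; rw [div_mul_eq_mul_div]
    refine (hid.mul ((((hP _).mul (hP _)).mul (hP _)).mul ?_)).div ?_
    · rw [e1]; exact hP _
    · rw [e2]; exact hP _
  have hphi : MeromorphicAt (fun x => (D.φ j).eval (D.lamX x)) 0 := by
    have hl : MeromorphicAt D.lamX 0 := by
      have e : D.lamX = fun x => D.lamX x := rfl
      rw [e]
      unfold lamX
      fun_prop
    induction D.φ j using Polynomial.induction_on' with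
    | add f g hf hg =>
      simp only [eval_add]
      exact hf.add hg
    | monomial m s =>
      simp only [eval_monomial]
      exact (MeromorphicAt.const _ _).mul (hl.pow m)
  refine ⟨fun x => (D.φ j).eval (D.lamX x) / (D.xiConst (D.δ j) * D.xiY (D.δ j) x),
    hphi.div ((MeromorphicAt.const _ _).mul hxi), fun γ => ?_⟩
  rw [psi, lam_eq, xi_eq]
  simp only [div_eq_mul_inv, mul_inv, inv_inv]
  ring

/-- The condition `f(𝓛) W ⊂ W` on the lattice `ε + ℤ` implies the corresponding relations at all
large integers. -/
theorem exists_aeval_recOpC_psi {ε : ℂ} {f : ℂ[X]} (hf : f ∈ D.algZ ε) (j : Fin k) :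
    ∃ c : Fin k → ℂ, ∀ᶠ n : ℕ in atTop, aeval D.recOpC f (D.psi j) n = ∑ i, c i * D.psi i n := by
  have hW := hf _ (Submodule.subset_span (Set.mem_range_self j))
  rw [W, Submodule.mem_span_range_iff_exists_fun] at hW
  obtain ⟨c, hc⟩ := hW
  refine ⟨c, ?_⟩
  have hlat : ∀ n : ℤ, aeval D.recOpC f (D.psi j) (n + ε) = ∑ i, c i * D.psi i (n + ε) := by
    intro n
    rw [D.aeval_recOp_restrict ε f (D.psi j)] at hc
    have := congrFun hc n
    rw [Finset.sum_apply] at this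
    exact this.symm
  choose G hG hGe using fun i => isGerm_psi (D := D) i
  obtain ⟨G₀, hG₀, hGe₀⟩ := (isGerm_psi (D := D) j).aeval (D.par_ne _) f
  have hsum : ∀ γ, ∑ i : Option (Fin k), D.par (D.δ (i.getD j)) ^ γ *
      (i.elim G₀ fun i x => -c i * G i x) (D.qpow γ) =
      aeval D.recOpC f (D.psi j) γ - ∑ i, c i * D.psi i γ := by
    intro γ
    rw [Fintype.sum_option, hGe₀, sub_eq_add_neg, ← Finset.sum_neg_distrib]
    congr 1
    refine Finset.sum_congr rfl fun i _ => ?_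
    rw [hGe]
    simp only [Option.getD_some, Option.elim_some]
    ring
  have key := D.transfer Finset.univ ε (fun i : Option (Fin k) => D.par (D.δ (i.getD j)))
    (fun i => i.elim G₀ fun i x => -c i * G i x) (fun i _ => D.par_ne _) (fun i _ => by
      cases i with
      | none => exact hG₀
      | some i => exact (MeromorphicAt.const _ _).mul (hG i)) (by
      refine Eventually.of_forall fun n => ?_
      rw [hsum, sub_eq_zero]
      exact_mod_cast hlat n)
  filter_upwards [key] with n hn
  rw [hsum, sub_eq_zero] at hn
  exact hn

end Data

/-! ### Operators in the degree variable -/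

section RecurrenceOp

/-- The basis of `ℂ[X]` formed by a sequence of polynomials of degrees `0, 1, 2, …`. -/
def degreeBasis (p : ℕ → ℂ[X]) (hp : ∀ n, (p n).degree = n) : Module.Basis ℕ ℂ ℂ[X] :=
  Sequence.basis ⟨p, hp⟩ fun i => isUnit_iff_ne_zero.mpr
    (leadingCoeff_ne_zero.mpr (Sequence.ne_zero ⟨p, hp⟩ i))

@[simp]
theorem degreeBasis_apply (p : ℕ → ℂ[X]) (hp : ∀ n, (p n).degree = n) (n : ℕ) :
    degreeBasis p hp n = p n := Sequence.basis_eq_self _ _ _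

variable (b : Module.Basis ℕ ℂ ℂ[X])

/-- The linear functional on polynomials with the values `u n` on the basis `b`. -/
def functional (u : ℕ → ℂ) : ℂ[X] →ₗ[ℂ] ℂ := b.constr ℂ u

@[simp]
theorem functional_basis (u : ℕ → ℂ) (n : ℕ) : functional b u (b n) = u n :=
  b.constr_basis ℂ u n

theorem functional_apply (u : ℕ → ℂ) (v : ℂ[X]) :
    functional b u v = (b.repr v).sum fun m x => x * u m := by
  rw [functional, Module.Basis.constr_apply]
  rfl

/-- The matrix of the multiplication by `2x` in the basis `b`, as an operator on sequences: it is
determined by having every sequence `n ↦ b n (x)` as an eigenvector with eigenvalue `2x`. -/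
def recurrenceOp : Module.End ℂ (ℕ → ℂ) where
  toFun u n := functional b u (2 * X * b n)
  map_add' u v := by
    funext n
    simp only [functional, map_add, LinearMap.add_apply, Pi.add_apply]
  map_smul' s u := by
    funext n
    simp only [functional, map_smul, LinearMap.smul_apply, Pi.smul_apply, RingHom.id_apply]

theorem functional_recurrenceOp (u : ℕ → ℂ) (v : ℂ[X]) :
    functional b (recurrenceOp b u) v = functional b u (2 * X * v) := by
  have : functional b (recurrenceOp b u) = functional b u ∘ₗ LinearMap.mulLeft ℂ (2 * X) :=
    b.ext fun n => by
      rw [functional_basis]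
      rfl
  rw [this]
  rfl

theorem functional_add (u w : ℕ → ℂ) (v : ℂ[X]) :
    functional b (u + w) v = functional b u v + functional b w v := by
  rw [functional, map_add]
  rfl

theorem functional_smul (s : ℂ) (u : ℕ → ℂ) (v : ℂ[X]) :
    functional b (s • u) v = s * functional b u v := by
  rw [functional, map_smul]
  rfl

theorem functional_sum {ι : Type*} (S : Finset ι) (c : ι → ℂ) (u : ι → ℕ → ℂ) (v : ℂ[X]) :
    functional b (∑ i ∈ S, c i • u i) v = ∑ i ∈ S, c i * functional b (u i) v := by
  rw [functional, map_sum, LinearMap.sum_apply]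
  exact Finset.sum_congr rfl fun i _ => functional_smul b _ _ _

theorem functional_aeval (f : ℂ[X]) (u : ℕ → ℂ) (v : ℂ[X]) :
    functional b (aeval (recurrenceOp b) f u) v = functional b u (aeval (2 * X) f * v) := by
  induction f using Polynomial.induction_on' generalizing u v with
  | add f g hf hg =>
    simp only [map_add, LinearMap.add_apply, functional_add, hf, hg, add_mul]
  | monomial r s =>
    have h : ∀ (r : ℕ) (u : ℕ → ℂ) (v : ℂ[X]), functional b ((recurrenceOp b ^ r) u) v =
        functional b u ((2 * X) ^ r * v) := by
      intro r
      induction r with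
      | zero => simp
      | succ r ih =>
        intro u v
        rw [pow_succ', Module.End.mul_apply, functional_recurrenceOp, ih, pow_succ,
          mul_assoc ((2 * X) ^ r)]
    simp only [aeval_monomial, Module.End.mul_apply, Module.algebraMap_end_apply,
      functional_smul, h]
    rw [mul_assoc, ← Algebra.smul_def, map_smul, smul_eq_mul]

theorem aeval_recurrenceOp_apply (f : ℂ[X]) (u : ℕ → ℂ) (n : ℕ) :
    aeval (recurrenceOp b) f u n = functional b u (aeval (2 * X) f * b n) := by
  rw [← functional_aeval, functional_basis]

theorem functional_eval (x : ℂ) (v : ℂ[X]) : functional b (fun n => (b n).eval x) v = v.eval x := by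
  have : functional b (fun n => (b n).eval x) = leval x := b.ext fun n => functional_basis b _ n
  rw [this]
  rfl

theorem eval_aeval_two_mul_X (f : ℂ[X]) (x : ℂ) : (aeval (2 * X : ℂ[X]) f).eval x = f.eval (2 * x) := by
  rw [show aeval (2 * X : ℂ[X]) f = f.comp (2 * X) from rfl, eval_comp]
  simp

theorem aeval_recurrenceOp_eval (f : ℂ[X]) (x : ℂ) (n : ℕ) :
    aeval (recurrenceOp b) f (fun m => (b m).eval x) n = f.eval (2 * x) * (b n).eval x := by
  rw [aeval_recurrenceOp_apply, functional_eval, eval_mul, eval_aeval_two_mul_X]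

theorem aeval_recurrenceOp_injective (hb : ∀ n, (b n).degree = n) :
    Function.Injective (aeval (recurrenceOp b) : ℂ[X] →ₐ[ℂ] _) := by
  rw [injective_iff_map_eq_zero]
  intro f hf
  refine Polynomial.funext fun y => ?_
  have h := aeval_recurrenceOp_eval b f (y / 2) 0
  rw [hf, mul_div_cancel₀ _ (two_ne_zero), eq_C_of_degree_le_zero (hb 0).le, eval_C] at h
  have h0 : (b 0).coeff 0 ≠ 0 := by
    intro e
    refine b.ne_zero 0 ?_
    rw [eq_C_of_degree_le_zero (hb 0).le, e, C_0]
  rw [eval_zero]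
  exact ((mul_eq_zero.mp h.symm).resolve_right h0)

/-- An operator on sequences given by a matrix is a difference operator if the matrix is banded. -/
theorem isDifferenceOperator_of_band (T : Module.End ℂ (ℕ → ℂ)) (v : ℕ → ℂ[X])
    (hT : ∀ u n, T u n = functional b u (v n)) (N : ℕ)
    (h1 : ∀ n m, n + N < m → b.repr (v n) m = 0) (h2 : ∀ n m, m + N < n → b.repr (v n) m = 0) :
    IsDifferenceOperator T := by
  refine ⟨N, fun j n => b.repr (v n) ((n : ℤ) + j).toNat, fun u n => ?_⟩
  rw [hT, functional_apply, Finsupp.sum_of_support_subset _ (s := Finset.Icc (n - N) (n + N))]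
  · rw [← Finset.sum_subset (Finset.Icc_subset_Icc_left
      (show (-(N : ℤ)) ≤ max (-(N : ℤ)) (-n) from le_max_left _ _))]
    · symm
      refine Finset.sum_nbij' (fun j : ℤ => ((n : ℤ) + j).toNat) (fun m => (m : ℤ) - n) ?_ ?_ ?_ ?_ ?_
      · intro j hj
        simp only [Finset.mem_Icc] at hj ⊢
        omega
      · intro m hm
        simp only [Finset.mem_Icc] at hm ⊢
        omega
      · intro j hj
        simp only [Finset.mem_Icc] at hj
        omega
      · intro m _
        omega
      · intro j hj
        simp only [Finset.mem_Icc] at hj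
        rw [if_pos (by omega)]
    · intro j hj hj'
      simp only [Finset.mem_Icc] at hj hj'
      rw [if_neg (by omega), mul_zero]
  · intro m hm
    rw [Finset.mem_Icc]
    by_contra hc
    refine Finsupp.mem_support_iff.mp hm ?_
    rcases lt_or_ge (n + N) m with h | h
    · exact h1 n m h
    · exact h2 n m (by omega)
  · simp

variable {b}

theorem exists_sub_degree_lt {p v : ℂ[X]} {d : ℕ} (hp : p.degree = d) (hv : v.degree < (d + 1 : ℕ)) :
    ∃ c : ℂ, (v - c • p).degree < d := by
  have hp0 : p.coeff d ≠ 0 := coeff_ne_zero_of_eq_degree hp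
  refine ⟨v.coeff d / p.coeff d, (degree_lt_iff_coeff_zero _ _).mpr fun m hm => ?_⟩
  rw [coeff_sub, coeff_smul, smul_eq_mul]
  rcases hm.eq_or_lt with rfl | hm
  · rw [div_mul_cancel₀ _ hp0, sub_self]
  · rw [(degree_lt_iff_coeff_zero _ _).mp hv m hm, coeff_eq_zero_of_degree_lt (n := m)
      (by rw [hp]; exact_mod_cast hm), mul_zero, sub_zero]

theorem repr_eq_zero_of_degree_lt (hb : ∀ n, (b n).degree = n) {v : ℂ[X]} {d m : ℕ}
    (hv : v.degree < d) (hm : d ≤ m) : b.repr v m = 0 := by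
  induction d generalizing v with
  | zero =>
    have : v = 0 := by
      rw [← degree_eq_bot]
      exact Nat.WithBot.lt_zero_iff.mp (by simpa using hv)
    simp [this]
  | succ d ih =>
    obtain ⟨c, hc⟩ : ∃ c : ℂ, (v - c • b d).degree < d := exists_sub_degree_lt (hb d) hv
    have e := ih hc (by omega)
    rw [map_sub, map_smul, Module.Basis.repr_self, Finsupp.sub_apply, Finsupp.smul_apply,
      Finsupp.single_eq_of_ne (by omega), smul_zero, sub_zero] at e
    exact e

/-- A polynomial that is supported on degrees at least `lo` in the basis `b` and is killed by the
functionals attached to `k` sequences `ψ j` with nondegenerate Casorati matrix has no components in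
degrees below `lo + k` in a basis `c` whose elements have the same two properties. -/
theorem repr_eq_zero_of_functional {c : Module.Basis ℕ ℂ ℂ[X]} (hb : ∀ n, (b n).degree = n)
    (hc : ∀ n, (c n).degree = n) {k lo : ℕ} {ψ : Fin k → ℕ → ℂ}
    (hlow : ∀ n, lo + k ≤ n → ∀ m < lo, b.repr (c n) m = 0)
    (hker : ∀ n, lo + k ≤ n → ∀ j, functional b (ψ j) (c n) = 0)
    (hdet : ∀ x : Fin k → ℂ, (∀ j, ∑ s : Fin k, x s * ψ j (lo + s) = 0) → x = 0)
    {v : ℂ[X]} (hv : ∀ m < lo, b.repr v m = 0) (hv' : ∀ j, functional b (ψ j) v = 0) :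
    ∀ m < lo + k, c.repr v m = 0 := by
  obtain ⟨d, hd⟩ : ∃ d : ℕ, v.degree < d :=
    ⟨v.natDegree + 1, lt_of_le_of_lt degree_le_natDegree (by exact_mod_cast Nat.lt_succ_self _)⟩
  have small : ∀ v : ℂ[X], v.degree < (lo + k : ℕ) → (∀ m < lo, b.repr v m = 0) →
      (∀ j, functional b (ψ j) v = 0) → v = 0 := by
    intro v hd hv hv'
    have hx : (fun s : Fin k => b.repr v (lo + s)) = 0 := by
      refine hdet _ fun j => ?_
      rw [← hv' j, functional_apply, Finsupp.sum_of_support_subset _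
        (s := Finset.univ.map (Fin.valEmbedding.trans (addLeftEmbedding lo) : Fin k ↪ ℕ)),
        Finset.sum_map]
      · rfl
      · intro m hm
        rw [Finsupp.mem_support_iff] at hm
        have h1 : lo ≤ m := le_of_not_gt fun h => hm (hv m h)
        have h2 : m < lo + k := lt_of_not_ge fun h => hm (repr_eq_zero_of_degree_lt hb hd h)
        exact Finset.mem_map.mpr ⟨⟨m - lo, by omega⟩, Finset.mem_univ _, Nat.add_sub_cancel' h1⟩
      · simp
    refine b.repr.map_eq_zero_iff.mp (Finsupp.ext fun m => ?_)
    rcases lt_or_ge m lo with h1 | h1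
    · exact hv m h1
    rcases lt_or_ge m (lo + k) with h2 | h2
    · have := congrFun hx ⟨m - lo, by omega⟩
      simpa [Nat.add_sub_cancel' h1] using this
    · exact repr_eq_zero_of_degree_lt hb hd h2
  induction d generalizing v with
  | zero =>
    rw [small v (hd.trans_le (by exact_mod_cast Nat.zero_le _)) hv hv']
    simp
  | succ d ih =>
    rcases lt_or_ge d (lo + k) with h | h
    · rw [small v (hd.trans_le (by exact_mod_cast h)) hv hv']
      simp
    intro m hm
    obtain ⟨y, hy⟩ := exists_sub_degree_lt (hc d) hd
    have e := ih (v := v - y • c d)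
      (fun m hm => by
        rw [map_sub, map_smul, Finsupp.sub_apply, Finsupp.smul_apply, hv m hm, hlow d h m hm,
          smul_zero, sub_zero])
      (fun j => by rw [map_sub, map_smul, hv' j, hker d h j, smul_zero, sub_zero]) hy m hm
    rw [map_sub, map_smul, Module.Basis.repr_self, Finsupp.sub_apply, Finsupp.smul_apply,
      Finsupp.single_eq_of_ne (by omega), smul_zero, sub_zero] at e
    exact e

theorem linearMap_congr {M : Type*} [AddCommMonoid M] [Module ℂ M] {F G : ℂ[X] →ₗ[ℂ] M} {v : ℂ[X]}
    {lo : ℕ} (hv : ∀ m < lo, b.repr v m = 0) (h : ∀ m, lo ≤ m → F (b m) = G (b m)) : F v = G v := by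
  rw [← b.linearCombination_repr v, Finsupp.linearCombination_apply, Finsupp.sum, map_sum, map_sum]
  refine Finset.sum_congr rfl fun m hm => ?_
  rw [map_smul, map_smul, h m (le_of_not_gt fun hlt => Finsupp.mem_support_iff.mp hm (hv m hlt))]

/-- Multiplication by `2x` in a basis satisfying a three-term recurrence relation. -/
theorem repr_two_mul_X {A B E : ℕ → ℂ}
    (hrec : ∀ m, A m • b (m + 2) + B m • b (m + 1) + E m • b m = 2 * X * b (m + 1))
    {v : ℂ[X]} {lo : ℕ} (hv : ∀ m < lo + 1, b.repr v m = 0) :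
    ∀ m < lo, b.repr (2 * X * v) m = 0 := by
  intro m hm
  refine linearMap_congr (F := b.coord m ∘ₗ LinearMap.mulLeft ℂ (2 * X)) (G := 0) hv fun i hi => ?_
  obtain ⟨i, rfl⟩ : ∃ i', i = i' + 1 := ⟨i - 1, by omega⟩
  rw [LinearMap.comp_apply, LinearMap.mulLeft_apply, ← hrec, Module.Basis.coord_apply]
  simp only [map_smul, map_add, Module.Basis.repr_self, Finsupp.smul_apply, Finsupp.add_apply]
  rw [Finsupp.single_eq_of_ne (by omega), Finsupp.single_eq_of_ne (by omega),
    Finsupp.single_eq_of_ne (by omega)]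
  simp

theorem repr_aeval_two_mul_X {A B E : ℕ → ℂ}
    (hrec : ∀ m, A m • b (m + 2) + B m • b (m + 1) + E m • b m = 2 * X * b (m + 1))
    (f : ℂ[X]) {v : ℂ[X]} {lo : ℕ} (hv : ∀ m < lo + f.natDegree, b.repr v m = 0) :
    ∀ m < lo, b.repr (aeval (2 * X) f * v) m = 0 := by
  have h : ∀ r : ℕ, ∀ v : ℂ[X], ∀ lo : ℕ, (∀ m < lo + r, b.repr v m = 0) →
      ∀ m < lo, b.repr ((2 * X) ^ r * v) m = 0 := by
    intro r
    induction r with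
    | zero => simp
    | succ r ih =>
      intro v lo hv
      rw [pow_succ, mul_assoc]
      exact ih _ _ (repr_two_mul_X hrec hv)
  intro m hm
  rw [aeval_eq_sum_range, Finset.sum_mul, map_sum, Finsupp.finsetSum_apply]
  refine Finset.sum_eq_zero fun r hr => ?_
  have := Finset.mem_range.mp hr
  rw [smul_mul_assoc, map_smul, Finsupp.smul_apply, h r v lo (fun m hm => hv m (by omega)) m hm,
    smul_zero]

end RecurrenceOp

namespace Data
variable {k : ℕ} {D : Data k}

theorem Regular.degree_awPoly (H : D.Regular) (n : ℕ) : (D.awPoly n).degree = n := by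
  rw [awPoly_eq]; exact degree_aw H.generic D.a_ne_zero n

/-- The basis formed by the Askey-Wilson polynomials. -/
def Regular.awBasis (H : D.Regular) : Module.Basis ℕ ℂ ℂ[X] := degreeBasis D.awPoly H.degree_awPoly

/-- The basis formed by the polynomials `p̂_n`. -/
def Regular.hatBasis (H : D.Regular) : Module.Basis ℕ ℂ ℂ[X] := degreeBasis D.pHat H.degree_pHat

theorem Regular.awBasis_apply (H : D.Regular) (n : ℕ) : H.awBasis n = D.awPoly n :=
  degreeBasis_apply _ _ n

theorem Regular.hatBasis_apply (H : D.Regular) (n : ℕ) : H.hatBasis n = D.pHat n :=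
  degreeBasis_apply _ _ n

theorem Regular.awBasis_recurrence (H : D.Regular) (m : ℕ) :
    D.recA (m + 1 : ℕ) • H.awBasis (m + 2) + D.recB (m + 1 : ℕ) • H.awBasis (m + 1) +
      D.recC (m + 1 : ℕ) • H.awBasis m = 2 * X * H.awBasis (m + 1) := by
  simp only [H.awBasis_apply, awPoly_eq, recA_eq, recB_eq, recC_eq, qpow_natCast, ← C_mul']
  exact aw_recurrence H.generic D.a_ne_zero D.b_ne_zero D.c_ne_zero D.d_ne_zero m

theorem Regular.functional_recOpC (H : D.Regular) (u : ℂ → ℂ) {v : ℂ[X]}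
    (hv : ∀ m < 1, H.awBasis.repr v m = 0) :
    functional H.awBasis (fun n => u n) (2 * X * v) =
      functional H.awBasis (fun n => D.recOpC u n) v := by
  rw [← LinearMap.mulLeft_apply ℂ, ← LinearMap.comp_apply]
  refine linearMap_congr hv fun m hm => ?_
  obtain ⟨m, rfl⟩ : ∃ i', m = i' + 1 := ⟨m - 1, by omega⟩
  rw [LinearMap.comp_apply, LinearMap.mulLeft_apply, ← H.awBasis_recurrence]
  simp only [map_add, map_smul, functional_basis, smul_eq_mul, recOpC, LinearMap.coe_mk,
    AddHom.coe_mk]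
  push_cast
  rw [add_sub_cancel_right, add_assoc (m : ℂ) 1 1, one_add_one_eq_two]

/-- In high degrees the operator `f(2x)` is, in the basis of the Askey-Wilson polynomials, the transpose
of `f(𝓛)`; low degrees are excluded, as the recurrence fails for `p_{-1}`. -/
theorem Regular.functional_aeval_recOpC (H : D.Regular) (f : ℂ[X]) (u : ℂ → ℂ) {v : ℂ[X]}
    (hv : ∀ m < f.natDegree, H.awBasis.repr v m = 0) :
    functional H.awBasis (fun n => u n) (aeval (2 * X) f * v) =
      functional H.awBasis (fun n => aeval D.recOpC f u n) v := by
  have h : ∀ r : ℕ, ∀ v : ℂ[X], (∀ m < r, H.awBasis.repr v m = 0) →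
      functional H.awBasis (fun n => u n) ((2 * X) ^ r * v) =
        functional H.awBasis (fun n => (D.recOpC ^ r) u n) v := by
    intro r
    induction r with
    | zero => simp
    | succ r ih =>
      intro v hv
      rw [pow_succ, mul_assoc, ih _ (repr_two_mul_X H.awBasis_recurrence hv),
        H.functional_recOpC _ fun m hm => hv m (by omega), pow_succ', Module.End.mul_apply]
  rw [aeval_eq_sum_range, aeval_eq_sum_range, Finset.sum_mul, map_sum]
  have e : (fun n : ℕ => (∑ i ∈ Finset.range (f.natDegree + 1), f.coeff i • D.recOpC ^ i) u n) =
      ∑ i ∈ Finset.range (f.natDegree + 1), f.coeff i • fun n : ℕ => (D.recOpC ^ i) u n := by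
    funext n
    simp [Finset.sum_apply]
  rw [e, functional_sum]
  refine Finset.sum_congr rfl fun r hr => ?_
  have := Finset.mem_range.mp hr
  rw [smul_mul_assoc, map_smul, h r v fun m hm => hv m (by omega), smul_eq_mul]

theorem Regular.repr_pHat (H : D.Regular) {n m : ℕ} (h : m + k < n) :
    H.awBasis.repr (D.pHat n) m = 0 := by
  rw [pHat, map_sum, Finsupp.finsetSum_apply]
  refine Finset.sum_eq_zero fun l hl => ?_
  have := Finset.mem_range.mp hl
  rw [if_pos (by omega), C_mul', map_smul, ← H.awBasis_apply, Module.Basis.repr_self,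
    Finsupp.smul_apply, Finsupp.single_eq_of_ne (by omega), smul_zero]

theorem Regular.tendsto_psi (H : D.Regular) (j : Fin k) {n l : ℕ} (hl : l ≤ n) :
    Tendsto (fun γ => D.psi j (γ - l)) (𝓝[≠] (n : ℂ)) (𝓝 (D.psi j (n - l : ℕ))) := by
  have h := (tendsto_laurent (D := D) (D.phi_mem j l) n).div (tendsto_xi (H.const_row j) hl)
    (xi_natCast_ne (H.const_row j) _)
  unfold psi
  rw [Nat.cast_sub hl] at h ⊢
  simp only [lam_sub_nat]
  exact h

/-- The functionals attached to `ψ^(j)` annihilate `p̂_n`, as the operator with the coefficients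
`Q^{(-l)}` annihilates `ψ^(j)`. -/
theorem Regular.functional_psi_pHat (H : D.Regular) (j : Fin k) {n : ℕ} (hn : k ≤ n) :
    functional H.awBasis (fun m => D.psi j m) (D.pHat n) = 0 := by
  have h : Tendsto (fun γ => ∑ l ∈ Finset.range (k + 1), D.coeffQ l γ * D.psi j (γ - l))
      (𝓝[≠] (n : ℂ)) (𝓝 (∑ l ∈ Finset.range (k + 1), valueAt (D.coeffQ l) n * D.psi j (n - l : ℕ))) :=
    tendsto_finsetSum _ fun l hl => by
      have := Finset.mem_range.mp hl
      exact (H.tendsto_coeffQ (by omega)).mul (H.tendsto_psi j (by omega))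
  simp only [sum_coeffQ_mul_psi] at h
  rw [tendsto_nhds_unique tendsto_const_nhds h, pHat, map_sum]
  refine Finset.sum_congr rfl fun l hl => ?_
  have := Finset.mem_range.mp hl
  rw [if_pos (by omega), C_mul', map_smul, ← H.awBasis_apply, functional_basis, smul_eq_mul]

/-- At large integers the Casorati matrix of `ψ^(1), …, ψ^(k)` is invertible, since `τ_n ≠ 0`. -/
theorem Regular.eventually_casorati_psi (H : D.Regular) : ∀ᶠ n : ℕ in atTop, ∀ x : Fin k → ℂ,
    (∀ j, ∑ s : Fin k, x s * D.psi j (n + (s : ℕ) : ℕ) = 0) → x = 0 := by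
  have hg := (D.eventually_good_sub (k + 2 - (k - 1 : ℕ)))
  filter_upwards [hg] with n hn x hx
  have hn' : D.Good (((n + (k - 1) : ℕ) : ℂ) - k - 2) := by
    convert hn using 1
    push_cast
    ring
  have htau : D.tau (n + (k - 1) : ℕ) ≠ 0 := by
    obtain ⟨v, hv, hv'⟩ := H.tau (n + (k - 1) : ℕ) (by omega)
    rw [tau_eq hn' H.const]
    have hl := tendsto_laurent (D := D) D.tauX_mem (n + (k - 1) : ℕ)
    have hG : ∀ᶠ γ in 𝓝[≠] ((n + (k - 1) : ℕ) : ℂ), D.Good (γ - k - 2) := by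
      simpa only [sub_sub] using eventually_good_sub_nhds (D := D) _ (k + 2)
    rw [Int.cast_natCast] at hv'
    rwa [tendsto_nhds_unique hl (hv'.congr' (hG.mono fun γ hγ => tau_eq hγ H.const))]
  have hdet := (mul_ne_zero_iff.mp htau).2
  set M : Matrix (Fin k) (Fin k) ℂ :=
    Matrix.of fun i s : Fin k => D.psi i (((n + (k - 1) : ℕ) : ℂ) - (s : ℕ)) with hM
  have hM0 : M.det ≠ 0 := by
    intro h0
    refine hdet ?_
    have := Matrix.det_mul_row (fun s : Fin k => D.xi 0 (((n + (k - 1) : ℕ) : ℂ) - (s : ℕ))) M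
    rw [h0, mul_zero] at this
    exact this
  have hz : M.mulVec (x ∘ Fin.rev) = 0 := by
    funext j
    rw [Pi.zero_apply, ← hx j, Matrix.mulVec, dotProduct, ← Equiv.sum_comp Fin.revPerm]
    refine Finset.sum_congr rfl fun s _ => ?_
    rw [Function.comp_apply, Fin.revPerm_apply, Fin.rev_rev, mul_comm, hM, Matrix.of_apply]
    congr 2
    have := s.2
    rw [Fin.val_rev, ← Nat.cast_sub (by omega)]
    congr 1
    omega
  have h := Matrix.eq_zero_of_mulVec_eq_zero hM0 hz
  funext s
  simpa using congrFun h (Fin.rev s)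

/-- Multiplication by `f(2x)`, for `f ∈ 𝔄_z`, preserves the common kernel of the functionals
attached to `ψ^(j)` up to low degrees; hence its matrix in the basis `p̂_n` is banded. -/
theorem Regular.exists_band (H : D.Regular) {ε : ℂ} {f : ℂ[X]} (hf : f ∈ D.algZ ε) :
    ∃ N, ∀ n m : ℕ, m + N < n → H.hatBasis.repr (aeval (2 * X) f * D.pHat n) m = 0 := by
  have h1 : ∀ᶠ n : ℕ in atTop, ∀ j : Fin k, ∃ c : Fin k → ℂ, ∀ m ≥ n,
      aeval D.recOpC f (D.psi j) m = ∑ i, c i * D.psi i m := by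
    refine eventually_all.mpr fun j => ?_
    obtain ⟨c, hc⟩ := exists_aeval_recOpC_psi hf j
    obtain ⟨N, hN⟩ := eventually_atTop.mp hc
    filter_upwards [eventually_ge_atTop N] with n hn
    exact ⟨c, fun m hm => hN m (hn.trans hm)⟩
  obtain ⟨N, hN⟩ := eventually_atTop.mp (h1.and H.eventually_casorati_psi)
  -- With this width all the degrees in question are at least `N`; smaller `n` impose no condition.
  refine ⟨N + 2 * f.natDegree + k, fun n m hm => ?_⟩
  set lo := n - k - f.natDegree with hlo
  refine repr_eq_zero_of_functional (b := H.awBasis) (ψ := fun j m => D.psi j m) (lo := lo)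
    (fun n => by rw [H.awBasis_apply, H.degree_awPoly])
    (fun n => by rw [H.hatBasis_apply, H.degree_pHat])
    (fun n hn m hm => by rw [H.hatBasis_apply, H.repr_pHat (by omega)])
    (fun n hn j => by rw [H.hatBasis_apply, H.functional_psi_pHat j (by omega)])
    (hN lo (by omega)).2
    (repr_aeval_two_mul_X H.awBasis_recurrence f fun m hm => H.repr_pHat (by omega))
    (fun j => ?_) m (by omega)
  have hlow : ∀ m < n - k, H.awBasis.repr (D.pHat n) m = 0 := fun m hm => H.repr_pHat (by omega)
  rw [H.functional_aeval_recOpC f _ fun m hm => hlow m (by omega)]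
  obtain ⟨c, hc⟩ := (hN (n - k) (by omega)).1 j
  rw [linearMap_congr (G := ∑ i, c i • functional H.awBasis (fun m => D.psi i m)) hlow fun m hm => by
    simp only [LinearMap.sum_apply, LinearMap.smul_apply, functional_basis, hc m hm, smul_eq_mul]]
  rw [LinearMap.sum_apply]
  refine Finset.sum_eq_zero fun i _ => ?_
  rw [LinearMap.smul_apply, H.functional_psi_pHat i (by omega), smul_zero]

/-- The operator attached to `f ∈ 𝔄_z` is a difference operator. -/
theorem Regular.isDifferenceOperator (H : D.Regular) {ε : ℂ} {f : ℂ[X]} (hf : f ∈ D.algZ ε) :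
    IsDifferenceOperator (aeval (recurrenceOp H.hatBasis) f) := by
  obtain ⟨N, hN⟩ := H.exists_band hf
  refine isDifferenceOperator_of_band H.hatBasis _ _ (aeval_recurrenceOp_apply H.hatBasis f)
    (N + f.natDegree) (fun n m hm => ?_) (fun n m hm => ?_)
  · refine repr_eq_zero_of_degree_lt (d := n + f.natDegree + 1)
      (fun n => by rw [H.hatBasis_apply, H.degree_pHat]) ?_ (by omega)
    rw [H.hatBasis_apply]
    refine lt_of_le_of_lt degree_le_natDegree ?_
    have h1 : (aeval (2 * X : ℂ[X]) f).natDegree ≤ f.natDegree := by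
      change (f.comp (2 * X)).natDegree ≤ _
      refine natDegree_comp_le.trans ?_
      have : (2 * X : ℂ[X]).natDegree ≤ 1 := by
        rw [show (2 : ℂ[X]) = C 2 from rfl]
        exact (natDegree_C_mul_le _ _).trans natDegree_X_le
      exact (Nat.mul_le_mul_left _ this).trans (mul_one _).le
    have h2 := natDegree_mul_le (p := aeval (2 * X : ℂ[X]) f) (q := D.pHat n)
    rw [natDegree_eq_of_degree_eq_some (H.degree_pHat n)] at h2
    exact_mod_cast Nat.lt_succ_of_le (h2.trans (by omega))
  · rw [H.hatBasis_apply]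
    exact hN n m (by omega)

end Data

/-! ### The two commutative algebras -/

namespace Data
variable {k : ℕ} {D : Data k}

/-- A `q`-difference operator is determined by its values on the polynomials `p̂_n`. -/
theorem Regular.qDiff_ext (H : D.Regular) {S T : Module.End ℂ (RatFunc ℂ)} (hS : S ∈ qDiff D.qU)
    (hT : T ∈ qDiff D.qU) (h : ∀ n, S (D.pHatZ n) = T (D.pHatZ n)) : S = T := by
  rw [← sub_eq_zero]
  refine eq_zero_of_mem_qDiff (fun n => ?_) (sub_mem hS hT) fun p => ?_
  · rw [qU_val]
    exact H.generic.pow_ne n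
  have : (S - T) ∘ₗ zEval.toLinearMap = 0 := H.hatBasis.ext fun n => by
    rw [LinearMap.comp_apply, H.hatBasis_apply]
    exact sub_eq_zero.mpr (h n)
  exact LinearMap.congr_fun this p

theorem zEval_ne_zero {p : ℂ[X]} (hp : p ≠ 0) : zEval p ≠ 0 := by
  intro h
  obtain ⟨c, hc⟩ := (IsAlgClosed.splits p).mem_range_of_isRoot hp (i := algebraMap ℂ (RatFunc ℂ))
    (x := (RatFunc.X + RatFunc.X⁻¹) / 2) (by rw [IsRoot, eval_map_algebraMap]; exact h)
  rw [RatFunc.algebraMap_eq_C] at hc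
  have hX : (RatFunc.X : RatFunc ℂ) ≠ 0 := RatFunc.X_ne_zero
  have e : algebraMap ℂ[X] (RatFunc ℂ) (X ^ 2 + 1) = algebraMap ℂ[X] (RatFunc ℂ) (C (2 * c) * X) := by
    simp only [map_add, map_mul, map_pow, map_one, RatFunc.algebraMap_X, RatFunc.algebraMap_C,
      map_ofNat]
    field_simp at hc
    linear_combination -hc
  have := congrArg (fun p => p.coeff 2) (RatFunc.algebraMap_injective ℂ e)
  simp [coeff_one] at this

/-- The representation of `𝔄_n` by `q`-difference operators in `z`. -/
def Regular.qDiffOp (H : D.Regular) : D.algN →ₐ[ℂ] Module.End ℂ (RatFunc ℂ) :=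
  AlgHom.ofLinearMap
    { toFun := fun h => (H.exists_qDiff h.2).choose
      map_add' := fun g h => H.qDiff_ext (H.exists_qDiff (g + h).2).choose_spec.1
        (add_mem (H.exists_qDiff g.2).choose_spec.1 (H.exists_qDiff h.2).choose_spec.1) fun n => by
          rw [LinearMap.add_apply, (H.exists_qDiff (g + h).2).choose_spec.2,
            (H.exists_qDiff g.2).choose_spec.2, (H.exists_qDiff h.2).choose_spec.2, ← add_smul,
            ← eval_add]
          rfl
      map_smul' := fun s h => H.qDiff_ext (H.exists_qDiff (s • h).2).choose_spec.1
        (Subalgebra.smul_mem _ (H.exists_qDiff h.2).choose_spec.1 s) fun n => by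
          rw [RingHom.id_apply, LinearMap.smul_apply, (H.exists_qDiff (s • h).2).choose_spec.2,
            (H.exists_qDiff h.2).choose_spec.2, smul_smul, ← smul_eq_mul, ← eval_smul]
          rfl }
    (H.qDiff_ext (H.exists_qDiff (1 : D.algN).2).choose_spec.1 (one_mem _) fun n => by
      refine ((H.exists_qDiff (1 : D.algN).2).choose_spec.2 n).trans ?_
      rw [OneMemClass.coe_one, eval_one, one_smul, Module.End.one_apply])
    (fun g h => H.qDiff_ext (H.exists_qDiff (g * h).2).choose_spec.1
      (mul_mem (H.exists_qDiff g.2).choose_spec.1 (H.exists_qDiff h.2).choose_spec.1) fun n => by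
        refine ((H.exists_qDiff (g * h).2).choose_spec.2 n).trans ?_
        change _ = (H.exists_qDiff g.2).choose ((H.exists_qDiff h.2).choose (D.pHatZ n))
        rw [(H.exists_qDiff h.2).choose_spec.2, map_smul, (H.exists_qDiff g.2).choose_spec.2,
          smul_smul, mul_comm, ← eval_mul]
        rfl)

theorem Regular.qDiffOp_mem (H : D.Regular) (h : D.algN) : H.qDiffOp h ∈ qDiff D.qU :=
  (H.exists_qDiff h.2).choose_spec.1

theorem Regular.qDiffOp_pHatZ (H : D.Regular) (h : D.algN) (n : ℕ) :
    H.qDiffOp h (D.pHatZ n) = (h : ℂ[X]).eval (D.lam (n - k / 2)) • D.pHatZ n :=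
  (H.exists_qDiff h.2).choose_spec.2 n

theorem tendsto_norm_lam (s : ℂ) : Tendsto (fun n : ℕ => ‖D.lam (n - s)‖) atTop atTop := by
  have hx0 : Tendsto (fun n : ℕ => D.qpow (n - s)) atTop (𝓝 0) := by
    refine (D.tendsto_pow_mul (D.qpow s)⁻¹).congr fun n => ?_
    rw [qpow_sub, qpow_natCast, div_eq_inv_mul]
  have hx : Tendsto (fun n : ℕ => D.qpow (n - s)) atTop (𝓝[≠] 0) :=
    tendsto_nhdsWithin_iff.mpr ⟨hx0, .of_forall fun n => D.qpow_ne _⟩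
  have h1 : Tendsto (fun n : ℕ => ‖(D.qpow (n - s))⁻¹ - 1‖) atTop atTop := by
    refine tendsto_atTop_mono (fun n => norm_sub_norm_le _ _) ?_
    exact tendsto_atTop_add_const_right _ _ (tendsto_norm_inv_nhdsNE_zero_atTop.comp hx)
  have h2 : Tendsto (fun n : ℕ => ‖1 - D.abcd * D.qpow (n - s) / D.q‖) atTop (𝓝 1) := by
    have := (((hx0.const_mul D.abcd).div_const (D.q : ℂ)).const_sub 1).norm
    simpa using this
  refine (h1.atTop_mul_pos one_pos h2).congr fun n => ?_
  rw [lam_eq, lamX, norm_mul]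

theorem Regular.qDiffOp_injective (H : D.Regular) : Function.Injective H.qDiffOp := by
  rw [injective_iff_map_eq_zero]
  intro h hh
  have h0 : ∀ n : ℕ, (h : ℂ[X]).eval (D.lam (n - k / 2)) = 0 := by
    intro n
    have e := H.qDiffOp_pHatZ h n
    rw [hh, LinearMap.zero_apply] at e
    refine (smul_eq_zero.mp e.symm).resolve_right (zEval_ne_zero ?_)
    rw [← H.hatBasis_apply]
    exact H.hatBasis.ne_zero n
  refine Subtype.ext (?_ : (h : ℂ[X]) = 0)
  rcases le_or_gt (h : ℂ[X]).degree 0 with hd | hd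
  · have e := h0 0
    rw [eq_C_of_degree_le_zero hd, eval_C] at e
    rw [eq_C_of_degree_le_zero hd, e, C_0]
  · have ht := (h : ℂ[X]).tendsto_norm_atTop hd (D.tendsto_norm_lam (k / 2))
    simp only [h0, norm_zero] at ht
    exact absurd ht (not_tendsto_const_atTop _ _)

theorem mul_comm_of_mem_range {A E : Type*} [CommRing A] [Ring E] [Algebra ℂ A] [Algebra ℂ E]
    (F : A →ₐ[ℂ] E) : ∀ S ∈ F.range, ∀ T ∈ F.range, S * T = T * S := by
  rintro _ ⟨x, rfl⟩ _ ⟨y, rfl⟩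
  exact ((map_mul F x y).symm.trans (congrArg F (mul_comm x y))).trans (map_mul F y x)

end Data

end AWExt

end

theorem theorem3p1 {k : ℕ} (D : AWExt.Data k)
    (htau : ∀ n : ℤ, -1 ≤ n → AWExt.NonzeroAt D.tau n)
    (hchi : ∀ n : ℕ,
      AWExt.NonzeroAt (fun γ => D.chi γ * D.xi 0 (γ - k - 1) / D.chi (γ - 1)) n)
    (ε : ℂ) (hε : D.Admissible ε) :
    ∃ (𝔇n : Subalgebra ℂ (Module.End ℂ (ℕ → ℂ)))
      (𝔇z : Subalgebra ℂ (Module.End ℂ (RatFunc ℂ)))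
      (L : D.algZ ε ≃ₐ[ℂ] 𝔇n) (B : D.algN ≃ₐ[ℂ] 𝔇z),
      (∀ f : D.algZ ε, AWExt.IsDifferenceOperator (L f : Module.End ℂ (ℕ → ℂ))) ∧
      (∀ (f : D.algZ ε) (z : ℂ), z ≠ 0 → ∀ n : ℕ,
        (L f : Module.End ℂ (ℕ → ℂ)) (fun m => (D.pHat m).eval ((z + 1 / z) / 2)) n =
          (f : Polynomial ℂ).eval (z + 1 / z) * (D.pHat n).eval ((z + 1 / z) / 2)) ∧
      (∀ S ∈ 𝔇n, ∀ T ∈ 𝔇n, S * T = T * S) ∧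
      (∀ h : D.algN, AWExt.IsQDifferenceOperator D.q (B h : Module.End ℂ (RatFunc ℂ))) ∧
      (∀ (h : D.algN) (n : ℕ),
        (B h : Module.End ℂ (RatFunc ℂ)) (D.pHatZ n) =
          (h : Polynomial ℂ).eval (D.lam (n - k / 2)) • D.pHatZ n) ∧
      (∀ S ∈ 𝔇z, ∀ T ∈ 𝔇z, S * T = T * S) := by
  have H : D.Regular := ⟨htau, hchi⟩
  set F : D.algZ ε →ₐ[ℂ] Module.End ℂ (ℕ → ℂ) :=
    (aeval (AWExt.recurrenceOp H.hatBasis)).comp (D.algZ ε).val with hF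
  have hF' : Function.Injective F := (AWExt.aeval_recurrenceOp_injective H.hatBasis fun n => by
    rw [H.hatBasis_apply, H.degree_pHat]).comp Subtype.val_injective
  refine ⟨F.range, H.qDiffOp.range, AlgEquiv.ofInjective F hF',
    AlgEquiv.ofInjective H.qDiffOp H.qDiffOp_injective, fun f => H.isDifferenceOperator f.2,
    fun f z _ n => ?_, AWExt.Data.mul_comm_of_mem_range F,
    fun h => AWExt.isQDifferenceOperator_of_mem D.qU_val (H.qDiffOp_mem h), H.qDiffOp_pHatZ,
    AWExt.Data.mul_comm_of_mem_range _⟩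
  have h := AWExt.aeval_recurrenceOp_eval H.hatBasis f ((z + 1 / z) / 2) n
  simp only [H.hatBasis_apply] at h
  rw [mul_div_cancel₀ _ (two_ne_zero' ℂ)] at h
  exact h
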